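/- **Setting.** Let $L,R\ge 0$ be random variables with $\mathbb E[L^\alpha+R^\alpha]=1$ for some $\alpha\in(0,2]$, and put $\mathcal S(s)=\mathbb E[L^s+R^s]-1$. Let $X_0$ be a real random variable with distribution function $F_0$. On some probability space let the following four families be given and independent of each other: $(X_n)_{n\ge1}$ i.i.d. with distribution function $F_0$; $((L_n,R_n))_{n\ge1}$ i.i.d. copies of $(L,R)$; $(I_n)_{n\ge1}$ independent, $I_n$ uniform on $\{1,\dots,n\}$; and $(\nu_t)_{t\ge0}$ with $P\{\nu_t=n\}=e^{-t}(1-e^{-t})^{n-1}$ for $n\ge1$. Define weights by $\beta_{1,1}=1$ and, for $n\ge1$, $$(\beta_{1,n+1},\dots,\beta_{n+1,n+1})=(\beta_{1,n},\dots,\beta_{I_n-1,n},\,L_n\beta_{I_n,n},\,R_n\beta_{I_n,n},\,\beta_{I_n+1,n},\dots,\beta_{n,n}),$$ and set $V_t=\sum_{j=1}^{\nu_t}\beta_{j,\nu_t}X_j$. (The characteristic function $\phi(t;\cdot)$ of $V_t$ solves $\partial_t\phi(t;\xi)+\phi(t;\xi)=\mathbb E[\phi(t;L\xi)\phi(t;R\xi)]$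 with $\phi(0;\xi)=\mathbb E[e^{i\xi X_0}]$.) For $\gamma>0$ let $$\mathcal W_\gamma(X,Y)=\inf_{(X',Y')}\big(\mathbb E|X'-Y'|^\gamma\big)^{1/\max(\gamma,1)}\in[0,\infty],$$ the infimum being over all pairs $(X',Y')$ in which $X'$ has the law of $X$ and $Y'$ has the law of $Y$. **Lemma.** Suppose that $\mathcal S(\gamma)<0$ for some $\gamma$ with $1\le\alpha<\gamma\le2$ or $\alpha<\gamma\le1$, that $\gamma<2\alpha$, that $\mathbb E[X_0]=0$ if $\alpha>1$, and that $\mathbb E|X_0|^\gamma<\infty$ if $\alpha=1$. Suppose further that there are real constants $c^+,c^-\ge0$, $K>0$ and $0<\epsilon<1$ with $$|1-c^+x^{-\alpha}-F_0(x)|<Kx^{-(\alpha+\epsilon)}\quad(x>0),\qquad |F_0(x)-c^-(-x)^{-\alpha}|<K(-x)^{-(\alpha+\epsilon)}\quad(x<0),$$ and, in the case $\alpha>1$, that $c^+>0$ and $c^->0$, or else that $\gamma<\alpha+\epsilon$. If $\gamma<\alpha/(1-\epsilon)$, then $V_t$ converges in distribution as $t\to+\infty$ to a limit $V_\infty$ with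 $$\mathcal W_\gamma(X_0,V_\infty)<\infty,$$ and so the exponential estimate $$\mathcal W_\gamma(V_t,V_\infty)\le A\,\mathcal W_\gamma(X_0,V_\infty)\,e^{-Bt|\mathcal S(\gamma)|}\qquad(t\ge0),$$ with $A=B=1$ if $\gamma\le1$, and $A=2^{1/\gamma}$, $B=1/\gamma$ otherwise, holds with a finite right-hand side. -/

import Mathlib

open MeasureTheory ProbabilityTheory Filter
open scoped ENNReal NNReal Topology

namespace KacModel

/-- Real power with the convention `0 ^ 0 = 0` (so `0 ^ s = 0` for every `s ≥ 0`). -/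
noncomputable def powZ (x s : ℝ) : ℝ := if x = 0 then 0 else x ^ s

/-- `S(s) = E[L^s + R^s] - 1 ∈ [-1, ∞]`, for non-negative random variables `L`, `R`. -/
noncomputable def S {Ω : Type*} [MeasurableSpace Ω] (P : Measure Ω) (L R : Ω → ℝ) (s : ℝ) :
    EReal :=
  ((∫⁻ ω, ENNReal.ofReal (powZ (L ω) s + powZ (R ω) s) ∂P : ℝ≥0∞) : EReal) - 1

/-- The weights of the leaves of a McKean tree. After `n` collisions the tree has `n + 1` leaves,
numbered `0, …, n` from the left, and `weight l r i n j` is the weight `β_{j+1,n+1}` of leaf `j`.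
The collision number `n` replaces the leaf `i n ∈ {0, …, n}` by two leaves, whose weights are
obtained through multiplication by `l n` (left) and `r n` (right):
`(β_0, …, β_{i-1}, l β_i, r β_i, β_{i+1}, …, β_n)`. -/
noncomputable def weight (l r : ℕ → ℝ) (i : ℕ → ℕ) : ℕ → ℕ → ℝ
  | 0, j => if j = 0 then 1 else 0
  | n + 1, j =>
    if j < i n then weight l r i n j
    else if j = i n then l n * weight l r i n (i n)
    else if j = i n + 1 then r n * weight l r i n (i n)
    else weight l r i n (j - 1)

/-- The weighted sum `W_{n+1} = ∑_{j=1}^{n+1} β_{j,n+1} X_j` over the `n + 1` leaves of the tree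
after `n` collisions (`X j` here is the variable attached to leaf number `j = 0, …, n`). -/
noncomputable def W {Ω : Type*} (X L R : ℕ → Ω → ℝ) (I : ℕ → Ω → ℕ) (n : ℕ) (ω : Ω) : ℝ :=
  ∑ j ∈ Finset.range (n + 1),
    weight (fun k => L k ω) (fun k => R k ω) (fun k => I k ω) n j * X j ω

/-- The random variable `V_t`: the sum `W` evaluated at the random number `N t = ν_t - 1` of
collisions that have taken place up to time `t` (so the tree has `ν_t` leaves). -/
noncomputable def V {Ω : Type*} (X L R : ℕ → Ω → ℝ) (I : ℕ → Ω → ℕ) (N : ℝ≥0 → Ω → ℕ)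
    (t : ℝ≥0) (ω : Ω) : ℝ :=
  W X L R I (N t ω) ω

/-- The probabilistic data behind `V_t`, for an initial law `μ₀` and a law `ρ` of `(L, R)`:
`X` is i.i.d. with law `μ₀`; `(L, R)` is i.i.d. with law `ρ`; the `I n` are independent and `I n`
is uniform on the `n + 1` leaves `{0, …, n}`; `N t + 1` is geometric,
`P(N t = n) = e^{-t} (1 - e^{-t})^n`; and the four families are stochastically independent. -/
structure IsMcKeanSystem {Ω : Type*} [MeasurableSpace Ω] (P : Measure Ω)
    (μ₀ : Measure ℝ) (ρ : Measure (ℝ × ℝ))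
    (X L R : ℕ → Ω → ℝ) (I : ℕ → Ω → ℕ) (N : ℝ≥0 → Ω → ℕ) : Prop where
  measurable_X : ∀ n, Measurable (X n)
  measurable_L : ∀ n, Measurable (L n)
  measurable_R : ∀ n, Measurable (R n)
  measurable_I : ∀ n, Measurable (I n)
  measurable_N : ∀ t, Measurable (N t)
  law_X : ∀ n, P.map (X n) = μ₀
  iIndepFun_X : iIndepFun X P
  law_LR : ∀ n, P.map (fun ω => (L n ω, R n ω)) = ρ
  iIndepFun_LR : iIndepFun (fun n ω => (L n ω, R n ω)) P
  law_I : ∀ n, ∀ i ≤ n, P {ω | I n ω = i} = ((n : ℝ≥0∞) + 1)⁻¹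
  iIndepFun_I : iIndepFun I P
  law_N : ∀ (t : ℝ≥0) (n : ℕ),
    P {ω | N t ω = n} =
      ENNReal.ofReal (Real.exp (-(t : ℝ)) * (1 - Real.exp (-(t : ℝ))) ^ n)
  iIndep_families : iIndep
    ![⨆ n, MeasurableSpace.comap (I n) inferInstance,
      ⨆ n, MeasurableSpace.comap (fun ω => (L n ω, R n ω)) inferInstance,
      ⨆ n, MeasurableSpace.comap (X n) inferInstance,
      ⨆ t, MeasurableSpace.comap (N t) inferInstance] P

/-- The Wasserstein distance of order `γ > 0` between two probability laws on the line: the infimum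
of `(E|X' - Y'|^γ)^(1 / max(γ, 1)) ∈ [0, ∞]` over all pairs `(X', Y')`, represented by their joint
law `π`, with marginal laws `μ` and `ν`. -/
noncomputable def wasserstein (γ : ℝ) (μ ν : Measure ℝ) : ℝ≥0∞ :=
  ⨅ (π : Measure (ℝ × ℝ)) (_ : π.map Prod.fst = μ ∧ π.map Prod.snd = ν),
    (∫⁻ z, ENNReal.ofReal (|z.1 - z.2| ^ γ) ∂π) ^ (1 / max γ 1)

end KacModel

/-!
The law of `V_t` is driven by the smoothing transformation `T μ = law (L X₁ + R X₂)`, with `X₁` and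
`X₂` independent of law `μ`. Everything rests on one inequality, `GrowthBound`: if `δ` is a law with
`γ`-th moment `m`, centred when `γ > 1`, then `E |s + Y| ^ γ ≤ |s| ^ γ + C` for `Y` of law `δ`, with
`C = m` for `γ ≤ 1` and `C = 2 m` for `1 < γ ≤ 2`. The constants `C` add up over independent
summands and scale by `|l| ^ γ` under multiplication by `l`. Applied to the difference of two
coupled variables, this makes `T` contract by `κ = E [L ^ γ + R ^ γ] = 1 + S(γ) < 1`, and the factor
`2` is paid once only, not at every step.

*The first step is at finite distance* (`finiteDist_smooth_of_tails`). The coupling of the quantile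
functions shows that a law with the given tails is at finite distance from a law with exact power
tails, that of `Y = (c⁺ / (1 - U)) ^ (1 / α)` for `U > 1/2`, `Y = -(c⁻ / U) ^ (1 / α)` for
`U ≤ 1/2`, where `U` is uniform on `(0, 1)`. It remains to see that the law of `Y` is at finite
distance from the law of `L Y₁ + R Y₂`. The latter is close to the law of the one of `L Y₁`, `R Y₂`
with the larger modulus: the error is the term with the smaller modulus, whose `γ`-th power is at
most `|L Y₁| ^ (γ / 2) * |R Y₂| ^ (γ / 2)`, and `γ < 2 α`. The laws of the larger and of the smaller
term add up to the laws of `L Y₁` and `R Y₂`. Up to a measure with finite `γ`-th moment the law of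
`Y` is a measure `Λ` homogeneous of degree `-α`, and the images of `Λ` under multiplication by `L`
and by `R` add up to `Λ`, because `E [L ^ α + R ^ α] = 1`. Finally, two laws that differ off the
origin only by measures with finite `γ`-th moments are at finite distance (`finiteDist_of_add_eq`).
For `α = 1` the moment hypothesis gives the finite distance directly.

*The limit* (`exists_smooth_fixedPoint`). By the contraction, the iterates of `T` applied to a
coupling of the initial law with its image have geometrically decreasing costs. Realised as the
consecutive pairs of a Markov chain, they give an almost sure limit, whose law `ν` is a fixed point
of `T` at finite distance from the initial law, with the same mean if `γ > 1`.

*The estimate* (`IsMcKeanSystem.exists_coupling`). Put independent copies of a coupling of the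
initial law with `ν` on the leaves of the McKean tree. The first coordinates give `V_t`. The second
ones give `ν` again: splitting a leaf does not change the expected product of characteristic
functions, as `ν` is a fixed point. The cost of the coupling obtained in this way is at most `C`
times the expected sum of the `γ`-th powers of the weights. This expectation is multiplied by
`1 + (κ - 1) / n` when a tree with `n` leaves grows by one, and summing against the geometric law of
the number of leaves gives the factor `e ^ (t (κ - 1))`, from the binomial series of
`(1 - z) ^ (-κ)`.
-/

namespace KacModel

/-! ### Elementary inequalities for powers of order at most two -/

lemma ofReal_abs_rpow {γ : ℝ} (hγ : 0 ≤ γ) (x : ℝ) :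
    ENNReal.ofReal (|x| ^ γ) = ‖x‖ₑ ^ γ := by
  rw [← ENNReal.ofReal_rpow_of_nonneg (abs_nonneg x) hγ, ← Real.norm_eq_abs, ofReal_norm]

/-- Minkowski's inequality for `γ ≥ 1`, subadditivity of `x ↦ x ^ γ` for `γ ≤ 1`. -/
lemma rpow_one_div_max_add_le {γ : ℝ} {Ω : Type*} [MeasurableSpace Ω] {μ : Measure Ω}
    {f g : Ω → ℝ≥0∞} (hγ : 0 < γ) (hf : Measurable f) (hg : Measurable g) :
    (∫⁻ ω, (f ω + g ω) ^ γ ∂μ) ^ (1 / max γ 1) ≤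
      (∫⁻ ω, f ω ^ γ ∂μ) ^ (1 / max γ 1) + (∫⁻ ω, g ω ^ γ ∂μ) ^ (1 / max γ 1) := by
  rcases le_total 1 γ with h | h
  · rw [max_eq_left h]
    exact ENNReal.lintegral_Lp_add_le hf.aemeasurable hg.aemeasurable h
  · rw [max_eq_right h]
    simp only [div_one, ENNReal.rpow_one]
    rw [← lintegral_add_left (by fun_prop)]
    exact lintegral_mono fun ω => ENNReal.rpow_add_le_add_rpow _ _ hγ.le h

lemma lintegral_add_rpow_lt_top {γ : ℝ} {Ω : Type*} [MeasurableSpace Ω] {μ : Measure Ω}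
    {f g : Ω → ℝ≥0∞} (hγ : 0 < γ) (hf : Measurable f) (hg : Measurable g)
    (hf' : ∫⁻ ω, f ω ^ γ ∂μ < ∞) (hg' : ∫⁻ ω, g ω ^ γ ∂μ < ∞) :
    ∫⁻ ω, (f ω + g ω) ^ γ ∂μ < ∞ := by
  have hm : 0 < 1 / max γ 1 := by positivity
  have := rpow_one_div_max_add_le (μ := μ) hγ hf hg
  rw [← ENNReal.rpow_lt_top_iff_of_pos hm] at hf' hg' ⊢
  exact this.trans_lt (ENNReal.add_lt_top.2 ⟨hf', hg'⟩)

lemma integrable_of_lintegral_rpow_lt_top {γ : ℝ} (hγ : 1 ≤ γ) {Ω : Type*} [MeasurableSpace Ω]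
    {μ : Measure Ω} [IsFiniteMeasure μ] {f : Ω → ℝ} (hf : Measurable f)
    (h : ∫⁻ ω, ‖f ω‖ₑ ^ γ ∂μ < ∞) : Integrable f μ := by
  refine ⟨hf.aestronglyMeasurable, ?_⟩
  have h1 : ∫⁻ ω, (1 + ‖f ω‖ₑ ^ γ) ∂μ < ∞ := by
    rw [lintegral_add_left (by fun_prop), lintegral_const, one_mul]
    exact ENNReal.add_lt_top.2 ⟨measure_lt_top _ _, h⟩
  refine lt_of_le_of_lt (lintegral_mono fun ω => ?_) h1
  rcases le_total ‖f ω‖ₑ 1 with h | h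
  · exact h.trans le_self_add
  · refine le_trans ?_ le_add_self
    exact (ENNReal.rpow_one _).symm.trans_le (ENNReal.rpow_le_rpow_of_exponent_le h hγ)

/-- First-order expansion of `|s + x| ^ γ` with remainder `2 |x| ^ γ`, for increments `x ≥ 0`: the
derivative of the difference of the two sides in `x` has a sign. -/
lemma abs_add_rpow_le_of_nonneg {γ : ℝ} (h1 : 1 < γ) (h2 : γ ≤ 2) (s : ℝ) {x : ℝ} (hx : 0 ≤ x) :
    |s + x| ^ γ ≤ |s| ^ γ + γ * |s| ^ (γ - 2) * s * x + 2 * |x| ^ γ := by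
  -- `|y| ^ (γ - 2) * y` is the signed power of order `γ - 1 ∈ (0, 1]`
  have sp : ∀ y : ℝ, 0 ≤ y → |y| ^ (γ - 2) * y = y ^ (γ - 1) := by
    intro y hy
    rcases hy.eq_or_lt with rfl | hy
    · rw [mul_zero, Real.zero_rpow (by linarith)]
    · rw [abs_of_pos hy, show γ - 1 = (γ - 2) + 1 by ring, Real.rpow_add_one hy.ne']
  have sn : ∀ y : ℝ, y ≤ 0 → |y| ^ (γ - 2) * y = -(-y) ^ (γ - 1) := by
    intro y hy
    have := sp (-y) (by linarith)
    rw [abs_neg] at this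
    linarith
  have hp0 : 0 ≤ γ - 1 := by linarith
  have hp1 : γ - 1 ≤ 1 := by linarith
  let h : ℝ → ℝ := fun u => |s + u| ^ γ - γ * |s| ^ (γ - 2) * s * u - 2 * |u| ^ γ
  have hd : ∀ u, HasDerivAt h (γ * |s + u| ^ (γ - 2) * (s + u) - γ * |s| ^ (γ - 2) * s
      - 2 * (γ * |u| ^ (γ - 2) * u)) u := by
    intro u
    have a := (hasDerivAt_abs_rpow (s + u) h1).comp_const_add s u
    have b := (hasDerivAt_id u).const_mul (γ * |s| ^ (γ - 2) * s)
    have c := (hasDerivAt_abs_rpow u h1).const_mul 2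
    have d := (a.sub b).sub c
    simp only [mul_one, ← mul_assoc] at d
    simpa only [h, Pi.sub_def, id, ← mul_assoc] using d
  have key : ∀ u, 0 ≤ u → |s + u| ^ (γ - 2) * (s + u) - |s| ^ (γ - 2) * s ≤ 2 * u ^ (γ - 1) := by
    intro u hu
    have hu' : 0 ≤ u ^ (γ - 1) := Real.rpow_nonneg hu _
    rcases le_total 0 s with hs | hs
    · rw [sp s hs, sp (s + u) (by linarith)]
      have := Real.rpow_add_le_add_rpow hs hu hp0 hp1
      linarith
    · rcases le_total 0 (s + u) with hsu | hsu
      · rw [sn s hs, sp (s + u) hsu]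
        have e1 := Real.rpow_le_rpow hsu (show s + u ≤ u by linarith) hp0
        have e2 := Real.rpow_le_rpow (show 0 ≤ -s by linarith) (show -s ≤ u by linarith) hp0
        linarith
      · rw [sn s hs, sn (s + u) hsu]
        have := Real.rpow_add_le_add_rpow (show 0 ≤ -(s + u) by linarith) hu hp0 hp1
        rw [show -(s + u) + u = -s by ring] at this
        linarith
  have anti : AntitoneOn h (Set.Ici 0) := by
    refine antitoneOn_of_deriv_nonpos (convex_Ici 0)
      (fun u _ => (hd u).continuousAt.continuousWithinAt)
      (fun u _ => (hd u).differentiableAt.differentiableWithinAt) fun u hu => ?_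
    rw [interior_Ici] at hu
    have hu : (0 : ℝ) < u := hu
    rw [(hd u).deriv]
    have k := key u hu.le
    have e := sp u hu.le
    have : γ * |s + u| ^ (γ - 2) * (s + u) - γ * |s| ^ (γ - 2) * s - 2 * (γ * |u| ^ (γ - 2) * u)
        = γ * (|s + u| ^ (γ - 2) * (s + u) - |s| ^ (γ - 2) * s - 2 * (|u| ^ (γ - 2) * u)) := by
      ring
    rw [this, e]
    exact mul_nonpos_of_nonneg_of_nonpos (by linarith) (by linarith)
  have := anti (Set.mem_Ici.2 le_rfl) (Set.mem_Ici.2 hx) hx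
  simp only [h, add_zero, mul_zero, sub_zero, abs_zero,
    Real.zero_rpow (show γ ≠ 0 by linarith)] at this
  linarith

lemma abs_add_rpow_le {γ : ℝ} (h1 : 1 < γ) (h2 : γ ≤ 2) (s x : ℝ) :
    |s + x| ^ γ ≤ |s| ^ γ + γ * |s| ^ (γ - 2) * s * x + 2 * |x| ^ γ := by
  rcases le_total 0 x with hx | hx
  · exact abs_add_rpow_le_of_nonneg h1 h2 s hx
  · have := abs_add_rpow_le_of_nonneg h1 h2 (-s) (x := -x) (by linarith)
    rw [show -s + -x = -(s + x) by ring, abs_neg, abs_neg, abs_neg] at this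
    linarith

/-! ### Growth bounds -/

/-- The law `δ` satisfies `E |s + D| ^ γ ≤ |s| ^ γ + C` for every real `s`. The least such `C`
dominates `E |D| ^ γ`, is comparable with it (for centred `D` if `γ > 1`), and, unlike
`E |D| ^ γ` itself when `γ > 1`, is subadditive over sums of independent variables without any
loss of a constant. -/
def GrowthBound (γ : ℝ) (δ : Measure ℝ) (C : ℝ≥0∞) : Prop :=
  ∀ s : ℝ, ∫⁻ x, ‖s + x‖ₑ ^ γ ∂δ ≤ ‖s‖ₑ ^ γ + C

lemma GrowthBound.lintegral_le {γ : ℝ} (hγ : 0 < γ) {δ : Measure ℝ} {C : ℝ≥0∞}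
    (h : GrowthBound γ δ C) : ∫⁻ x, ‖x‖ₑ ^ γ ∂δ ≤ C := by
  simpa [hγ] using h 0

lemma GrowthBound.of_le_one {γ : ℝ} (hγ : 0 < γ) (h1 : γ ≤ 1) (δ : Measure ℝ)
    [IsProbabilityMeasure δ] : GrowthBound γ δ (∫⁻ x, ‖x‖ₑ ^ γ ∂δ) := by
  intro s
  calc ∫⁻ x, ‖s + x‖ₑ ^ γ ∂δ ≤ ∫⁻ x, (‖s‖ₑ ^ γ + ‖x‖ₑ ^ γ) ∂δ := by
        refine lintegral_mono fun x => ?_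
        exact (ENNReal.rpow_le_rpow (enorm_add_le s x) hγ.le).trans
          (ENNReal.rpow_add_le_add_rpow _ _ hγ.le h1)
    _ = _ := by rw [lintegral_add_left (by fun_prop)]; simp

/-- For a centred law the first-order term of the expansion of `|s + x| ^ γ` integrates to zero. -/
lemma GrowthBound.of_centred {γ : ℝ} (h1 : 1 < γ) (h2 : γ ≤ 2) (δ : Measure ℝ)
    [IsProbabilityMeasure δ] (hc : ∫ x, x ∂δ = 0) :
    GrowthBound γ δ (2 * ∫⁻ x, ‖x‖ₑ ^ γ ∂δ) := by
  intro s
  have hγ : 0 < γ := by linarith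
  by_cases hfin : ∫⁻ x, ‖x‖ₑ ^ γ ∂δ = ∞
  · simp [hfin]
  have i1 : Integrable (fun x : ℝ => |x| ^ γ) δ := by
    refine ⟨(Measurable.pow_const (by fun_prop) γ).aestronglyMeasurable, ?_⟩
    rw [hasFiniteIntegral_iff_ofReal (ae_of_all _ fun x => by positivity)]
    simp only [ofReal_abs_rpow hγ.le]
    exact lt_top_iff_ne_top.2 hfin
  have i2 : Integrable (fun x : ℝ => x) δ :=
    integrable_of_lintegral_rpow_lt_top h1.le measurable_id (lt_top_iff_ne_top.2 hfin)
  have i3 : Integrable (fun x : ℝ => |s| ^ γ + γ * |s| ^ (γ - 2) * s * x + 2 * |x| ^ γ) δ :=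
    ((integrable_const _).add (i2.const_mul _)).add (i1.const_mul _)
  have i0 : Integrable (fun x : ℝ => |s + x| ^ γ) δ :=
    i3.mono' (Measurable.pow_const (by fun_prop) γ).aestronglyMeasurable (ae_of_all _ fun x => by
      rw [Real.norm_of_nonneg (by positivity)]; exact abs_add_rpow_le h1 h2 s x)
  have e : ∫ x, |s + x| ^ γ ∂δ ≤ |s| ^ γ + 2 * ∫ x, |x| ^ γ ∂δ := by
    refine (integral_mono i0 i3 fun x => abs_add_rpow_le h1 h2 s x).trans_eq ?_
    rw [integral_add (f := fun x : ℝ => |s| ^ γ + γ * |s| ^ (γ - 2) * s * x)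
      ((integrable_const _).add (i2.const_mul _)) (i1.const_mul _),
      integral_add (integrable_const _) (i2.const_mul _), integral_const_mul,
      integral_const_mul, hc]
    simp
  have e' := ENNReal.ofReal_le_ofReal e
  rw [ofReal_integral_eq_lintegral_ofReal i0 (ae_of_all _ fun x => by positivity),
    ENNReal.ofReal_add (by positivity)
      (mul_nonneg zero_le_two (integral_nonneg fun x => by positivity)),
    ENNReal.ofReal_mul zero_le_two,
    ofReal_integral_eq_lintegral_ofReal i1 (ae_of_all _ fun x => by positivity)] at e'
  simpa only [ofReal_abs_rpow hγ.le, ENNReal.ofReal_ofNat] using e'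

lemma GrowthBound.scaled {γ : ℝ} (hγ : 0 < γ) {δ : Measure ℝ} [IsProbabilityMeasure δ] {C : ℝ≥0∞}
    (h : GrowthBound γ δ C) (l s : ℝ) :
    ∫⁻ x, ‖s + l * x‖ₑ ^ γ ∂δ ≤ ‖s‖ₑ ^ γ + ‖l‖ₑ ^ γ * C := by
  rcases eq_or_ne l 0 with rfl | hl
  · simp
  have e : ∀ x, ‖s + l * x‖ₑ ^ γ = ‖l‖ₑ ^ γ * ‖s / l + x‖ₑ ^ γ := by
    intro x
    rw [← ENNReal.mul_rpow_of_nonneg _ _ hγ.le, ← enorm_mul]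
    congr 2
    field_simp
  simp_rw [e]
  rw [lintegral_const_mul _ (by fun_prop)]
  refine (mul_le_mul_right (h (s / l)) _).trans_eq ?_
  rw [mul_add, ← ENNReal.mul_rpow_of_nonneg _ _ hγ.le, ← enorm_mul]
  congr 3
  field_simp

/-! ### Couplings -/

/-- `π` is the joint law of a pair with marginal laws `μ` and `ν`. -/
def IsCoupling (π : Measure (ℝ × ℝ)) (μ ν : Measure ℝ) : Prop :=
  π.map Prod.fst = μ ∧ π.map Prod.snd = ν

/-- The transport cost `E |X' - Y'| ^ γ` of a joint law. -/
noncomputable def cost (γ : ℝ) (π : Measure (ℝ × ℝ)) : ℝ≥0∞ := ∫⁻ z, ‖z.1 - z.2‖ₑ ^ γ ∂π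

/-- Two laws are at finite Wasserstein distance of order `γ` when they have a coupling of finite
cost. -/
def FiniteDist (γ : ℝ) (μ ν : Measure ℝ) : Prop := ∃ π, IsCoupling π μ ν ∧ cost γ π < ∞

lemma IsCoupling.isProbabilityMeasure {π : Measure (ℝ × ℝ)} {μ ν : Measure ℝ}
    (h : IsCoupling π μ ν) [hμ : IsProbabilityMeasure μ] : IsProbabilityMeasure π := by
  constructor
  have := hμ.measure_univ
  rwa [← h.1, Measure.map_apply measurable_fst .univ, Set.preimage_univ] at this

lemma isCoupling_map {Ω : Type*} [MeasurableSpace Ω] {Q : Measure Ω} {f g : Ω → ℝ}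
    (hf : Measurable f) (hg : Measurable g) :
    IsCoupling (Q.map fun ω => (f ω, g ω)) (Q.map f) (Q.map g) :=
  ⟨by rw [Measure.map_map (by fun_prop) (by fun_prop)]; rfl,
    by rw [Measure.map_map (by fun_prop) (by fun_prop)]; rfl⟩

lemma cost_map {Ω : Type*} [MeasurableSpace Ω] {Q : Measure Ω} {f g : Ω → ℝ} (γ : ℝ)
    (hf : Measurable f) (hg : Measurable g) :
    cost γ (Q.map fun ω => (f ω, g ω)) = ∫⁻ ω, ‖f ω - g ω‖ₑ ^ γ ∂Q := by
  rw [cost, lintegral_map (by fun_prop) (by fun_prop)]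

lemma finiteDist_map {Ω : Type*} [MeasurableSpace Ω] {Q : Measure Ω} {f g : Ω → ℝ} {γ : ℝ}
    (hf : Measurable f) (hg : Measurable g) (h : ∫⁻ ω, ‖f ω - g ω‖ₑ ^ γ ∂Q < ∞) :
    FiniteDist γ (Q.map f) (Q.map g) :=
  ⟨_, isCoupling_map hf hg, by rwa [cost_map γ hf hg]⟩

lemma FiniteDist.symm {γ : ℝ} {μ ν : Measure ℝ} (h : FiniteDist γ μ ν) : FiniteDist γ ν μ := by
  obtain ⟨π, ⟨rfl, rfl⟩, hc⟩ := h
  refine finiteDist_map measurable_snd measurable_fst ?_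
  simpa only [cost, enorm_sub_rev] using hc

lemma map_compProd_comap {α β δ : Type*} [MeasurableSpace α] [MeasurableSpace β]
    [MeasurableSpace δ] (μ : Measure α) [SFinite μ] (κ : Kernel β δ) [IsSFiniteKernel κ]
    {f : α → β} (hf : Measurable f) :
    (μ ⊗ₘ κ.comap f hf).map (Prod.map f id) = μ.map f ⊗ₘ κ := by
  ext s hs
  rw [Measure.map_apply (by fun_prop) hs,
    Measure.compProd_apply ((by fun_prop : Measurable (Prod.map f (id : δ → δ))) hs),
    Measure.compProd_apply hs, lintegral_map (Kernel.measurable_kernel_prodMk_left hs) hf]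
  rfl

/-- Two couplings with a common marginal law are realised on one probability space. -/
lemma exists_gluing (π₁ π₂ : Measure (ℝ × ℝ)) [IsProbabilityMeasure π₁] [IsProbabilityMeasure π₂]
    (h : π₁.map Prod.snd = π₂.map Prod.fst) :
    ∃ M : Measure ((ℝ × ℝ) × ℝ), IsProbabilityMeasure M ∧ M.map Prod.fst = π₁ ∧
      M.map (fun w => (w.1.2, w.2)) = π₂ := by
  refine ⟨π₁ ⊗ₘ π₂.condKernel.comap Prod.snd measurable_snd, inferInstance,
    Measure.fst_compProd _ _, ?_⟩
  rw [show (fun w : (ℝ × ℝ) × ℝ => (w.1.2, w.2)) = Prod.map Prod.snd id from rfl,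
    map_compProd_comap, h]
  exact π₂.disintegrate π₂.condKernel

lemma FiniteDist.trans {γ : ℝ} (hγ : 0 < γ) {μ ν ξ : Measure ℝ} [IsProbabilityMeasure μ]
    [IsProbabilityMeasure ν] (h₁ : FiniteDist γ μ ν) (h₂ : FiniteDist γ ν ξ) :
    FiniteDist γ μ ξ := by
  obtain ⟨π₁, c₁, hc₁⟩ := h₁
  obtain ⟨π₂, c₂, hc₂⟩ := h₂
  have := c₁.isProbabilityMeasure
  have := c₂.isProbabilityMeasure
  obtain ⟨M, -, hM₁, hM₂⟩ := exists_gluing π₁ π₂ (c₁.2.trans c₂.1.symm)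
  have e₁ : M.map (fun w => w.1.1) = μ := by
    rw [← c₁.1, ← hM₁, Measure.map_map (by fun_prop) (by fun_prop)]; rfl
  have e₂ : M.map (fun w => w.2) = ξ := by
    rw [← c₂.2, ← hM₂, Measure.map_map (by fun_prop) (by fun_prop)]; rfl
  rw [← e₁, ← e₂]
  refine finiteDist_map (by fun_prop) (by fun_prop) ?_
  rw [← hM₁, cost, lintegral_map (by fun_prop) (by fun_prop)] at hc₁
  rw [← hM₂, cost, lintegral_map (by fun_prop) (by fun_prop)] at hc₂
  refine (lintegral_mono fun w => ENNReal.rpow_le_rpow ?_ hγ.le).trans_lt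
    (lintegral_add_rpow_lt_top hγ (by fun_prop) (by fun_prop) hc₁ hc₂)
  simpa using enorm_add_le (w.1.1 - w.1.2) (w.1.2 - w.2)

/-- A sequence of couplings, each with the second marginal law of its predecessor as its first
marginal law, is realised by the consecutive pairs of one random sequence (a Markov chain). -/
lemma exists_chain (π : ℕ → Measure (ℝ × ℝ)) [∀ n, IsProbabilityMeasure (π n)]
    (h : ∀ n, (π n).map Prod.snd = (π (n + 1)).map Prod.fst) :
    ∃ M : Measure (ℕ → ℝ), IsProbabilityMeasure M ∧
      ∀ n, M.map (fun z => (z n, z (n + 1))) = π n := by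
  -- a step of the chain follows the conditional law of the second coordinate of `π n` given the
  -- first one
  let ev : ∀ n : ℕ, ((i : Finset.Iic n) → ℝ) → ℝ := fun n x => x ⟨n, Finset.mem_Iic.2 (le_refl n)⟩
  have hev : ∀ n, Measurable (ev n) := fun n => measurable_pi_apply _
  let κ : (n : ℕ) → Kernel ((i : Finset.Iic n) → ℝ) ℝ := fun n =>
    (π n).condKernel.comap (ev n) (hev n)
  have : IsProbabilityMeasure ((π 0).map Prod.fst) :=
    Measure.isProbabilityMeasure_map measurable_fst.aemeasurable
  let M : Measure (ℕ → ℝ) := Kernel.trajMeasure (X := fun _ => ℝ) ((π 0).map Prod.fst) κ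
  have hM : IsProbabilityMeasure M := inferInstance
  have step : ∀ n, M.map (fun z => z n) = (π n).map Prod.fst →
      M.map (fun z => (z n, z (n + 1))) = π n := by
    intro n hn
    have e := Kernel.map_frestrictLe_trajMeasure_compProd_eq_map_trajMeasure
      (X := fun _ => ℝ) (κ := κ) (μ₀ := (π 0).map Prod.fst) (a := n)
    have e' := congrArg (fun m => m.map (Prod.map (ev n) id)) e
    rw [map_compProd_comap, Measure.map_map (by fun_prop) (by fun_prop),
      Measure.map_map (by fun_prop) (by fun_prop)] at e'
    change _ = M.map (fun z => (z n, z (n + 1))) at e'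
    rw [← e']
    change (M.map fun z => z n) ⊗ₘ _ = _
    rw [hn]
    exact (π n).disintegrate (π n).condKernel
  have h0 : M.map (fun z => z 0) = (π 0).map Prod.fst := by
    have e : M.map (Preorder.frestrictLe (π := fun _ => ℝ) 0) = ((π 0).map Prod.fst).map
        (MeasurableEquiv.piUnique fun _ : Finset.Iic 0 => ℝ).symm := by
      simp only [M, Kernel.trajMeasure]
      rw [Measure.map_comp _ _ (by fun_prop), Kernel.traj_map_frestrictLe,
        Kernel.partialTraj_self, Measure.id_comp]
    have e' := congrArg (fun m => m.map (ev 0)) e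
    rw [Measure.map_map (by fun_prop) (by fun_prop), Measure.map_map (by fun_prop) (by fun_prop)]
      at e'
    exact e'.trans Measure.map_id
  have all : ∀ n, M.map (fun z => z n) = (π n).map Prod.fst := by
    intro n
    induction n with
    | zero => exact h0
    | succ n ih =>
      rw [← h n, ← step n ih, Measure.map_map (by fun_prop) (by fun_prop)]
      rfl
  exact ⟨M, hM, fun n => step n (all n)⟩

/-- Two laws that differ by measures with finite `γ`-th moment (away from the origin, where the
two measures may be infinite) are at finite Wasserstein distance: the common part of the laws
stays in place, and the remaining parts are coupled independently. -/
lemma finiteDist_of_add_eq {γ : ℝ} (hγ : 0 < γ) (μ ν a b : Measure ℝ) [IsProbabilityMeasure μ]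
    [IsProbabilityMeasure ν] (ha : ∫⁻ x, ‖x‖ₑ ^ γ ∂a < ∞) (hb : ∫⁻ x, ‖x‖ₑ ^ γ ∂b < ∞)
    (h : ∀ s, MeasurableSet s → (0 : ℝ) ∉ s → μ s + a s = ν s + b s) : FiniteDist γ μ ν := by
  obtain ⟨s, hs, h₁, h₂⟩ := hahn_decomposition μ ν
  have le₁ : ν.restrict s ≤ μ.restrict s := by
    refine Measure.le_iff.2 fun t ht => ?_
    rw [Measure.restrict_apply ht, Measure.restrict_apply ht]
    exact h₁ _ (ht.inter hs) Set.inter_subset_right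
  have le₂ : μ.restrict sᶜ ≤ ν.restrict sᶜ := by
    refine Measure.le_iff.2 fun t ht => ?_
    rw [Measure.restrict_apply ht, Measure.restrict_apply ht]
    exact h₂ _ (ht.inter hs.compl) Set.inter_subset_right
  -- the excess `μ'` of `μ` over `ν`, the excess `ν'` of `ν` over `μ`, and the common part `κ`
  set μ' := μ.restrict s - ν.restrict s with hμ'
  set ν' := ν.restrict sᶜ - μ.restrict sᶜ with hν'
  have e₁ : μ' + ν.restrict s = μ.restrict s := Measure.sub_add_cancel_of_le le₁
  have e₂ : ν' + μ.restrict sᶜ = ν.restrict sᶜ := Measure.sub_add_cancel_of_le le₂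
  set κ := ν.restrict s + μ.restrict sᶜ with hκ
  have eμ : κ + μ' = μ := by
    rw [← Measure.restrict_add_restrict_compl (μ := μ) hs, ← e₁, hκ]; abel
  have eν : κ + ν' = ν := by
    rw [← Measure.restrict_add_restrict_compl (μ := ν) hs, ← e₂, hκ]; abel
  have fμ' : IsFiniteMeasure μ' := inferInstance
  have fν' : IsFiniteMeasure ν' := inferInstance
  -- away from the origin the excess of one law over the other is bounded by `b`, respectively `a`
  have aux : ∀ (m m' d c e : Measure ℝ) [IsFiniteMeasure m'] (t : Set ℝ),
      MeasurableSet t → d + m'.restrict t = m.restrict t →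
      (∀ u, MeasurableSet u → (0 : ℝ) ∉ u → m u + c u = m' u + e u) →
      ∫⁻ x, ‖x‖ₑ ^ γ ∂d ≤ ∫⁻ x, ‖x‖ₑ ^ γ ∂e := by
    intro m m' d c e _ t ht hd hu
    have hle : d.restrict {0}ᶜ ≤ e := by
      refine Measure.le_iff.2 fun u hu' => ?_
      have hm : MeasurableSet (u ∩ {0}ᶜ) := hu'.inter (measurableSet_singleton 0).compl
      rw [Measure.restrict_apply hu']
      have a1 := congrArg (fun q : Measure ℝ => q (u ∩ {0}ᶜ)) hd
      simp only [Measure.add_apply, Measure.restrict_apply hm] at a1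
      have a2 := hu (u ∩ {0}ᶜ ∩ t) (hm.inter ht) (by simp)
      have a3 : d (u ∩ {0}ᶜ) ≤ e (u ∩ {0}ᶜ ∩ t) := by
        refine (ENNReal.add_le_add_iff_left (measure_ne_top m' (u ∩ {0}ᶜ ∩ t))).1 ?_
        rw [← a2, ← a1, add_comm]
        exact le_self_add
      exact a3.trans (measure_mono fun x hx => hx.1.1)
    calc ∫⁻ x, ‖x‖ₑ ^ γ ∂d = ∫⁻ x in {0}ᶜ, ‖x‖ₑ ^ γ ∂d := by
          rw [← lintegral_add_compl _ (measurableSet_singleton (0 : ℝ))]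
          simp [hγ]
      _ ≤ _ := lintegral_mono' hle le_rfl
  have mμ' : ∫⁻ x, ‖x‖ₑ ^ γ ∂μ' < ∞ := (aux μ ν μ' a b s hs e₁ h).trans_lt hb
  have mν' : ∫⁻ x, ‖x‖ₑ ^ γ ∂ν' < ∞ :=
    (aux ν μ ν' b a sᶜ hs.compl e₂ fun u hu h0 => (h u hu h0).symm).trans_lt ha
  have mass : μ' Set.univ = ν' Set.univ := by
    have h3 : κ Set.univ + μ' Set.univ = κ Set.univ + ν' Set.univ := by
      rw [← Measure.add_apply, ← Measure.add_apply, eμ, eν, measure_univ, measure_univ]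
    exact (ENNReal.add_right_inj (measure_ne_top κ _)).1 h3
  set m := μ' Set.univ with hm
  have mtop : m ≠ ∞ := measure_ne_top μ' _
  refine ⟨κ.map (fun x => (x, x)) + m⁻¹ • μ'.prod ν', ⟨?_, ?_⟩, ?_⟩
  · rw [Measure.map_add _ _ (by fun_prop), Measure.map_map (by fun_prop) (by fun_prop),
      Measure.map_smul, Measure.map_fst_prod, ← mass, smul_smul]
    rcases eq_or_ne m 0 with h0 | h0
    · have : μ' = 0 := Measure.measure_univ_eq_zero.1 h0
      rw [this, smul_zero, ← eμ, this]
      exact congrArg (· + (0 : Measure ℝ)) Measure.map_id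
    · rw [ENNReal.inv_mul_cancel h0 mtop, one_smul]
      refine Eq.trans ?_ eμ
      exact congrArg (· + μ') Measure.map_id
  · rw [Measure.map_add _ _ (by fun_prop), Measure.map_map (by fun_prop) (by fun_prop),
      Measure.map_smul, Measure.map_snd_prod, ← hm, smul_smul]
    rcases eq_or_ne m 0 with h0 | h0
    · have : ν' = 0 := Measure.measure_univ_eq_zero.1 (mass ▸ h0)
      rw [this, smul_zero, ← eν, this]
      exact congrArg (· + (0 : Measure ℝ)) Measure.map_id
    · rw [ENNReal.inv_mul_cancel h0 mtop, one_smul]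
      refine Eq.trans ?_ eν
      exact congrArg (· + ν') Measure.map_id
  · rw [cost, lintegral_add_measure, lintegral_map (by fun_prop) (by fun_prop)]
    simp only [sub_self, enorm_zero, ENNReal.zero_rpow_of_pos hγ, lintegral_zero, zero_add]
    rcases eq_or_ne m 0 with h0 | h0
    · have : μ' = 0 := Measure.measure_univ_eq_zero.1 h0
      simp [this]
    rw [lintegral_smul_measure]
    refine ENNReal.mul_lt_top (ENNReal.inv_lt_top.2 (pos_iff_ne_zero.2 h0)) ?_
    refine (lintegral_mono fun z : ℝ × ℝ => ENNReal.rpow_le_rpow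
      (enorm_sub_le (a := z.1) (b := z.2)) hγ.le).trans_lt
      (lintegral_add_rpow_lt_top hγ (by fun_prop) (by fun_prop) ?_ ?_)
    · rw [lintegral_prod _ (by fun_prop)]
      simp only [lintegral_const]
      rw [lintegral_mul_const _ (by fun_prop)]
      exact ENNReal.mul_lt_top mμ' (measure_lt_top _ _)
    · rw [lintegral_prod _ (by fun_prop)]
      simp only [lintegral_const]
      exact ENNReal.mul_lt_top mν' (measure_lt_top _ _)

/-! ### The smoothing transformation -/

/-- The smoothing transformation: the law of `L X₁ + R X₂` for `(L, R)` of law `ρ` and `X₁`, `X₂`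
of law `μ`, all independent. -/
noncomputable def smooth (ρ : Measure (ℝ × ℝ)) (μ : Measure ℝ) : Measure ℝ :=
  (ρ.prod (μ.prod μ)).map fun w => w.1.1 * w.2.1 + w.1.2 * w.2.2

/-- The smoothing transformation on the plane, with the same weights `(L, R)` for both
coordinates. -/
noncomputable def smoothPair (ρ : Measure (ℝ × ℝ)) (π : Measure (ℝ × ℝ)) : Measure (ℝ × ℝ) :=
  (ρ.prod (π.prod π)).map fun w =>
    (w.1.1 * w.2.1.1 + w.1.2 * w.2.2.1, w.1.1 * w.2.1.2 + w.1.2 * w.2.2.2)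

/-- The moment `E [|L| ^ γ + |R| ^ γ]` of the weights. -/
noncomputable def weightMoment (γ : ℝ) (ρ : Measure (ℝ × ℝ)) : ℝ≥0∞ :=
  ∫⁻ w, (‖w.1‖ₑ ^ γ + ‖w.2‖ₑ ^ γ) ∂ρ

instance (ρ : Measure (ℝ × ℝ)) (μ : Measure ℝ) [IsProbabilityMeasure ρ] [IsProbabilityMeasure μ] :
    IsProbabilityMeasure (smooth ρ μ) :=
  Measure.isProbabilityMeasure_map (by fun_prop)

instance (ρ π : Measure (ℝ × ℝ)) [IsProbabilityMeasure ρ] [IsProbabilityMeasure π] :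
    IsProbabilityMeasure (smoothPair ρ π) :=
  Measure.isProbabilityMeasure_map (by fun_prop)

/-- The smoothing transformation contracts growth bounds. -/
lemma GrowthBound.smooth {γ : ℝ} (hγ : 0 < γ) {ρ : Measure (ℝ × ℝ)} [IsProbabilityMeasure ρ]
    {δ : Measure ℝ} [IsProbabilityMeasure δ] {C : ℝ≥0∞} (h : GrowthBound γ δ C) :
    GrowthBound γ (smooth ρ δ) (weightMoment γ ρ * C) := by
  intro s
  rw [KacModel.smooth, lintegral_map (by fun_prop) (by fun_prop), lintegral_prod _ (by fun_prop)]
  calc ∫⁻ w, ∫⁻ z, ‖s + (w.1 * z.1 + w.2 * z.2)‖ₑ ^ γ ∂(δ.prod δ) ∂ρ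
      ≤ ∫⁻ w, (‖s‖ₑ ^ γ + (‖w.1‖ₑ ^ γ + ‖w.2‖ₑ ^ γ) * C) ∂ρ := by
        refine lintegral_mono fun w => ?_
        rw [lintegral_prod _ (by fun_prop)]
        calc ∫⁻ x, ∫⁻ y, ‖s + (w.1 * x + w.2 * y)‖ₑ ^ γ ∂δ ∂δ
            ≤ ∫⁻ x, (‖s + w.1 * x‖ₑ ^ γ + ‖w.2‖ₑ ^ γ * C) ∂δ := by
              refine lintegral_mono fun x => ?_
              simpa only [add_assoc] using h.scaled hγ w.2 (s + w.1 * x)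
          _ ≤ ‖s‖ₑ ^ γ + ‖w.1‖ₑ ^ γ * C + ‖w.2‖ₑ ^ γ * C := by
              rw [lintegral_add_right _ (by fun_prop), lintegral_const, measure_univ, mul_one]
              gcongr
              exact h.scaled hγ w.1 s
          _ = _ := by ring
    _ = _ := by
        rw [lintegral_add_left (by fun_prop), lintegral_const, measure_univ, mul_one,
          lintegral_mul_const _ (by fun_prop), weightMoment]

lemma map_smoothPair {ρ π : Measure (ℝ × ℝ)} [IsProbabilityMeasure ρ] [IsProbabilityMeasure π]
    {f : ℝ × ℝ → ℝ} (hf : Measurable f)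
    (hadd : ∀ (l r : ℝ) (z z' : ℝ × ℝ),
      f (l * z.1 + r * z'.1, l * z.2 + r * z'.2) = l * f z + r * f z') :
    (smoothPair ρ π).map f = smooth ρ (π.map f) := by
  have e : ρ.prod ((π.map f).prod (π.map f)) =
      (ρ.prod (π.prod π)).map (Prod.map id (Prod.map f f)) := by
    rw [Measure.map_prod_map _ _ hf hf]
    nth_rw 1 [← Measure.map_id (μ := ρ)]
    rw [Measure.map_prod_map _ _ measurable_id (by fun_prop)]
  rw [smooth, e, smoothPair, Measure.map_map hf (by fun_prop),
    Measure.map_map (by fun_prop) (by fun_prop)]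
  congr 1
  ext w
  exact hadd _ _ _ _

lemma IsCoupling.smoothPair {ρ π : Measure (ℝ × ℝ)} {μ ν : Measure ℝ} [IsProbabilityMeasure ρ]
    [IsProbabilityMeasure π] (h : IsCoupling π μ ν) :
    IsCoupling (smoothPair ρ π) (smooth ρ μ) (smooth ρ ν) := by
  constructor
  · rw [map_smoothPair measurable_fst fun _ _ _ _ => rfl, h.1]
  · rw [map_smoothPair measurable_snd fun _ _ _ _ => rfl, h.2]

/-- The law of the difference of the two coordinates of a joint law. -/
noncomputable def diffLaw (π : Measure (ℝ × ℝ)) : Measure ℝ := π.map fun z => z.1 - z.2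

instance (π : Measure (ℝ × ℝ)) [IsProbabilityMeasure π] : IsProbabilityMeasure (diffLaw π) :=
  Measure.isProbabilityMeasure_map (by fun_prop)

lemma lintegral_diffLaw (γ : ℝ) (π : Measure (ℝ × ℝ)) :
    ∫⁻ x, ‖x‖ₑ ^ γ ∂(diffLaw π) = cost γ π := by
  rw [diffLaw, lintegral_map (by fun_prop) (by fun_prop), cost]

lemma diffLaw_smoothPair (ρ π : Measure (ℝ × ℝ)) [IsProbabilityMeasure ρ]
    [IsProbabilityMeasure π] : diffLaw (smoothPair ρ π) = smooth ρ (diffLaw π) :=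
  map_smoothPair (by fun_prop) fun _ _ _ _ => by ring

lemma lintegral_fst_le_weightMoment (γ : ℝ) (ρ : Measure (ℝ × ℝ)) :
    ∫⁻ w, ‖w.1‖ₑ ^ γ ∂ρ ≤ weightMoment γ ρ := lintegral_mono fun _ => le_self_add

lemma lintegral_snd_le_weightMoment (γ : ℝ) (ρ : Measure (ℝ × ℝ)) :
    ∫⁻ w, ‖w.2‖ₑ ^ γ ∂ρ ≤ weightMoment γ ρ := lintegral_mono fun _ => le_add_self

lemma lintegral_enorm_mul_rpow {γ : ℝ} (hγ : 0 < γ) {α β : Type*} [MeasurableSpace α]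
    [MeasurableSpace β] (ρ : Measure α) (μ : Measure β) [SFinite μ] {f : α → ℝ} {g : β → ℝ}
    (hf : Measurable f) (hg : Measurable g) :
    ∫⁻ w, ‖f w.1 * g w.2‖ₑ ^ γ ∂(ρ.prod μ) = (∫⁻ a, ‖f a‖ₑ ^ γ ∂ρ) * ∫⁻ b, ‖g b‖ₑ ^ γ ∂μ := by
  simp_rw [enorm_mul, ENNReal.mul_rpow_of_nonneg _ _ hγ.le]
  exact lintegral_prod_mul (f := fun a => ‖f a‖ₑ ^ γ) (g := fun b => ‖g b‖ₑ ^ γ) (by fun_prop)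
    (by fun_prop)

lemma lintegral_smooth_lt_top {γ : ℝ} (hγ : 0 < γ) {ρ : Measure (ℝ × ℝ)}
    [IsProbabilityMeasure ρ] {μ : Measure ℝ} [IsProbabilityMeasure μ]
    (hρ : weightMoment γ ρ < ∞) (hμ : ∫⁻ x, ‖x‖ₑ ^ γ ∂μ < ∞) :
    ∫⁻ x, ‖x‖ₑ ^ γ ∂(smooth ρ μ) < ∞ := by
  rw [smooth, lintegral_map (by fun_prop) (by fun_prop)]
  refine (lintegral_mono fun w => ENNReal.rpow_le_rpow (enorm_add_le _ _) hγ.le).trans_lt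
    (lintegral_add_rpow_lt_top hγ (by fun_prop) (by fun_prop) ?_ ?_)
  · rw [lintegral_enorm_mul_rpow (f := Prod.fst) (g := Prod.fst) hγ _ _ (by fun_prop)
      (by fun_prop)]
    refine ENNReal.mul_lt_top ((lintegral_fst_le_weightMoment γ ρ).trans_lt hρ) ?_
    rw [lintegral_prod _ (by fun_prop)]
    simpa using hμ
  · rw [lintegral_enorm_mul_rpow (f := Prod.snd) (g := Prod.snd) hγ _ _ (by fun_prop)
      (by fun_prop)]
    refine ENNReal.mul_lt_top ((lintegral_snd_le_weightMoment γ ρ).trans_lt hρ) ?_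
    rw [lintegral_prod _ (by fun_prop)]
    simpa using hμ

lemma FiniteDist.smooth {γ : ℝ} (hγ : 0 < γ) {ρ : Measure (ℝ × ℝ)} [IsProbabilityMeasure ρ]
    (hρ : weightMoment γ ρ < ∞) {μ ν : Measure ℝ} [IsProbabilityMeasure μ]
    (h : FiniteDist γ μ ν) : FiniteDist γ (smooth ρ μ) (smooth ρ ν) := by
  obtain ⟨π, c, hc⟩ := h
  have := c.isProbabilityMeasure
  refine ⟨_, c.smoothPair (ρ := ρ), ?_⟩
  rw [← lintegral_diffLaw, diffLaw_smoothPair]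
  exact lintegral_smooth_lt_top hγ hρ (by rwa [lintegral_diffLaw])

lemma finiteDist_smooth_of_moment {γ : ℝ} (hγ : 0 < γ) {ρ : Measure (ℝ × ℝ)}
    [IsProbabilityMeasure ρ] {μ : Measure ℝ} [IsProbabilityMeasure μ]
    (hρ : weightMoment γ ρ < ∞) (hμ : ∫⁻ x, ‖x‖ₑ ^ γ ∂μ < ∞) : FiniteDist γ μ (smooth ρ μ) :=
  finiteDist_of_add_eq hγ μ _ (smooth ρ μ) μ (lintegral_smooth_lt_top hγ hρ hμ) hμ
    fun _ _ _ => add_comm _ _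

/-- If `big ω` and `small ω` are the two numbers `f ω` and `g ω` in some order, the laws of `big`
and `small` have the same sum as those of `f` and `g`. -/
lemma map_add_map_of_swap {Ω : Type*} [MeasurableSpace Ω] (Q : Measure Ω) {f g big small : Ω → ℝ}
    (hf : Measurable f) (hg : Measurable g) (hbig : Measurable big) (hsmall : Measurable small)
    (h : ∀ ω, (big ω = f ω ∧ small ω = g ω) ∨ (big ω = g ω ∧ small ω = f ω)) :
    Q.map big + Q.map small = Q.map f + Q.map g := by
  refine Measure.ext_of_lintegral _ fun F hF => ?_
  rw [lintegral_add_measure, lintegral_add_measure, lintegral_map hF hbig, lintegral_map hF hsmall,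
    lintegral_map hF hf, lintegral_map hF hg, ← lintegral_add_left (by fun_prop),
    ← lintegral_add_left (by fun_prop)]
  refine lintegral_congr fun ω => ?_
  rcases h ω with ⟨h1, h2⟩ | ⟨h1, h2⟩
  · rw [h1, h2]
  · rw [h1, h2, add_comm]

/-- The main estimate on the smoothing transformation. Let `μ` be a law which differs by a measure
with finite `γ`-th moment from a measure `Λ` that is homogeneous of degree `-α`. Up to the smaller
of `|L Y₁|` and `|R Y₂|`, which has finite `γ`-th moment as `γ < 2 α`, the sum `L Y₁ + R Y₂`
is the larger of its two terms. The laws of the larger and of the smaller term sum to those of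
`L Y₁` and `R Y₂`, and so differ little from `E [L ^ α + R ^ α] Λ = Λ`. -/
lemma finiteDist_smooth_of_homogeneous {α γ : ℝ} (hγ : 0 < γ)
    {ρ : Measure (ℝ × ℝ)} [IsProbabilityMeasure ρ] (hρ0 : ∀ᵐ w ∂ρ, 0 ≤ w.1 ∧ 0 ≤ w.2)
    (hρα : weightMoment α ρ = 1) (hργ : weightMoment γ ρ < ∞)
    {μ a Λ : Measure ℝ} [IsProbabilityMeasure μ] [SFinite a] [SFinite Λ] (hΛ : μ + a = Λ)
    (hhom : ∀ l : ℝ, 0 ≤ l → ∀ s, MeasurableSet s → (0 : ℝ) ∉ s →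
      Λ ((fun x => l * x) ⁻¹' s) = ‖l‖ₑ ^ α * Λ s)
    (ha : ∫⁻ x, ‖x‖ₑ ^ γ ∂a < ∞) (hμ : ∫⁻ x, ‖x‖ₑ ^ (γ / 2) ∂μ < ∞) :
    FiniteDist γ μ (smooth ρ μ) := by
  set Q := ρ.prod (μ.prod μ) with hQ
  let f : (ℝ × ℝ) × ℝ × ℝ → ℝ := fun w => w.1.1 * w.2.1
  let g : (ℝ × ℝ) × ℝ × ℝ → ℝ := fun w => w.1.2 * w.2.2
  have hf : Measurable f := by fun_prop
  have hg : Measurable g := by fun_prop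
  have hset : MeasurableSet {w | ‖g w‖ₑ ≤ ‖f w‖ₑ} := measurableSet_le (by fun_prop) (by fun_prop)
  classical
  let big := fun w => if ‖g w‖ₑ ≤ ‖f w‖ₑ then f w else g w
  let small := fun w => if ‖g w‖ₑ ≤ ‖f w‖ₑ then g w else f w
  have hbig : Measurable big := Measurable.ite hset hf hg
  have hsmall : Measurable small := Measurable.ite hset hg hf
  have hγ2 : 0 < γ / 2 := by positivity
  have sum_small : ∫⁻ w, ‖small w‖ₑ ^ γ ∂Q < ∞ := by
    calc ∫⁻ w, ‖small w‖ₑ ^ γ ∂Q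
        ≤ ∫⁻ w, (‖w.1.1‖ₑ ^ γ + ‖w.1.2‖ₑ ^ γ) * (‖w.2.1‖ₑ ^ (γ / 2) * ‖w.2.2‖ₑ ^ (γ / 2)) ∂Q := by
          refine lintegral_mono fun w => ?_
          have e : ∀ x : ℝ≥0∞, x ^ γ = x ^ (γ / 2) * x ^ (γ / 2) := fun x => by
            rw [← ENNReal.rpow_add_of_nonneg _ _ hγ2.le hγ2.le, add_halves]
          have h1 : ‖small w‖ₑ ^ γ ≤ ‖f w‖ₑ ^ (γ / 2) * ‖g w‖ₑ ^ (γ / 2) := by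
            rw [e]
            simp only [small]
            split_ifs with h
            · gcongr
            · gcongr
              exact (not_le.1 h).le
          have h2 : ∀ x y : ℝ≥0∞, x * y ≤ x * x + y * y := fun x y => by
            rcases le_total x y with h | h
            · exact (mul_le_mul_left h y).trans le_add_self
            · exact (mul_le_mul_right h x).trans le_self_add
          refine h1.trans ?_
          simp only [f, g, enorm_mul, ENNReal.mul_rpow_of_nonneg _ _ hγ2.le]
          rw [e ‖w.1.1‖ₑ, e ‖w.1.2‖ₑ]
          calc _ = (‖w.1.1‖ₑ ^ (γ / 2) * ‖w.1.2‖ₑ ^ (γ / 2)) *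
                (‖w.2.1‖ₑ ^ (γ / 2) * ‖w.2.2‖ₑ ^ (γ / 2)) := by ring
            _ ≤ _ := by gcongr; exact h2 _ _
      _ = weightMoment γ ρ * ((∫⁻ x, ‖x‖ₑ ^ (γ / 2) ∂μ) * ∫⁻ x, ‖x‖ₑ ^ (γ / 2) ∂μ) := by
          rw [hQ, lintegral_prod_mul (f := fun w : ℝ × ℝ => ‖w.1‖ₑ ^ γ + ‖w.2‖ₑ ^ γ)
            (g := fun z : ℝ × ℝ => ‖z.1‖ₑ ^ (γ / 2) * ‖z.2‖ₑ ^ (γ / 2)) (by fun_prop)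
            (by fun_prop), weightMoment,
            lintegral_prod_mul (f := fun x : ℝ => ‖x‖ₑ ^ (γ / 2))
              (g := fun x : ℝ => ‖x‖ₑ ^ (γ / 2)) (by fun_prop) (by fun_prop)]
      _ < ∞ := ENNReal.mul_lt_top hργ (ENNReal.mul_lt_top hμ hμ)
  have d1 : FiniteDist γ (smooth ρ μ) (Q.map big) := by
    refine finiteDist_map (by fun_prop) hbig ?_
    refine lt_of_eq_of_lt (lintegral_congr fun w => ?_) sum_small
    congr 2
    simp only [big, small]
    split_ifs <;> simp [f, g]
  -- the images of `a` under multiplication by `L` and by `R`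
  let aL : Measure ℝ := (ρ.prod a).map fun w => w.1.1 * w.2
  let aR : Measure ℝ := (ρ.prod a).map fun w => w.1.2 * w.2
  have haL : ∫⁻ x, ‖x‖ₑ ^ γ ∂aL < ∞ := by
    rw [lintegral_map (by fun_prop) (by fun_prop),
      lintegral_enorm_mul_rpow (f := Prod.fst) (g := fun x => x) hγ _ _ (by fun_prop)
      (by fun_prop)]
    exact ENNReal.mul_lt_top ((lintegral_fst_le_weightMoment γ ρ).trans_lt hργ) ha
  have haR : ∫⁻ x, ‖x‖ₑ ^ γ ∂aR < ∞ := by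
    rw [lintegral_map (by fun_prop) (by fun_prop),
      lintegral_enorm_mul_rpow (f := Prod.snd) (g := fun x => x) hγ _ _ (by fun_prop)
      (by fun_prop)]
    exact ENNReal.mul_lt_top ((lintegral_snd_le_weightMoment γ ρ).trans_lt hργ) ha
  have scal : ∀ (p : ℝ × ℝ → ℝ), Measurable p → (∀ᵐ w ∂ρ, 0 ≤ p w) →
      ∀ s, MeasurableSet s → (0 : ℝ) ∉ s →
      (ρ.prod μ).map (fun w => p w.1 * w.2) s + (ρ.prod a).map (fun w => p w.1 * w.2) s =
        (∫⁻ w, ‖p w‖ₑ ^ α ∂ρ) * Λ s := by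
    intro p hp hp0 s hs h0
    have hm : Measurable fun w : (ℝ × ℝ) × ℝ => p w.1 * w.2 := by fun_prop
    rw [← Measure.add_apply, ← Measure.map_add _ _ hm, ← Measure.prod_add, hΛ,
      Measure.map_apply hm hs, Measure.prod_apply (hm hs), ← lintegral_mul_const _ (by fun_prop)]
    refine lintegral_congr_ae ?_
    filter_upwards [hp0] with w hw
    exact hhom (p w) hw s hs h0
  have ef : Q.map f = (ρ.prod μ).map fun w => w.1.1 * w.2 := by
    have : ρ.prod μ = Q.map (Prod.map id Prod.fst) := by
      rw [hQ, ← Measure.map_prod_map _ _ measurable_id measurable_fst, Measure.map_id,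
        Measure.map_fst_prod, measure_univ, one_smul]
    rw [this, Measure.map_map (by fun_prop) (by fun_prop)]
    rfl
  have eg : Q.map g = (ρ.prod μ).map fun w => w.1.2 * w.2 := by
    have : ρ.prod μ = Q.map (Prod.map id Prod.snd) := by
      rw [hQ, ← Measure.map_prod_map _ _ measurable_id measurable_snd, Measure.map_id,
        Measure.map_snd_prod, measure_univ, one_smul]
    rw [this, Measure.map_map (by fun_prop) (by fun_prop)]
    rfl
  have hQbig : IsProbabilityMeasure (Q.map big) :=
    Measure.isProbabilityMeasure_map hbig.aemeasurable
  have d2 : FiniteDist γ μ (Q.map big) := by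
    refine finiteDist_of_add_eq hγ μ _ a (Q.map small + (aL + aR)) ha ?_ fun s hs h0 => ?_
    · rw [lintegral_add_measure, lintegral_add_measure, lintegral_map (by fun_prop) hsmall]
      exact ENNReal.add_lt_top.2 ⟨sum_small, ENNReal.add_lt_top.2 ⟨haL, haR⟩⟩
    · have e1 := congrArg (fun m : Measure ℝ => m s) (map_add_map_of_swap Q hf hg hbig hsmall
        fun w => by simp only [big, small]; split_ifs <;> simp)
      simp only [Measure.add_apply] at e1 ⊢
      have e2 := scal Prod.fst (by fun_prop) (hρ0.mono fun w hw => hw.1) s hs h0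
      have e3 := scal Prod.snd (by fun_prop) (hρ0.mono fun w hw => hw.2) s hs h0
      have e4 : μ s + a s = Λ s := by rw [← hΛ, Measure.add_apply]
      rw [← add_assoc, e1, e4, ef, eg, add_add_add_comm]
      simp only [aL, aR]
      rw [e2, e3, ← add_mul, ← lintegral_add_left (by fun_prop)]
      rw [weightMoment] at hρα
      rw [hρα, one_mul]
  exact d2.trans hγ d1.symm

/-! ### Laws with exact power tails -/

/-- The tail quantile function of the power law with tail `c * x ^ (-α)`. -/
noncomputable def powerQuantile (α c v : ℝ) : ℝ := (c / v) ^ (1 / α)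

@[fun_prop]
lemma measurable_powerQuantile (α c : ℝ) : Measurable (powerQuantile α c) :=
  Measurable.pow_const (by fun_prop) _

/-- The part of the measure with right tail `cp * x ^ (-α)` and left tail `cm * |x| ^ (-α)` on which
the tails, taken as coordinate, range over `S ⊆ (0, ∞)`. For `S = (0, ∞)` this is (off the origin)
the full homogeneous measure, for `S = (0, 1/2)` a probability measure. -/
noncomputable def powerMeasure (α cp cm : ℝ) (S : Set ℝ) : Measure ℝ :=
  (volume.restrict S).map (powerQuantile α cp) +
    (volume.restrict S).map (fun v => -powerQuantile α cm v)

instance (α cp cm : ℝ) (S : Set ℝ) : SFinite (powerMeasure α cp cm S) := by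
  unfold powerMeasure; infer_instance

lemma powerMeasure_add_of_disjoint (α cp cm : ℝ) {S T : Set ℝ} (h : Disjoint S T)
    (hT : MeasurableSet T) :
    powerMeasure α cp cm S + powerMeasure α cp cm T = powerMeasure α cp cm (S ∪ T) := by
  simp only [powerMeasure]
  rw [Measure.restrict_union h hT, Measure.map_add _ _ (by fun_prop),
    Measure.map_add _ _ (by fun_prop)]
  abel

instance (α cp cm : ℝ) : IsProbabilityMeasure (powerMeasure α cp cm (Set.Ioo 0 (1 / 2))) := by
  constructor
  rw [powerMeasure, Measure.add_apply, Measure.map_apply (by fun_prop) .univ,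
    Measure.map_apply (by fun_prop) .univ]
  simp only [Set.preimage_univ, Measure.restrict_apply_univ, Real.volume_Ioo, sub_zero]
  rw [← ENNReal.ofReal_add (by norm_num) (by norm_num)]
  norm_num

/-- The tail quantile function inverts `x ↦ c * x ^ (-α)`, so scaling the value by `l` amounts to
scaling the tail by `l ^ (-α)`. -/
lemma powerQuantile_scale {α c l v : ℝ} (hα : 0 < α) (hc : 0 ≤ c) (hl : 0 < l) (hv : 0 < v) :
    powerQuantile α c (l ^ (-α) * v) = l * powerQuantile α c v := by
  have hlα : 0 < l ^ α := Real.rpow_pos_of_pos hl α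
  rw [powerQuantile, powerQuantile, Real.rpow_neg hl.le,
    show c / ((l ^ α)⁻¹ * v) = l ^ α * (c / v) by field_simp,
    Real.mul_rpow hlα.le (by positivity), ← Real.rpow_mul hl.le, mul_one_div_cancel hα.ne',
    Real.rpow_one]

lemma map_restrict_Ioi_preimage_mul {α l : ℝ} (hl : 0 < l) {h : ℝ → ℝ}
    (hm : Measurable h) (hh : ∀ v, 0 < v → h (l ^ (-α) * v) = l * h v) {s : Set ℝ}
    (hs : MeasurableSet s) :
    (volume.restrict (Set.Ioi 0)).map h ((fun x => l * x) ⁻¹' s) =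
      ‖l‖ₑ ^ α * (volume.restrict (Set.Ioi 0)).map h s := by
  have hpos : 0 < l ^ (-α) := Real.rpow_pos_of_pos hl _
  have hms : MeasurableSet ((fun x => l * x) ⁻¹' s) := (measurable_const_mul l) hs
  rw [Measure.map_apply hm hms, Measure.map_apply hm hs,
    Measure.restrict_apply (hm hms), Measure.restrict_apply (hm hs)]
  have e : h ⁻¹' ((fun x => l * x) ⁻¹' s) ∩ Set.Ioi 0 =
      (l ^ (-α) * ·) ⁻¹' (h ⁻¹' s ∩ Set.Ioi 0) := by
    ext v
    simp only [Set.mem_inter_iff, Set.mem_preimage, Set.mem_Ioi, mul_pos_iff_of_pos_left hpos]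
    exact and_congr_left fun hv => by rw [hh v hv]
  rw [e, Real.volume_preimage_mul_left hpos.ne', Real.rpow_neg hl.le, inv_inv,
    abs_of_pos (Real.rpow_pos_of_pos hl α), ← ENNReal.ofReal_rpow_of_pos hl,
    Real.enorm_of_nonneg hl.le]

lemma powerMeasure_homogeneous {α cp cm l : ℝ} (hα : 0 < α) (hcp : 0 ≤ cp) (hcm : 0 ≤ cm)
    (hl : 0 ≤ l) {s : Set ℝ} (hs : MeasurableSet s) (h0 : (0 : ℝ) ∉ s) :
    powerMeasure α cp cm (Set.Ioi 0) ((fun x => l * x) ⁻¹' s) =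
      ‖l‖ₑ ^ α * powerMeasure α cp cm (Set.Ioi 0) s := by
  rcases hl.eq_or_lt with rfl | hl
  · have : (fun x : ℝ => 0 * x) ⁻¹' s = ∅ := by ext; simp [h0]
    rw [this, measure_empty, enorm_zero, ENNReal.zero_rpow_of_pos hα, zero_mul]
  · rw [powerMeasure, Measure.add_apply, Measure.add_apply, mul_add,
      map_restrict_Ioi_preimage_mul hl (by fun_prop)
        (fun v hv => powerQuantile_scale hα hcp hl hv) hs,
      map_restrict_Ioi_preimage_mul (α := α) hl (h := fun v => -powerQuantile α cm v) (by fun_prop)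
        (fun v hv => by rw [powerQuantile_scale hα hcm hl hv]; ring) hs]

lemma lintegral_enorm_rpow_rpow_lt_top {p q : ℝ} (hp : 0 ≤ p) {S : Set ℝ} (hS : MeasurableSet S)
    (hS0 : S ⊆ Set.Ioi 0) (h : IntegrableOn (fun v : ℝ => v ^ (q * p)) S) :
    ∫⁻ v in S, ‖v ^ q‖ₑ ^ p < ∞ := by
  refine lt_of_eq_of_lt (setLIntegral_congr_fun hS fun v hv => ?_) h.2
  have hv0 : 0 < v := hS0 hv
  change _ = ‖v ^ (q * p)‖ₑ
  rw [Real.enorm_of_nonneg (by positivity), Real.enorm_of_nonneg (by positivity),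
    ENNReal.ofReal_rpow_of_nonneg (by positivity) hp, ← Real.rpow_mul hv0.le]

lemma lintegral_powerQuantile_lt_top {α p c : ℝ} (hc : 0 ≤ c) (hp : 0 ≤ p) {S : Set ℝ}
    (hS : MeasurableSet S) (hS0 : S ⊆ Set.Ioi 0)
    (h : IntegrableOn (fun v : ℝ => v ^ (-(p / α))) S) :
    ∫⁻ v in S, ‖powerQuantile α c v‖ₑ ^ p < ∞ := by
  have e : ∀ v ∈ S, ‖powerQuantile α c v‖ₑ ^ p =
      ‖c ^ (1 / α)‖ₑ ^ p * ‖v ^ (-(1 / α))‖ₑ ^ p := by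
    intro v hv
    have hv0 : 0 < v := hS0 hv
    rw [powerQuantile, Real.div_rpow hc hv0.le, div_eq_mul_inv, ← Real.rpow_neg hv0.le, enorm_mul,
      ENNReal.mul_rpow_of_nonneg _ _ hp]
  rw [setLIntegral_congr_fun hS e, lintegral_const_mul' _ _ (by finiteness)]
  refine ENNReal.mul_lt_top (by finiteness) (lintegral_enorm_rpow_rpow_lt_top hp hS hS0 ?_)
  rwa [show -(1 / α) * p = -(p / α) by ring]

lemma lintegral_powerMeasure_lt_top {α p cp cm : ℝ} (hcp : 0 ≤ cp) (hcm : 0 ≤ cm) (hp : 0 ≤ p)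
    {S : Set ℝ} (hS : MeasurableSet S) (hS0 : S ⊆ Set.Ioi 0)
    (h : IntegrableOn (fun v : ℝ => v ^ (-(p / α))) S) :
    ∫⁻ x, ‖x‖ₑ ^ p ∂(powerMeasure α cp cm S) < ∞ := by
  rw [powerMeasure, lintegral_add_measure, lintegral_map (by fun_prop) (by fun_prop),
    lintegral_map (by fun_prop) (by fun_prop)]
  simp only [enorm_neg]
  exact ENNReal.add_lt_top.2 ⟨lintegral_powerQuantile_lt_top hcp hp hS hS0 h,
    lintegral_powerQuantile_lt_top hcm hp hS hS0 h⟩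

lemma integrableOn_Ioo_rpow {q : ℝ} (hq : -1 < q) :
    IntegrableOn (fun v : ℝ => v ^ q) (Set.Ioo 0 (1 / 2)) := by
  have := (intervalIntegral.intervalIntegrable_rpow' (a := 0) (b := 1 / 2) hq).1
  exact this.mono_set Set.Ioo_subset_Ioc_self

lemma lintegral_powerMeasure_Ioo_lt_top {α p cp cm : ℝ} (hα : 0 < α) (hcp : 0 ≤ cp)
    (hcm : 0 ≤ cm) (hp : 0 ≤ p) (hpα : p < α) :
    ∫⁻ x, ‖x‖ₑ ^ p ∂(powerMeasure α cp cm (Set.Ioo 0 (1 / 2))) < ∞ := by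
  refine lintegral_powerMeasure_lt_top hcp hcm hp measurableSet_Ioo Set.Ioo_subset_Ioi_self
    (integrableOn_Ioo_rpow ?_)
  rw [neg_lt_neg_iff, div_lt_one hα]
  exact hpα

/-- The part of the homogeneous measure with tail coordinate at least `1/2`, which lies near the
origin, has a finite `γ`-th moment as `γ > α`; the rest, a probability measure, has a finite
moment of order `γ / 2 < α`. -/
lemma finiteDist_smooth_powerMeasure {α γ cp cm : ℝ} (hα : 0 < α) (hαγ : α < γ) (hγα : γ < 2 * α)
    (hcp : 0 ≤ cp) (hcm : 0 ≤ cm) {ρ : Measure (ℝ × ℝ)} [IsProbabilityMeasure ρ]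
    (hρ0 : ∀ᵐ w ∂ρ, 0 ≤ w.1 ∧ 0 ≤ w.2) (hρα : weightMoment α ρ = 1) (hργ : weightMoment γ ρ < ∞) :
    FiniteDist γ (powerMeasure α cp cm (Set.Ioo 0 (1 / 2)))
      (smooth ρ (powerMeasure α cp cm (Set.Ioo 0 (1 / 2)))) := by
  have hγ : 0 < γ := hα.trans hαγ
  refine finiteDist_smooth_of_homogeneous (a := powerMeasure α cp cm (Set.Ici (1 / 2)))
    (Λ := powerMeasure α cp cm (Set.Ioi 0)) hγ hρ0 hρα hργ ?_
    (fun l hl s hs h0 => powerMeasure_homogeneous hα hcp hcm hl hs h0) ?_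
    (lintegral_powerMeasure_Ioo_lt_top hα hcp hcm (by positivity) (by linarith))
  · rw [powerMeasure_add_of_disjoint _ _ _ _ measurableSet_Ici,
      Set.Ioo_union_Ici_eq_Ioi (by norm_num)]
    exact Set.disjoint_left.2 fun x hx hx' => not_le.2 hx.2 hx'
  · refine lintegral_powerMeasure_lt_top hcp hcm hγ.le measurableSet_Ici
      (fun x hx => lt_of_lt_of_le (by norm_num) (Set.mem_Ici.1 hx)) ?_
    refine (integrableOn_Ioi_rpow_of_lt (a := -(γ / α)) (c := 1 / 4) ?_ (by norm_num)).mono_set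
      fun x hx => lt_of_lt_of_le (by norm_num) (Set.mem_Ici.1 hx)
    rw [neg_lt_neg_iff, one_lt_div hα]
    exact hαγ

/-! ### Quantile functions -/

/-- The quantile function of a law on the line, extended by zero outside of `(0, 1)`. -/
noncomputable def quantile (μ : Measure ℝ) (u : ℝ) : ℝ :=
  open Classical in if u ∈ Set.Ioo (0 : ℝ) 1 then sInf {x | u ≤ cdf μ x} else 0

lemma quantile_le_iff (μ : Measure ℝ) {u : ℝ} (hu : u ∈ Set.Ioo (0 : ℝ) 1) (x : ℝ) :
    quantile μ u ≤ x ↔ u ≤ cdf μ x := by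
  rw [quantile, if_pos hu]
  have hne : {x | u ≤ cdf μ x}.Nonempty := by
    obtain ⟨y, hy⟩ := ((tendsto_cdf_atTop μ).eventually (lt_mem_nhds hu.2)).exists
    exact ⟨y, hy.le⟩
  have hbdd : BddBelow {x | u ≤ cdf μ x} := by
    obtain ⟨y, hy⟩ := ((tendsto_cdf_atBot μ).eventually (gt_mem_nhds hu.1)).exists
    refine ⟨y, fun z hz => ?_⟩
    by_contra h
    exact absurd (hz.trans ((cdf μ).mono (not_le.1 h).le)) (not_le.2 hy)
  constructor
  · intro h
    rw [← (cdf μ).iInf_Ioi_eq x]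
    refine le_ciInf fun y => ?_
    obtain ⟨z, hz, hzy⟩ := exists_lt_of_csInf_lt hne (h.trans_lt y.2)
    exact le_trans (α := ℝ) hz ((cdf μ).mono hzy.le)
  · exact fun h => csInf_le hbdd h

lemma measurable_quantile (μ : Measure ℝ) : Measurable (quantile μ) := by
  refine measurable_of_Iic fun x => ?_
  have : quantile μ ⁻¹' Set.Iic x = (Set.Ioo 0 1 ∩ Set.Iic (cdf μ x)) ∪
      ((Set.Ioo (0 : ℝ) 1)ᶜ ∩ {_u | (0 : ℝ) ≤ x}) := by
    ext u
    by_cases hu : u ∈ Set.Ioo (0 : ℝ) 1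
    · simp only [Set.mem_preimage, Set.mem_Iic, quantile_le_iff μ hu, Set.mem_union,
        Set.mem_inter_iff, hu, Set.mem_compl_iff]
      simp
    · simp only [Set.mem_preimage, Set.mem_Iic, quantile, Set.mem_union,
        Set.mem_inter_iff, hu, Set.mem_compl_iff]
      simp
  rw [this]
  exact (measurableSet_Ioo.inter measurableSet_Iic).union
    (measurableSet_Ioo.compl.inter (MeasurableSet.const _))

instance : IsProbabilityMeasure (volume.restrict (Set.Ioo (0 : ℝ) 1)) := ⟨by simp⟩

lemma map_quantile (μ : Measure ℝ) [IsProbabilityMeasure μ] :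
    (volume.restrict (Set.Ioo (0 : ℝ) 1)).map (quantile μ) = μ := by
  have : IsProbabilityMeasure ((volume.restrict (Set.Ioo (0 : ℝ) 1)).map (quantile μ)) :=
    Measure.isProbabilityMeasure_map (measurable_quantile μ).aemeasurable
  refine Measure.ext_of_Iic _ _ fun x => ?_
  rw [Measure.map_apply (measurable_quantile μ) measurableSet_Iic,
    Measure.restrict_apply (measurable_quantile μ measurableSet_Iic), ← ofReal_cdf μ x]
  have e : quantile μ ⁻¹' Set.Iic x ∩ Set.Ioo 0 1 = Set.Ioo 0 1 ∩ Set.Iic (cdf μ x) := by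
    ext u
    simp only [Set.mem_inter_iff, Set.mem_preimage, Set.mem_Iic]
    exact ⟨fun h => ⟨h.2, (quantile_le_iff μ h.2 x).1 h.1⟩,
      fun h => ⟨(quantile_le_iff μ h.1 x).2 h.2, h.1⟩⟩
  rw [e]
  have h1 := cdf_le_one μ x
  have h0 := cdf_nonneg μ x
  refine le_antisymm ?_ ?_
  · calc volume (Set.Ioo 0 1 ∩ Set.Iic (cdf μ x)) ≤ volume (Set.Ioc 0 (cdf μ x)) :=
          measure_mono fun u hu => ⟨hu.1.1, hu.2⟩
      _ = _ := by rw [Real.volume_Ioc, sub_zero]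
  · calc ENNReal.ofReal (cdf μ x) = volume (Set.Ioo 0 (cdf μ x)) := by
          rw [Real.volume_Ioo, sub_zero]
      _ ≤ _ := by
          refine measure_mono fun u hu => ?_
          exact ⟨⟨hu.1, hu.2.trans_le h1⟩, hu.2.le⟩

/-! ### Quantiles of laws with power tails -/

lemma one_add_rpow_le {p θ : ℝ} (hp : 0 < p) (hθ : 0 ≤ θ) (hθ1 : θ ≤ 1 / 2) :
    (1 + θ) ^ p ≤ 1 + (p * Real.exp p + 2 * p) * θ := by
  have h1 : (1 + θ) ^ p ≤ Real.exp (p * θ) := by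
    rw [mul_comm, Real.exp_mul]
    exact Real.rpow_le_rpow (by linarith) (by linarith [Real.add_one_le_exp θ]) hp.le
  have h2 : Real.exp (p * θ) ≤ 1 + p * θ * Real.exp (p * θ) := by
    have := Real.add_one_le_exp (-(p * θ))
    have e : Real.exp (-(p * θ)) * Real.exp (p * θ) = 1 := by rw [← Real.exp_add]; simp
    nlinarith [Real.exp_pos (p * θ)]
  have h3 : Real.exp (p * θ) ≤ Real.exp p := Real.exp_le_exp.2 (by nlinarith)
  have h4 : p * θ * Real.exp (p * θ) ≤ p * θ * Real.exp p := by gcongr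
  have : 0 ≤ 2 * p * θ := by positivity
  linarith

lemma one_sub_rpow_ge {p θ : ℝ} (hp : 0 < p) (hθ : 0 ≤ θ) (hθ1 : θ ≤ 1 / 2) :
    1 - (p * Real.exp p + 2 * p) * θ ≤ (1 - θ) ^ p := by
  have hpos : 0 < 1 - θ := by linarith
  have hlog : -(2 * θ) ≤ Real.log (1 - θ) := by
    refine le_trans ?_ (Real.one_sub_inv_le_log_of_pos hpos)
    have : (1 - θ)⁻¹ ≤ 1 + 2 * θ := by
      rw [inv_le_iff_one_le_mul₀ hpos]
      nlinarith
    linarith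
  rw [Real.rpow_def_of_pos hpos]
  have h1 := Real.add_one_le_exp (Real.log (1 - θ) * p)
  have h2 : 0 ≤ p * Real.exp p * θ := by positivity
  nlinarith

/-- The exponent `β` such that a law whose tail is `c * x ^ (-α)` up to `O(x ^ (-(α + ε)))` has a
quantile function which differs from the one of the exact power law by `O(v ^ (-β))`. -/
noncomputable def quantileExponent (α ε c : ℝ) : ℝ :=
  if c = 0 then 1 / (α + ε) else (1 - ε) / α

/-- The function `q` is a tail quantile function of a law with tail `c * x ^ (-α)` up to
`K * x ^ (-(α + ε))`: it lies between the solutions of the equations "lower bound of the tail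
equals `v`" and "upper bound of the tail equals `v`". -/
structure IsTailQuantile (α ε c K : ℝ) (q : ℝ → ℝ) : Prop where
  le_of_le : ∀ v ∈ Set.Ioo (0 : ℝ) (1 / 2), ∀ x, 0 < x →
    c * x ^ (-α) + K * x ^ (-(α + ε)) ≤ v → q v ≤ x
  ge_of_le : ∀ v ∈ Set.Ioo (0 : ℝ) (1 / 2), ∀ x, 0 < x →
    v ≤ c * x ^ (-α) - K * x ^ (-(α + ε)) → x ≤ q v
  bddBelow : ∃ B, ∀ v ∈ Set.Ioo (0 : ℝ) (1 / 2), -B ≤ q v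

/-- Without a main term the power quantile vanishes, and the quantile itself is bounded by the
remainder of the tail. -/
lemma IsTailQuantile.bound_zero {α ε K : ℝ} {q : ℝ → ℝ} (hα : 0 < α) (hK : 0 < K) (hε : 0 < ε)
    (h : IsTailQuantile α ε 0 K q) :
    ∃ C, 0 ≤ C ∧ ∀ v ∈ Set.Ioo (0 : ℝ) (1 / 2),
      |q v - powerQuantile α 0 v| ≤ C * (1 + v ^ (-(1 / (α + ε)))) := by
  obtain ⟨B, hB⟩ := h.bddBelow
  refine ⟨|B| + K ^ (1 / (α + ε)), by positivity, fun v hv => ?_⟩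
  have hv0 : 0 < v := hv.1
  have hαε : 0 < α + ε := by linarith
  have hx : 0 < (K / v) ^ (1 / (α + ε)) := by positivity
  have h1 := h.le_of_le v hv _ hx (by
    rw [zero_mul, zero_add, ← Real.rpow_mul (by positivity),
      show 1 / (α + ε) * -(α + ε) = -1 by field_simp, Real.rpow_neg_one, inv_div,
      mul_div_cancel₀ _ hK.ne'])
  have h2 := hB v hv
  have e : (K / v) ^ (1 / (α + ε)) = K ^ (1 / (α + ε)) * v ^ (-(1 / (α + ε))) := by
    rw [Real.div_rpow hK.le hv0.le, Real.rpow_neg hv0.le, div_eq_mul_inv]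
  have hz : powerQuantile α 0 v = 0 := by
    rw [powerQuantile, zero_div, Real.zero_rpow (by positivity)]
  rw [hz, sub_zero, abs_le]
  rw [e] at h1
  have p1 : 0 ≤ v ^ (-(1 / (α + ε))) := by positivity
  have p2 : 0 ≤ K ^ (1 / (α + ε)) := by positivity
  have p3 := mul_nonneg p2 p1
  have p4 := mul_nonneg (abs_nonneg B) p1
  have p5 := le_abs_self B
  constructor
  · nlinarith
  · nlinarith [abs_nonneg B]

/-- A main term of the tail improves the bound for the quantile: the remainder changes the solution
`y` of `c * y ^ (-α) = v` by a relative error of order `y ^ (-ε)`, and `y ^ (1 - ε)` is of order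
`v ^ (-(1 - ε) / α)`. -/
lemma IsTailQuantile.bound_pos {α ε c K : ℝ} {q : ℝ → ℝ} (hα : 0 < α) (hK : 0 < K) (hε : 0 < ε)
    (hc : 0 < c) (h : IsTailQuantile α ε c K q) :
    ∃ C, 0 ≤ C ∧ ∀ v ∈ Set.Ioo (0 : ℝ) (1 / 2),
      |q v - powerQuantile α c v| ≤ C * (1 + v ^ (-((1 - ε) / α))) := by
  obtain ⟨B, hB⟩ := h.bddBelow
  -- With `y = powerQuantile α c v`, the equations for the quantile have approximate solutions
  -- `y * (1 ± θ) ^ (1 / α)`, `θ = D * y ^ (-ε)`, as long as `θ ≤ 1 / 2`.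
  set D := K * 2 ^ (ε / α) / c with hD
  have h2εα : (1 : ℝ) ≤ 2 ^ (ε / α) := Real.one_le_rpow (by norm_num) (by positivity)
  have hDpos : 0 < D := by positivity
  set p := 1 / α with hp
  have hp0 : 0 < p := by positivity
  set M := p * Real.exp p + 2 * p with hM
  have hM0 : 0 < M := by positivity
  -- If `θ > 1 / 2`, then `y ≤ Y`, so `v` is bounded below and `q v` is bounded above by `x₀`.
  set Y := (2 * D) ^ (1 / ε) with hY
  have hY0 : 0 < Y := by positivity
  obtain ⟨x₀, hx₀, hx₀v⟩ : ∃ x₀ : ℝ, 0 < x₀ ∧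
      c * x₀ ^ (-α) + K * x₀ ^ (-(α + ε)) ≤ c * Y ^ (-α) := by
    have t1 := (tendsto_rpow_neg_atTop hα).const_mul c
    have t2 := (tendsto_rpow_neg_atTop (show 0 < α + ε by linarith)).const_mul K
    have t := t1.add t2
    simp only [mul_zero, add_zero] at t
    have hpos : 0 < c * Y ^ (-α) := by positivity
    obtain ⟨x₀, h1, h2⟩ := ((t.eventually (gt_mem_nhds hpos)).and (eventually_gt_atTop 0)).exists
    exact ⟨x₀, h2, h1.le⟩
  refine ⟨(|B| + x₀ + Y) + M * D * c ^ ((1 - ε) / α), by positivity, fun v hv => ?_⟩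
  have hv0 : 0 < v := hv.1
  have hv' : 0 ≤ v ^ (-((1 - ε) / α)) := by positivity
  set y := powerQuantile α c v with hy
  have hy0 : 0 < y := by rw [hy, powerQuantile]; positivity
  have hyα : c * y ^ (-α) = v := by
    rw [hy, powerQuantile, ← Real.rpow_mul (by positivity),
      show 1 / α * -α = -1 by field_simp, Real.rpow_neg_one, inv_div, mul_div_cancel₀ _ hc.ne']
  set θ := D * y ^ (-ε) with hθ
  have hθ0 : 0 ≤ θ := by positivity
  have hcD : 0 ≤ M * D * c ^ ((1 - ε) / α) := by positivity
  have hBxY : 0 ≤ |B| + x₀ + Y := by positivity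
  rcases le_or_gt θ (1 / 2) with hθ1 | hθ1
  · have hyθ : y * θ = D * c ^ ((1 - ε) / α) * v ^ (-((1 - ε) / α)) := by
      have e1 : y * y ^ (-ε) = y ^ (1 - ε) := by
        rw [sub_eq_add_neg, Real.rpow_add hy0, Real.rpow_one]
      have e2 : y ^ (1 - ε) = c ^ ((1 - ε) / α) * v ^ (-((1 - ε) / α)) := by
        rw [hy, powerQuantile, ← Real.rpow_mul (by positivity),
          show 1 / α * (1 - ε) = (1 - ε) / α by ring, Real.div_rpow hc.le hv0.le,
          Real.rpow_neg hv0.le, div_eq_mul_inv]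
      rw [hθ, mul_left_comm, e1, e2, mul_assoc]
    have up : q v ≤ y * (1 + θ) ^ p := by
      refine h.le_of_le v hv _ (by positivity) ?_
      have hθ' : 0 < 1 + θ := by linarith
      have e1 : (y * (1 + θ) ^ p) ^ (-α) = y ^ (-α) * (1 + θ)⁻¹ := by
        rw [Real.mul_rpow hy0.le (by positivity), ← Real.rpow_mul hθ'.le,
          show p * -α = -1 by rw [hp]; field_simp, Real.rpow_neg_one]
      have e2 : (y * (1 + θ) ^ p) ^ (-ε) ≤ y ^ (-ε) := by
        refine Real.rpow_le_rpow_of_nonpos hy0 ?_ (by linarith)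
        exact le_mul_of_one_le_right hy0.le (Real.one_le_rpow (by linarith) hp0.le)
      rw [neg_add, Real.rpow_add (by positivity), e1, ← hyα]
      have hy1 : 0 < y ^ (-α) := by positivity
      have hy2 : 0 < y ^ (-ε) := by positivity
      calc c * (y ^ (-α) * (1 + θ)⁻¹) + K * (y ^ (-α) * (1 + θ)⁻¹ * (y * (1 + θ) ^ p) ^ (-ε))
          ≤ c * (y ^ (-α) * (1 + θ)⁻¹) + K * (y ^ (-α) * (1 + θ)⁻¹ * y ^ (-ε)) := by gcongr
        _ = y ^ (-α) * ((c + K * y ^ (-ε)) * (1 + θ)⁻¹) := by ring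
        _ ≤ y ^ (-α) * c := by
          gcongr
          rw [← div_eq_mul_inv, div_le_iff₀ hθ', mul_add, mul_one, hθ, hD]
          have : c * (K * 2 ^ (ε / α) / c * y ^ (-ε)) = 2 ^ (ε / α) * (K * y ^ (-ε)) := by
            field_simp
          rw [this]
          have := le_mul_of_one_le_left (show 0 ≤ K * y ^ (-ε) by positivity) h2εα
          linarith
        _ = _ := by ring
    have lo : y * (1 - θ) ^ p ≤ q v := by
      have hθ' : 0 < 1 - θ := by linarith
      refine h.ge_of_le v hv _ (by positivity) ?_
      have e1 : (y * (1 - θ) ^ p) ^ (-α) = y ^ (-α) * (1 - θ)⁻¹ := by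
        rw [Real.mul_rpow hy0.le (by positivity), ← Real.rpow_mul hθ'.le,
          show p * -α = -1 by rw [hp]; field_simp, Real.rpow_neg_one]
      have e2 : (y * (1 - θ) ^ p) ^ (-ε) ≤ y ^ (-ε) * 2 ^ (ε / α) := by
        rw [Real.mul_rpow hy0.le (by positivity), ← Real.rpow_mul hθ'.le]
        gcongr
        calc (1 - θ) ^ (p * -ε) ≤ (1 / 2) ^ (p * -ε) :=
              Real.rpow_le_rpow_of_nonpos (by norm_num) (by linarith)
                (by have := mul_pos hp0 hε; linarith)
          _ = 2 ^ (ε / α) := by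
              rw [one_div, Real.inv_rpow zero_le_two, ← Real.rpow_neg zero_le_two]
              congr 1
              rw [hp]
              ring
      rw [neg_add, Real.rpow_add (by positivity), e1]
      nth_rw 1 [← hyα]
      have hy1 : 0 < y ^ (-α) := by positivity
      have hy2 : 0 < y ^ (-ε) := by positivity
      calc c * y ^ (-α) = y ^ (-α) * ((c - c * θ) * (1 - θ)⁻¹) := by field_simp
        _ = c * (y ^ (-α) * (1 - θ)⁻¹) -
            K * (y ^ (-α) * (1 - θ)⁻¹ * (y ^ (-ε) * 2 ^ (ε / α))) := by
          rw [show c * θ = K * (y ^ (-ε) * 2 ^ (ε / α)) by rw [hθ, hD]; field_simp]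
          ring
        _ ≤ _ := by gcongr
    have u1 := mul_le_mul_of_nonneg_left (one_add_rpow_le hp0 hθ0 hθ1) hy0.le
    have l1 := mul_le_mul_of_nonneg_left (one_sub_rpow_ge hp0 hθ0 hθ1) hy0.le
    have e : y * (M * θ) = M * D * c ^ ((1 - ε) / α) * v ^ (-((1 - ε) / α)) := by
      rw [mul_left_comm, hyθ]; ring
    have b1 := mul_nonneg hBxY hv'
    rw [abs_le]
    constructor <;> linarith
  · have hyY : y < Y := by
      have h1 : y ^ ε < 2 * D := by
        have hpos : 0 < y ^ ε := by positivity
        rw [hθ, Real.rpow_neg hy0.le, ← div_eq_mul_inv, lt_div_iff₀ hpos] at hθ1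
        linarith
      have := Real.rpow_lt_rpow (by positivity) h1 (show 0 < 1 / ε by positivity)
      rwa [← Real.rpow_mul hy0.le, mul_one_div_cancel hε.ne', Real.rpow_one] at this
    have hqx : q v ≤ x₀ := by
      refine h.le_of_le v hv _ hx₀ (hx₀v.trans ?_)
      rw [← hyα]
      have := Real.rpow_le_rpow_of_nonpos hy0 hyY.le (show -α ≤ 0 by linarith)
      gcongr
    have hqB := hB v hv
    have b1 := mul_nonneg hBxY hv'
    have b2 := mul_nonneg hcD hv'
    have b3 := le_abs_self B
    have b4 := abs_nonneg B
    rw [abs_le]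
    constructor <;> linarith

lemma IsTailQuantile.lintegral_lt_top {α γ ε c K : ℝ} {q : ℝ → ℝ} (hα : 0 < α) (hγ : 0 < γ)
    (hK : 0 < K) (hε : 0 < ε) (hc : 0 ≤ c) (hβ : quantileExponent α ε c * γ < 1)
    (h : IsTailQuantile α ε c K q) :
    ∫⁻ v in Set.Ioo (0 : ℝ) (1 / 2), ‖q v - powerQuantile α c v‖ₑ ^ γ < ∞ := by
  obtain ⟨C, hC0, hC⟩ : ∃ C, 0 ≤ C ∧ ∀ v ∈ Set.Ioo (0 : ℝ) (1 / 2),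
      |q v - powerQuantile α c v| ≤ C * (1 + v ^ (-quantileExponent α ε c)) := by
    rcases hc.eq_or_lt with rfl | hc
    · rw [quantileExponent, if_pos rfl]
      exact h.bound_zero hα hK hε
    · rw [quantileExponent, if_neg hc.ne']
      exact h.bound_pos hα hK hε hc
  set β := quantileExponent α ε c
  calc ∫⁻ v in Set.Ioo (0 : ℝ) (1 / 2), ‖q v - powerQuantile α c v‖ₑ ^ γ
      ≤ ∫⁻ v in Set.Ioo (0 : ℝ) (1 / 2), (‖C‖ₑ * (‖(1 : ℝ)‖ₑ + ‖v ^ (-β)‖ₑ)) ^ γ := by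
        refine setLIntegral_mono (by fun_prop) fun v hv => ?_
        refine ENNReal.rpow_le_rpow ?_ hγ.le
        have hv0 : 0 ≤ v ^ (-β) := Real.rpow_nonneg hv.1.le _
        rw [← ofReal_norm, Real.norm_eq_abs, Real.enorm_of_nonneg hC0,
          Real.enorm_of_nonneg zero_le_one, Real.enorm_of_nonneg hv0,
          ← ENNReal.ofReal_add zero_le_one hv0, ← ENNReal.ofReal_mul hC0]
        exact ENNReal.ofReal_le_ofReal (hC v hv)
    _ = ‖C‖ₑ ^ γ * ∫⁻ v in Set.Ioo (0 : ℝ) (1 / 2), (‖(1 : ℝ)‖ₑ + ‖v ^ (-β)‖ₑ) ^ γ := by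
        simp_rw [ENNReal.mul_rpow_of_nonneg _ _ hγ.le]
        rw [lintegral_const_mul _ (by fun_prop)]
    _ < ∞ := by
        refine ENNReal.mul_lt_top (by finiteness)
          (lintegral_add_rpow_lt_top hγ (by fun_prop) (by fun_prop) (by simp) ?_)
        refine lintegral_enorm_rpow_rpow_lt_top hγ.le measurableSet_Ioo Set.Ioo_subset_Ioi_self
          (integrableOn_Ioo_rpow (by linarith))

lemma quantile_mono (μ : Measure ℝ) {u v : ℝ} (hu : u ∈ Set.Ioo (0 : ℝ) 1)
    (hv : v ∈ Set.Ioo (0 : ℝ) 1) (huv : u ≤ v) : quantile μ u ≤ quantile μ v :=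
  (quantile_le_iff μ hu _).2 (huv.trans ((quantile_le_iff μ hv _).1 le_rfl))

lemma isTailQuantile_right {μ : Measure ℝ} {α ε c K : ℝ}
    (h : ∀ x : ℝ, 0 < x → |1 - c * x ^ (-α) - cdf μ x| < K * x ^ (-(α + ε))) :
    IsTailQuantile α ε c K fun v => quantile μ (1 - v) where
  le_of_le v hv x hx hxv := by
    have hu : 1 - v ∈ Set.Ioo (0 : ℝ) 1 := ⟨by linarith [hv.2], by linarith [hv.1]⟩
    rw [quantile_le_iff μ hu]
    linarith [(abs_lt.1 (h x hx)).2]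
  ge_of_le v hv x hx hxv := by
    have hu : 1 - v ∈ Set.Ioo (0 : ℝ) 1 := ⟨by linarith [hv.2], by linarith [hv.1]⟩
    refine (not_le.1 fun hle => ?_).le
    rw [quantile_le_iff μ hu] at hle
    linarith [(abs_lt.1 (h x hx)).1]
  bddBelow := by
    refine ⟨-quantile μ (1 / 2), fun v hv => ?_⟩
    rw [neg_neg]
    exact quantile_mono μ ⟨by norm_num, by norm_num⟩ ⟨by linarith [hv.2], by linarith [hv.1]⟩
      (by linarith [hv.2])

lemma isTailQuantile_left {μ : Measure ℝ} {α ε c K : ℝ}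
    (h : ∀ x : ℝ, x < 0 → |cdf μ x - c * (-x) ^ (-α)| < K * (-x) ^ (-(α + ε))) :
    IsTailQuantile α ε c K fun v => -quantile μ v where
  le_of_le v hv x hx hxv := by
    have hu : v ∈ Set.Ioo (0 : ℝ) 1 := ⟨hv.1, by linarith [hv.2]⟩
    rw [neg_le]
    refine (not_le.1 fun hle => ?_).le
    rw [quantile_le_iff μ hu] at hle
    have := (abs_lt.1 (h (-x) (by linarith))).2
    rw [neg_neg] at this
    linarith
  ge_of_le v hv x hx hxv := by
    have hu : v ∈ Set.Ioo (0 : ℝ) 1 := ⟨hv.1, by linarith [hv.2]⟩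
    rw [le_neg, quantile_le_iff μ hu]
    have := (abs_lt.1 (h (-x) (by linarith))).1
    rw [neg_neg] at this
    linarith
  bddBelow := by
    refine ⟨quantile μ (1 / 2), fun v hv => neg_le_neg ?_⟩
    exact quantile_mono μ ⟨hv.1, by linarith [hv.2]⟩ ⟨by norm_num, by norm_num⟩ hv.2.le

/-- The uniform law on `(0, 1)`, folded at `1/2`: the left half carries the left tail and the
reflected right half the right tail. -/
lemma restrict_Ioo_eq_add_map_one_sub :
    volume.restrict (Set.Ioo (0 : ℝ) 1) = volume.restrict (Set.Ioo (0 : ℝ) (1 / 2)) +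
      (volume.restrict (Set.Ioo (0 : ℝ) (1 / 2))).map (fun v => 1 - v) := by
  have e : (volume.restrict (Set.Ioo (0 : ℝ) (1 / 2))).map (fun v => 1 - v) =
      volume.restrict (Set.Ioo (1 / 2 : ℝ) 1) := by
    have hp := (Measure.measurePreserving_sub_left (volume : Measure ℝ) 1).restrict_preimage
      (measurableSet_Ioo (a := (1 / 2 : ℝ)) (b := 1))
    have hs : (fun v : ℝ => 1 - v) ⁻¹' Set.Ioo (1 / 2) 1 = Set.Ioo 0 (1 / 2) := by
      rw [Set.preimage_const_sub_Ioo]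
      norm_num
    rw [hs] at hp
    exact hp.map_eq
  rw [e, ← Measure.restrict_union (Set.disjoint_left.2 fun x hx hx' => by
    linarith [hx.2, hx'.1]) measurableSet_Ioo]
  refine Measure.restrict_congr_set ?_
  have h2 : (Set.Ioo (1 / 2 : ℝ) 1 : Set ℝ) =ᵐ[volume] Set.Ico (1 / 2 : ℝ) 1 := Ioo_ae_eq_Ico
  have h3 : Set.Ioo (0 : ℝ) (1 / 2) ∪ Set.Ico (1 / 2 : ℝ) 1 = Set.Ioo 0 1 :=
    Set.Ioo_union_Ico_eq_Ioo (by norm_num) (by norm_num)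
  rw [← h3]
  exact (ae_eq_set_union (Filter.EventuallyEq.refl _ _) h2).symm

/-- The quantile coupling with the exact power law has finite cost. -/
lemma finiteDist_powerMeasure {μ : Measure ℝ} [IsProbabilityMeasure μ] {α γ ε cp cm K : ℝ}
    (hα : 0 < α) (hγ : 0 < γ) (hK : 0 < K) (hε : 0 < ε) (hcp : 0 ≤ cp) (hcm : 0 ≤ cm)
    (hβp : quantileExponent α ε cp * γ < 1) (hβm : quantileExponent α ε cm * γ < 1)
    (hpos : ∀ x : ℝ, 0 < x → |1 - cp * x ^ (-α) - cdf μ x| < K * x ^ (-(α + ε)))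
    (hneg : ∀ x : ℝ, x < 0 → |cdf μ x - cm * (-x) ^ (-α)| < K * (-x) ^ (-(α + ε))) :
    FiniteDist γ μ (powerMeasure α cp cm (Set.Ioo 0 (1 / 2))) := by
  classical
  let y : ℝ → ℝ := fun u => if u ≤ 1 / 2 then -powerQuantile α cm u else powerQuantile α cp (1 - u)
  have hy : Measurable y := Measurable.ite measurableSet_Iic (by fun_prop) (by fun_prop)
  have hq := measurable_quantile μ
  have y1 : ∀ v ∈ Set.Ioo (0 : ℝ) (1 / 2), y v = -powerQuantile α cm v := fun v hv =>
    if_pos hv.2.le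
  have y2 : ∀ v ∈ Set.Ioo (0 : ℝ) (1 / 2), y (1 - v) = powerQuantile α cp v := fun v hv => by
    simp only [y]
    rw [if_neg (by linarith [hv.2]), sub_sub_cancel]
  have ey : (volume.restrict (Set.Ioo (0 : ℝ) 1)).map y =
      powerMeasure α cp cm (Set.Ioo 0 (1 / 2)) := by
    rw [restrict_Ioo_eq_add_map_one_sub, Measure.map_add _ _ hy, Measure.map_map hy (by fun_prop),
      powerMeasure, add_comm]
    congr 1
    · refine Measure.map_congr ?_
      filter_upwards [ae_restrict_mem measurableSet_Ioo] with v hv using y2 v hv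
    · refine Measure.map_congr ?_
      filter_upwards [ae_restrict_mem measurableSet_Ioo] with v hv using y1 v hv
  rw [← ey]
  nth_rw 1 [← map_quantile μ]
  refine finiteDist_map hq hy ?_
  rw [restrict_Ioo_eq_add_map_one_sub, lintegral_add_measure,
    lintegral_map (by fun_prop) (by fun_prop)]
  refine ENNReal.add_lt_top.2 ⟨?_, ?_⟩
  · have := (isTailQuantile_left hneg).lintegral_lt_top hα hγ hK hε hcm hβm
    refine lt_of_eq_of_lt (setLIntegral_congr_fun measurableSet_Ioo fun v hv => ?_) this
    rw [y1 v hv, ← enorm_neg]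
    congr 2
    ring
  · have := (isTailQuantile_right hpos).lintegral_lt_top hα hγ hK hε hcp hβp
    refine lt_of_eq_of_lt (setLIntegral_congr_fun measurableSet_Ioo fun v hv => ?_) this
    rw [y2 v hv]

/-- A tail constant is non-negative, because it is the limit of `x ^ α` times a probability. -/
lemma tail_constant_nonneg {α ε c K : ℝ} {G : ℝ → ℝ} (hε : 0 < ε) (hG : ∀ x, 0 ≤ G x)
    (h : ∀ x : ℝ, 0 < x → |G x - c * x ^ (-α)| < K * x ^ (-(α + ε))) : 0 ≤ c := by
  have key : ∀ x : ℝ, 0 < x → 0 ≤ c + K * x ^ (-ε) := by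
    intro x hx
    have h1 := (abs_lt.1 (h x hx)).2
    have h2 := hG x
    rw [neg_add, Real.rpow_add hx] at h1
    have h3 : 0 < x ^ (-α) := Real.rpow_pos_of_pos hx _
    have h4 : 0 ≤ x ^ (-α) * (c + K * x ^ (-ε)) := by nlinarith
    exact nonneg_of_mul_nonneg_right h4 h3
  have t : Tendsto (fun x : ℝ => c + K * x ^ (-ε)) atTop (𝓝 c) := by
    simpa using ((tendsto_rpow_neg_atTop hε).const_mul K).const_add c
  exact ge_of_tendsto t ((eventually_gt_atTop 0).mono key)

/-- A law with power tails of order `α` is at finite Wasserstein distance from its image under the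
smoothing transformation. -/
lemma finiteDist_smooth_of_tails {μ : Measure ℝ} [IsProbabilityMeasure μ] {α γ ε cp cm K : ℝ}
    (hα : 0 < α) (hαγ : α < γ) (hγα : γ < 2 * α) (hK : 0 < K) (hε : 0 < ε)
    (hβp : quantileExponent α ε cp * γ < 1) (hβm : quantileExponent α ε cm * γ < 1)
    (hpos : ∀ x : ℝ, 0 < x → |1 - cp * x ^ (-α) - cdf μ x| < K * x ^ (-(α + ε)))
    (hneg : ∀ x : ℝ, x < 0 → |cdf μ x - cm * (-x) ^ (-α)| < K * (-x) ^ (-(α + ε)))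
    {ρ : Measure (ℝ × ℝ)} [IsProbabilityMeasure ρ] (hρ0 : ∀ᵐ w ∂ρ, 0 ≤ w.1 ∧ 0 ≤ w.2)
    (hρα : weightMoment α ρ = 1) (hργ : weightMoment γ ρ < ∞) :
    FiniteDist γ μ (smooth ρ μ) ∧ (1 < α → Integrable (fun x => x) μ) := by
  have hγ : 0 < γ := hα.trans hαγ
  have hcp : 0 ≤ cp := by
    refine tail_constant_nonneg (α := α) (K := K) (G := fun x => 1 - cdf μ x) hε
      (fun x => by linarith [cdf_le_one μ x]) fun x hx => ?_
    rw [sub_right_comm]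
    exact hpos x hx
  have hcm : 0 ≤ cm := by
    refine tail_constant_nonneg (α := α) (K := K) (G := fun x => cdf μ (-x)) hε
      (fun x => cdf_nonneg μ _) fun x hx => ?_
    simpa using hneg (-x) (by linarith)
  have d := finiteDist_powerMeasure hα hγ hK hε hcp hcm hβp hβm hpos hneg
  refine ⟨?_, fun h1 => ?_⟩
  · exact (d.trans hγ (finiteDist_smooth_powerMeasure hα hαγ hγα hcp hcm hρ0 hρα hργ)).trans hγ
      (d.smooth hγ hργ).symm
  · obtain ⟨π, ⟨e1, e2⟩, hc⟩ := d
    have hπ : IsProbabilityMeasure π := IsCoupling.isProbabilityMeasure ⟨e1, e2⟩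
    have hm := lintegral_powerMeasure_Ioo_lt_top hα hcp hcm zero_le_one h1
    rw [← e2, lintegral_map (by fun_prop) (by fun_prop)] at hm
    simp only [ENNReal.rpow_one] at hm
    rw [← e1, integrable_map_measure (by fun_prop) (by fun_prop)]
    have i2 : Integrable (fun z : ℝ × ℝ => z.2) π := ⟨by fun_prop, hm⟩
    have i1 : Integrable (fun z : ℝ × ℝ => z.1 - z.2) π :=
      integrable_of_lintegral_rpow_lt_top (h1.trans hαγ).le (by fun_prop) hc
    exact (i1.add i2).congr (ae_of_all _ fun z => by simp)

/-! ### The fixed point of the smoothing transformation -/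

lemma integral_smooth {ρ : Measure (ℝ × ℝ)} [IsProbabilityMeasure ρ] {μ : Measure ℝ}
    [IsProbabilityMeasure μ] (hl : Integrable (fun w : ℝ × ℝ => w.1) ρ)
    (hr : Integrable (fun w : ℝ × ℝ => w.2) ρ) (hμ : Integrable (fun x => x) μ) :
    Integrable (fun x => x) (smooth ρ μ) ∧
      ∫ x, x ∂(smooth ρ μ) = (∫ w, (w.1 + w.2) ∂ρ) * ∫ x, x ∂μ := by
  have h1 : Integrable (fun z : ℝ × ℝ => z.1) (μ.prod μ) := hμ.comp_fst μ
  have h2 : Integrable (fun z : ℝ × ℝ => z.2) (μ.prod μ) := hμ.comp_snd μ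
  have i1 : Integrable (fun w : (ℝ × ℝ) × ℝ × ℝ => w.1.1 * w.2.1) (ρ.prod (μ.prod μ)) :=
    hl.mul_prod h1
  have i2 : Integrable (fun w : (ℝ × ℝ) × ℝ × ℝ => w.1.2 * w.2.2) (ρ.prod (μ.prod μ)) :=
    hr.mul_prod h2
  refine ⟨?_, ?_⟩
  · rw [smooth, integrable_map_measure (by fun_prop) (by fun_prop)]
    exact i1.add i2
  · rw [smooth, integral_map (by fun_prop) (by fun_prop), integral_add i1 i2,
      integral_prod_mul (fun w : ℝ × ℝ => w.1) (fun z : ℝ × ℝ => z.1),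
      integral_prod_mul (fun w : ℝ × ℝ => w.2) (fun z : ℝ × ℝ => z.2), integral_add hl hr,
      integral_fun_fst (fun x : ℝ => x), integral_fun_snd (fun x : ℝ => x)]
    simp only [probReal_univ, one_smul]
    ring

lemma charFun_smooth (ρ : Measure (ℝ × ℝ)) [IsProbabilityMeasure ρ] (μ : Measure ℝ)
    [IsProbabilityMeasure μ] (t : ℝ) :
    charFun (smooth ρ μ) t = ∫ w, charFun μ (w.1 * t) * charFun μ (w.2 * t) ∂ρ := by
  have hint : Integrable (fun w : (ℝ × ℝ) × ℝ × ℝ =>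
      Complex.exp (t * (w.1.1 * w.2.1 + w.1.2 * w.2.2 : ℝ) * Complex.I)) (ρ.prod (μ.prod μ)) := by
    refine (integrable_const (1 : ℝ)).mono' (by fun_prop) (ae_of_all _ fun w => ?_)
    rw [← Complex.ofReal_mul, Complex.norm_exp_ofReal_mul_I]
  rw [charFun_apply_real, smooth, integral_map (by fun_prop) (by fun_prop), integral_prod _ hint]
  refine integral_congr_ae (ae_of_all _ fun w => ?_)
  simp only [charFun_apply_real]
  rw [← integral_prod_mul]
  refine integral_congr_ae (ae_of_all _ fun z => ?_)
  simp only [← Complex.exp_add]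
  congr 1
  push_cast
  ring

lemma tendsto_charFun_of_ae_tendsto {Ω : Type*} [MeasurableSpace Ω] {M : Measure Ω}
    [IsProbabilityMeasure M] {Z : ℕ → Ω → ℝ} {Z' : Ω → ℝ} (hZ : ∀ n, Measurable (Z n))
    (hZ' : Measurable Z') (h : ∀ᵐ ω ∂M, Tendsto (fun n => Z n ω) atTop (𝓝 (Z' ω))) (t : ℝ) :
    Tendsto (fun n => charFun (M.map (Z n)) t) atTop (𝓝 (charFun (M.map Z') t)) := by
  have e : ∀ f : Ω → ℝ, Measurable f →
      charFun (M.map f) t = ∫ ω, Complex.exp (t * f ω * Complex.I) ∂M := fun f hf => by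
    rw [charFun_apply_real, integral_map hf.aemeasurable (by fun_prop)]
  simp_rw [e _ (hZ _), e _ hZ']
  refine tendsto_integral_of_dominated_convergence (fun _ => (1 : ℝ)) (fun n => ?_)
    (integrable_const _) (fun n => ae_of_all _ fun ω => ?_) ?_
  · have := hZ n
    fun_prop
  · rw [← Complex.ofReal_mul, Complex.norm_exp_ofReal_mul_I]
  · filter_upwards [h] with ω hω
    have hc : Continuous fun x : ℝ => Complex.exp (t * x * Complex.I) := by fun_prop
    exact (hc.tendsto _).comp hω

/-- A weak limit of the iterates of the smoothing transformation is a fixed point. -/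
lemma smooth_eq_of_tendsto_charFun {ρ : Measure (ℝ × ℝ)} [IsProbabilityMeasure ρ]
    {μ : ℕ → Measure ℝ} [∀ n, IsProbabilityMeasure (μ n)] {ν : Measure ℝ} [IsProbabilityMeasure ν]
    (hμ : ∀ n, μ (n + 1) = smooth ρ (μ n))
    (h : ∀ t, Tendsto (fun n => charFun (μ n) t) atTop (𝓝 (charFun ν t))) : smooth ρ ν = ν := by
  refine Measure.ext_of_charFun (funext fun t => ?_)
  have h1 : Tendsto (fun n => charFun (μ (n + 1)) t) atTop (𝓝 (charFun (smooth ρ ν) t)) := by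
    simp_rw [hμ, charFun_smooth]
    refine tendsto_integral_of_dominated_convergence (fun _ => (1 : ℝ)) (fun n => ?_)
      (integrable_const _) (fun n => ae_of_all _ fun w => ?_) (ae_of_all _ fun w => ?_)
    · exact (((measurable_charFun (μ := μ n)).comp (by fun_prop)).mul
        ((measurable_charFun (μ := μ n)).comp (by fun_prop))).aestronglyMeasurable
    · rw [norm_mul]
      exact mul_le_one₀ (norm_charFun_le_one _) (norm_nonneg _) (norm_charFun_le_one _)
    · exact (h _).mul (h _)
  exact tendsto_nhds_unique h1 ((h t).comp (tendsto_add_atTop_nat 1))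

lemma tsum_lt_top_of_tsum_rpow_lt_top {g : ℝ} (hg : 0 < g) (hg1 : g ≤ 1) {a : ℕ → ℝ≥0∞}
    (h : ∑' n, a n ^ g < ∞) : ∑' n, a n < ∞ := by
  have key : ∀ s : Finset ℕ, (∑ n ∈ s, a n) ^ g ≤ ∑ n ∈ s, a n ^ g := by
    intro s
    classical
    induction s using Finset.induction_on with
    | empty => simp [hg]
    | insert n s hn ih =>
      rw [Finset.sum_insert hn, Finset.sum_insert hn]
      exact (ENNReal.rpow_add_le_add_rpow _ _ hg.le hg1).trans (add_le_add_right ih _)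
  refine lt_of_le_of_lt (b := (∑' n, a n ^ g) ^ (1 / g)) ?_
    (ENNReal.rpow_lt_top_of_nonneg (by positivity) h.ne)
  rw [ENNReal.tsum_eq_iSup_sum]
  refine iSup_le fun s => ?_
  rw [one_div, ENNReal.le_rpow_inv_iff hg]
  exact (key s).trans (ENNReal.sum_le_tsum s)

/-- For `γ > 1` this is the inequality between the `L¹` norm and the `L^γ` norm. -/
lemma lintegral_rpow_min_le {γ : ℝ} {Ω : Type*} [MeasurableSpace Ω] {M : Measure Ω}
    [IsProbabilityMeasure M] {f : Ω → ℝ} (hf : Measurable f) :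
    ∫⁻ ω, ‖f ω‖ₑ ^ min γ 1 ∂M ≤ (∫⁻ ω, ‖f ω‖ₑ ^ γ ∂M) ^ (1 / max γ 1) := by
  rcases le_total γ 1 with h | h
  · simp [h]
  · rw [min_eq_right h, max_eq_left h]
    have := eLpNorm'_le_eLpNorm'_of_exponent_le zero_lt_one h M hf.aestronglyMeasurable
    simpa only [eLpNorm', div_one, ENNReal.rpow_one] using this

lemma lintegral_sum_rpow_le {γ : ℝ} (hγ : 0 < γ) {Ω : Type*} [MeasurableSpace Ω] {M : Measure Ω}
    {f : ℕ → Ω → ℝ≥0∞} (hf : ∀ k, Measurable (f k)) (n : ℕ) :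
    (∫⁻ ω, (∑ k ∈ Finset.range n, f k ω) ^ γ ∂M) ^ (1 / max γ 1) ≤
      ∑ k ∈ Finset.range n, (∫⁻ ω, f k ω ^ γ ∂M) ^ (1 / max γ 1) := by
  have hm : 0 < max γ 1 := by positivity
  induction n with
  | zero => simp [hγ]
  | succ n ih =>
    simp_rw [Finset.sum_range_succ]
    refine (rpow_one_div_max_add_le hγ ?_ (hf n)).trans (add_le_add_left ih _)
    exact Finset.measurable_fun_sum _ fun k _ => hf k

/-- A random sequence whose increments have geometrically decreasing `γ`-th moments converges
almost surely, and its limit is at finite cost from its initial value. -/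
lemma exists_limit_of_geometric {γ : ℝ} (hγ : 0 < γ) {κ C : ℝ≥0∞} (hκ : κ < 1) (hC : C < ∞)
    {Ω : Type*} [MeasurableSpace Ω] {M : Measure Ω} [IsProbabilityMeasure M] {Z : ℕ → Ω → ℝ}
    (hZ : ∀ n, Measurable (Z n))
    (hd : ∀ n, ∫⁻ ω, ‖Z n ω - Z (n + 1) ω‖ₑ ^ γ ∂M ≤ κ ^ n * C) :
    ∃ Z' : Ω → ℝ, Measurable Z' ∧ (∀ᵐ ω ∂M, Tendsto (fun n => Z n ω) atTop (𝓝 (Z' ω))) ∧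
      ∫⁻ ω, ‖Z 0 ω - Z' ω‖ₑ ^ γ ∂M < ∞ ∧
      (1 < γ → Tendsto (fun n => ∫ ω, (Z 0 ω - Z n ω) ∂M) atTop (𝓝 (∫ ω, (Z 0 ω - Z' ω) ∂M))) := by
  set p := 1 / max γ 1 with hp
  have hp0 : 0 < p := by positivity
  set d : ℕ → Ω → ℝ := fun n ω => Z n ω - Z (n + 1) ω with hdd
  have hdm : ∀ n, Measurable (d n) := fun n => (hZ n).sub (hZ (n + 1))
  have hdp : ∀ n, (∫⁻ ω, ‖d n ω‖ₑ ^ γ ∂M) ^ p ≤ (κ ^ p) ^ n * C ^ p := fun n => by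
    refine (ENNReal.rpow_le_rpow (hd n) hp0.le).trans_eq ?_
    rw [ENNReal.mul_rpow_of_nonneg _ _ hp0.le, ← ENNReal.rpow_natCast, ← ENNReal.rpow_natCast,
      ← ENNReal.rpow_mul, ← ENNReal.rpow_mul, mul_comm (n : ℝ)]
  set B := ∑' n, (κ ^ p) ^ n * C ^ p with hB
  have hBtop : B < ∞ := by
    rw [hB, ENNReal.tsum_mul_right, ENNReal.tsum_geometric]
    have h1 : κ ^ p < 1 := ENNReal.rpow_lt_one hκ hp0
    exact ENNReal.mul_lt_top (ENNReal.inv_lt_top.2 (tsub_pos_of_lt h1))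
      (ENNReal.rpow_lt_top_of_nonneg hp0.le hC.ne)
  have hg0 : 0 < min γ 1 := by positivity
  have hsum : ∫⁻ ω, ∑' n, ‖d n ω‖ₑ ^ min γ 1 ∂M < ∞ := by
    rw [lintegral_tsum fun n => by have := hdm n; fun_prop]
    exact (ENNReal.tsum_le_tsum fun n => (lintegral_rpow_min_le (hdm n)).trans (hdp n)).trans_lt
      hBtop
  -- the increments are almost surely summable, so `∑' n, ‖d n ω‖ₑ` also dominates `Z 0 - Z n`
  have hae : ∀ᵐ ω ∂M, ∑' n, ‖d n ω‖ₑ < ∞ := by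
    filter_upwards [ae_lt_top (by have := hdm; fun_prop) hsum.ne] with ω hω
    exact tsum_lt_top_of_tsum_rpow_lt_top hg0 (min_le_right _ _) hω
  have hconv : ∀ᵐ ω ∂M, ∃ l, Tendsto (fun n => Z n ω) atTop (𝓝 l) := by
    filter_upwards [hae] with ω hω
    exact cauchySeq_tendsto_of_complete (cauchySeq_of_edist_le_of_tsum_ne_top _
      (fun n => (edist_eq_enorm_sub (Z n ω) (Z (n + 1) ω)).le) hω.ne)
  obtain ⟨Z', hZ', hlim⟩ :=
    measurable_limit_of_tendsto_metrizable_ae (fun n => (hZ n).aemeasurable) hconv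
  have htel : ∀ n ω, Z 0 ω - Z n ω = ∑ k ∈ Finset.range n, d k ω := fun n ω =>
    (Finset.sum_range_sub' (fun k => Z k ω) n).symm
  have hle : ∀ n ω, ‖Z 0 ω - Z n ω‖ₑ ≤ ∑ k ∈ Finset.range n, ‖d k ω‖ₑ := fun n ω => by
    rw [htel]; exact enorm_sum_le _ _
  refine ⟨Z', hZ', hlim, ?_, fun h1 => ?_⟩
  · have hbound : ∀ n, ∫⁻ ω, ‖Z 0 ω - Z n ω‖ₑ ^ γ ∂M ≤ B ^ (1 / p) := fun n => by
      rw [one_div, ENNReal.le_rpow_inv_iff hp0]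
      refine (ENNReal.rpow_le_rpow (lintegral_mono fun ω =>
        ENNReal.rpow_le_rpow (hle n ω) hγ.le) hp0.le).trans ?_
      refine (lintegral_sum_rpow_le hγ (fun k => by have := hdm k; fun_prop) n).trans ?_
      exact (Finset.sum_le_sum fun k _ => hdp k).trans (ENNReal.sum_le_tsum _)
    refine lt_of_le_of_lt ?_ (ENNReal.rpow_lt_top_of_nonneg (y := 1 / p) (by positivity) hBtop.ne)
    calc ∫⁻ ω, ‖Z 0 ω - Z' ω‖ₑ ^ γ ∂M
        = ∫⁻ ω, liminf (fun n => ‖Z 0 ω - Z n ω‖ₑ ^ γ) atTop ∂M := by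
          refine lintegral_congr_ae ?_
          filter_upwards [hlim] with ω hω
          refine (Tendsto.liminf_eq ?_).symm
          exact ((ENNReal.continuous_rpow_const.tendsto _).comp
            ((tendsto_const_nhds.sub hω).enorm))
      _ ≤ liminf (fun n => ∫⁻ ω, ‖Z 0 ω - Z n ω‖ₑ ^ γ ∂M) atTop :=
          lintegral_liminf_le fun n => by have := hZ n; have := hZ 0; fun_prop
      _ ≤ B ^ (1 / p) := by
          refine (liminf_le_limsup).trans ?_
          exact limsup_le_of_le (h := Eventually.of_forall hbound)
  · rw [min_eq_right h1.le] at hsum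
    simp only [ENNReal.rpow_one] at hsum
    refine tendsto_integral_of_dominated_convergence (fun ω => (∑' n, ‖d n ω‖ₑ).toReal)
      (fun n => ((hZ 0).sub (hZ n)).aestronglyMeasurable) ?_ (fun n => ?_) ?_
    · exact integrable_toReal_of_lintegral_ne_top
        (Measurable.aemeasurable (by have := hdm; fun_prop)) hsum.ne
    · filter_upwards [hae] with ω hω
      rw [← toReal_enorm]
      exact ENNReal.toReal_mono hω.ne ((hle n ω).trans (ENNReal.sum_le_tsum _))
    · filter_upwards [hlim] with ω hω using tendsto_const_nhds.sub hω

lemma integrable_weights {γ : ℝ} (hγ : 1 ≤ γ) {ρ : Measure (ℝ × ℝ)} [IsProbabilityMeasure ρ]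
    (hρ : weightMoment γ ρ < ∞) :
    Integrable (fun w : ℝ × ℝ => w.1) ρ ∧ Integrable (fun w : ℝ × ℝ => w.2) ρ :=
  ⟨integrable_of_lintegral_rpow_lt_top hγ measurable_fst
      ((lintegral_fst_le_weightMoment γ ρ).trans_lt hρ),
    integrable_of_lintegral_rpow_lt_top hγ measurable_snd
      ((lintegral_snd_le_weightMoment γ ρ).trans_lt hρ)⟩

/-- The growth bound for a law with the moment and centring conditions, with the constant factor
`1` for `γ ≤ 1` and `2` for `1 < γ ≤ 2`. -/
lemma growthBound_of_moment {γ : ℝ} (hγ : 0 < γ) (hγ2 : γ ≤ 2) (δ : Measure ℝ)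
    [IsProbabilityMeasure δ] (hc : 1 < γ → ∫ x, x ∂δ = 0) :
    GrowthBound γ δ ((if γ ≤ 1 then 1 else 2) * ∫⁻ x, ‖x‖ₑ ^ γ ∂δ) := by
  split_ifs with h
  · rw [one_mul]
    exact GrowthBound.of_le_one hγ h δ
  · exact GrowthBound.of_centred (not_le.1 h) hγ2 δ (hc (not_le.1 h))

lemma integral_diffLaw {π : Measure (ℝ × ℝ)} {μ ν : Measure ℝ} (h : IsCoupling π μ ν)
    (hμ : Integrable (fun x => x) μ) (hν : Integrable (fun x => x) ν) :
    ∫ x, x ∂(diffLaw π) = ∫ x, x ∂μ - ∫ x, x ∂ν := by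
  obtain ⟨rfl, rfl⟩ := h
  rw [integrable_map_measure (by fun_prop) (by fun_prop)] at hμ hν
  rw [diffLaw, integral_map (by fun_prop) (by fun_prop), integral_map (by fun_prop) (by fun_prop),
    integral_map (by fun_prop) (by fun_prop)]
  exact integral_sub hμ hν

/-- A law at finite Wasserstein distance from its image under the smoothing transformation is at
finite distance from a fixed point, obtained as the limit of the iterates along a Markov chain with
geometrically decreasing increments. -/
theorem exists_smooth_fixedPoint {γ : ℝ} (hγ : 0 < γ) (hγ2 : γ ≤ 2) {ρ : Measure (ℝ × ℝ)}
    [IsProbabilityMeasure ρ] (hρ : weightMoment γ ρ < 1) {μ : Measure ℝ} [IsProbabilityMeasure μ]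
    (hμ : FiniteDist γ μ (smooth ρ μ))
    (hmean : 1 < γ → Integrable (fun x => x) μ ∧
      (∫ w, (w.1 + w.2) ∂ρ) * ∫ x, x ∂μ = ∫ x, x ∂μ) :
    ∃ ν : Measure ℝ, IsProbabilityMeasure ν ∧ smooth ρ ν = ν ∧ FiniteDist γ μ ν ∧
      (1 < γ → Integrable (fun x => x) ν ∧ ∫ x, x ∂μ = ∫ x, x ∂ν) := by
  obtain ⟨π₀, hπ₀, hc₀⟩ := hμ
  have hpπ₀ := hπ₀.isProbabilityMeasure
  have hρtop : weightMoment γ ρ < ∞ := hρ.trans ENNReal.one_lt_top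
  let μs : ℕ → Measure ℝ := fun n => (smooth ρ)^[n] μ
  have hμs : ∀ n, μs (n + 1) = smooth ρ (μs n) := fun n => Function.iterate_succ_apply' _ _ _
  let π : ℕ → Measure (ℝ × ℝ) := fun n => (smoothPair ρ)^[n] π₀
  have hπs : ∀ n, π (n + 1) = smoothPair ρ (π n) := fun n => Function.iterate_succ_apply' _ _ _
  have hpμ (n : ℕ) : IsProbabilityMeasure (μs n) := by
    induction n with
    | zero => assumption
    | succ n ih => rw [hμs]; infer_instance
  have hpπ (n : ℕ) : IsProbabilityMeasure (π n) := by
    induction n with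
    | zero => assumption
    | succ n ih => rw [hπs]; infer_instance
  have hcoup : ∀ n, IsCoupling (π n) (μs n) (μs (n + 1)) := fun n => by
    induction n with
    | zero => exact hπ₀
    | succ n ih =>
      rw [hπs, hμs (n + 1)]
      nth_rw 1 [hμs n]
      exact ih.smoothPair
  set C := (if γ ≤ 1 then 1 else 2) * cost γ π₀ with hC
  have hCtop : C < ∞ := by
    refine ENNReal.mul_lt_top ?_ hc₀
    split_ifs <;> simp
  have hcentre : 1 < γ → ∀ n, ∫ x, x ∂(diffLaw (π n)) = 0 := fun h1 n => by
    obtain ⟨hl, hr⟩ := integrable_weights h1.le hρtop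
    have key : Integrable (fun x => x) (μs n) ∧ ∫ x, x ∂(μs n) = ∫ x, x ∂μ := by
      induction n with
      | zero => exact ⟨(hmean h1).1, rfl⟩
      | succ n ih =>
        have := integral_smooth hl hr ih.1
        rw [hμs]
        exact ⟨this.1, by rw [this.2, ih.2, (hmean h1).2]⟩
    have s := integral_smooth hl hr key.1
    rw [integral_diffLaw (hcoup n) key.1 (by rw [hμs]; exact s.1), hμs, s.2, key.2,
      (hmean h1).2, sub_self]
  -- the constant of the growth bound contracts, not the cost: the factor `2` enters at `n = 0` only
  have hgrowth : ∀ n, GrowthBound γ (diffLaw (π n)) (weightMoment γ ρ ^ n * C) := fun n => by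
    induction n with
    | zero =>
      rw [pow_zero, one_mul, hC, ← lintegral_diffLaw]
      exact growthBound_of_moment hγ hγ2 (diffLaw π₀) fun h1 => hcentre h1 0
    | succ n ih =>
      rw [hπs, diffLaw_smoothPair, pow_succ', mul_assoc]
      exact ih.smooth hγ
  obtain ⟨M, hM, hMπ⟩ := exists_chain π fun n => (hcoup n).2.trans (hcoup (n + 1)).1.symm
  have hlaw : ∀ n, M.map (fun z => z n) = μs n := fun n => by
    rw [← (hcoup n).1, ← hMπ n, Measure.map_map (by fun_prop) (by fun_prop)]
    rfl
  have hdiff : ∀ n, M.map (fun z => z n - z (n + 1)) = diffLaw (π n) := fun n => by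
    rw [diffLaw, ← hMπ n, Measure.map_map (by fun_prop) (by fun_prop)]
    rfl
  have hcost : ∀ n, ∫⁻ z, ‖z n - z (n + 1)‖ₑ ^ γ ∂M ≤ weightMoment γ ρ ^ n * C := fun n => by
    have := (hgrowth n).lintegral_le hγ
    rwa [← hdiff, lintegral_map (by fun_prop) (by fun_prop)] at this
  obtain ⟨Z', hZ', hlim, hfin, hmlim⟩ := exists_limit_of_geometric
    (Z := fun n (z : ℕ → ℝ) => z n) hγ hρ hCtop (fun n => by fun_prop) hcost
  have hν : IsProbabilityMeasure (M.map Z') := Measure.isProbabilityMeasure_map hZ'.aemeasurable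
  have h0 : M.map (fun z => z 0) = μ := hlaw 0
  refine ⟨M.map Z', hν, ?_, ?_, fun h1 => ?_⟩
  · refine smooth_eq_of_tendsto_charFun hμs fun t => ?_
    have := tendsto_charFun_of_ae_tendsto (Z := fun n (z : ℕ → ℝ) => z n)
      (fun n => by fun_prop) hZ' hlim t
    simpa only [hlaw] using this
  · rw [← h0]
    exact finiteDist_map (by fun_prop) hZ' hfin
  · have hev : Measurable fun z : ℕ → ℝ => z 0 := measurable_pi_apply 0
    have i0 : Integrable (fun z : ℕ → ℝ => z 0) M := by
      have := (hmean h1).1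
      rwa [← h0, integrable_map_measure (by fun_prop) hev.aemeasurable] at this
    have id : ∀ n, Integrable (fun z : ℕ → ℝ => z n - z (n + 1)) M := fun n =>
      integrable_of_lintegral_rpow_lt_top h1.le (by fun_prop) ((hcost n).trans_lt
        (ENNReal.mul_lt_top (ENNReal.pow_lt_top hρtop) hCtop))
    have i' : Integrable (fun z => z 0 - Z' z) M :=
      integrable_of_lintegral_rpow_lt_top h1.le (by fun_prop) hfin
    have iZ' : Integrable Z' M := (i0.sub i').congr (ae_of_all _ fun z => by simp)
    have hzero : ∀ n, ∫ z, (z 0 - z n) ∂M = 0 := fun n => by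
      have e : ∀ z : ℕ → ℝ, z 0 - z n = ∑ k ∈ Finset.range n, (z k - z (k + 1)) := fun z =>
        (Finset.sum_range_sub' z n).symm
      simp_rw [e]
      rw [integral_finsetSum _ fun k _ => id k]
      refine Finset.sum_eq_zero fun k _ => ?_
      have := hcentre h1 k
      rwa [← hdiff, integral_map (by fun_prop) (by fun_prop)] at this
    have hm := hmlim h1
    simp only [hzero] at hm
    have hm0 := tendsto_nhds_unique hm tendsto_const_nhds
    rw [integral_sub i0 iZ'] at hm0
    refine ⟨by rwa [integrable_map_measure (by fun_prop) hZ'.aemeasurable], ?_⟩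
    rw [← h0, integral_map hev.aemeasurable (by fun_prop),
      integral_map hZ'.aemeasurable (by fun_prop)]
    linarith

/-! ### The weights of a McKean tree -/

/-- The weights of the leaves of a McKean tree as a function of the sequence of the indices of the
split leaves and of the sequence of the pairs `(l, r)`. -/
noncomputable def treeWeight (i : ℕ → ℕ) (lr : ℕ → ℝ × ℝ) : ℕ → ℕ → ℝ :=
  weight (fun k => (lr k).1) (fun k => (lr k).2) i

lemma treeWeight_zero (i : ℕ → ℕ) (lr : ℕ → ℝ × ℝ) (j : ℕ) :
    treeWeight i lr 0 j = if j = 0 then 1 else 0 := by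
  rw [treeWeight, weight]

lemma treeWeight_succ (i : ℕ → ℕ) (lr : ℕ → ℝ × ℝ) (n j : ℕ) :
    treeWeight i lr (n + 1) j =
      if j < i n then treeWeight i lr n j
      else if j = i n then (lr n).1 * treeWeight i lr n j
      else if j = i n + 1 then (lr n).2 * treeWeight i lr n (j - 1)
      else treeWeight i lr n (j - 1) := by
  simp only [treeWeight]
  rw [weight]
  split_ifs with h1 h2 h3
  · rfl
  · rw [h2]
  · rw [h3, Nat.add_sub_cancel]
  · rfl

lemma measurable_treeWeight (n j : ℕ) :
    Measurable fun p : (ℕ → ℕ) × (ℕ → ℝ × ℝ) => treeWeight p.1 p.2 n j := by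
  induction n generalizing j with
  | zero => simp only [treeWeight_zero]; exact measurable_const
  | succ n ih =>
    simp only [treeWeight_succ]
    have hi : Measurable fun p : (ℕ → ℕ) × (ℕ → ℝ × ℝ) => p.1 n := by fun_prop
    refine Measurable.ite (hi (measurableSet_Ioi (a := j))) (ih j) ?_
    refine Measurable.ite (measurableSet_eq_fun measurable_const hi)
      (Measurable.mul (by fun_prop) (ih j)) ?_
    exact Measurable.ite (measurableSet_eq_fun measurable_const (hi.add_const 1))
      (Measurable.mul (by fun_prop) (ih _)) (ih _)

/-- The weights after `n` collisions depend on the first `n` collisions only. -/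
lemma treeWeight_congr {i i' : ℕ → ℕ} {lr lr' : ℕ → ℝ × ℝ} {n : ℕ} (hi : ∀ k < n, i k = i' k)
    (hlr : ∀ k < n, lr k = lr' k) (j : ℕ) : treeWeight i lr n j = treeWeight i' lr' n j := by
  induction n generalizing j with
  | zero => simp only [treeWeight_zero]
  | succ n ih =>
    simp only [treeWeight_succ, hi n n.lt_succ_self, hlr n n.lt_succ_self]
    rw [ih (fun k hk => hi k (hk.trans n.lt_succ_self))
      (fun k hk => hlr k (hk.trans n.lt_succ_self)), ih (fun k hk => hi k (hk.trans n.lt_succ_self))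
      (fun k hk => hlr k (hk.trans n.lt_succ_self))]

/-- A product over the leaves of a tree after one more collision: the factor of the split leaf is
replaced by the product of two factors. Likewise for sums. -/
@[to_additive]
lemma prod_treeWeight_succ {M : Type*} [CommMonoid M] (f : ℝ → M) (i : ℕ → ℕ) (lr : ℕ → ℝ × ℝ)
    {n : ℕ} (hn : i n ≤ n) :
    ∏ j ∈ Finset.range (n + 1 + 1), f (treeWeight i lr (n + 1) j) =
      ∏ j ∈ Finset.range (n + 1), if j = i n then
        f ((lr n).1 * treeWeight i lr n j) * f ((lr n).2 * treeWeight i lr n j)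
        else f (treeWeight i lr n j) := by
  obtain ⟨m, hm⟩ := Nat.exists_eq_add_of_le hn
  have e1 : n + 1 + 1 = i n + (m + 1 + 1) := by omega
  have e2 : n + 1 = i n + (m + 1) := by omega
  have r1 : Finset.range (n + 1 + 1) = Finset.range (i n + (m + 1 + 1)) := by rw [e1]
  have r2 : Finset.range (n + 1) = Finset.range (i n + (m + 1)) := by rw [e2]
  rw [r1, r2, Finset.prod_range_add _ (i n) (m + 1 + 1), Finset.prod_range_add _ (i n) (m + 1)]
  refine congrArg₂ (fun x y : M => x * y) (Finset.prod_congr rfl fun j hj => ?_) ?_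
  · have hj := Finset.mem_range.1 hj
    rw [treeWeight_succ, if_pos hj, if_neg hj.ne]
  · rw [Finset.prod_range_succ', Finset.prod_range_succ', Finset.prod_range_succ']
    have a : ∀ k, treeWeight i lr (n + 1) (i n + (k + 1 + 1)) = treeWeight i lr n (i n + (k + 1)) :=
      fun k => by
        rw [treeWeight_succ, if_neg (by omega), if_neg (by omega), if_neg (by omega)]
        rfl
    have b : treeWeight i lr (n + 1) (i n + (0 + 1)) = (lr n).2 * treeWeight i lr n (i n) := by
      rw [treeWeight_succ, if_neg (by omega), if_neg (by omega), if_pos (by omega)]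
      rfl
    have c : treeWeight i lr (n + 1) (i n + 0) = (lr n).1 * treeWeight i lr n (i n) := by
      rw [treeWeight_succ, if_neg (by omega), if_pos (by omega)]
      rfl
    simp only [a, b, c]
    rw [add_zero, if_pos rfl, mul_assoc, mul_comm (f ((lr n).2 * _))]
    refine congrArg₂ (fun x y : M => x * y) (Finset.prod_congr rfl fun k _ => ?_) rfl
    rw [if_neg (by omega)]

/-! ### Independence of the collisions -/

/-- If `U` is independent of the pair `(V, W)` and `V` of `W`, all three are independent; in
particular, the pair `(U, V)` and `W` are. -/
lemma IndepFun.assoc_left {Ω α β δ : Type*} [MeasurableSpace Ω] [MeasurableSpace α]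
    [MeasurableSpace β] [MeasurableSpace δ] {P : Measure Ω} [IsProbabilityMeasure P] {U : Ω → α}
    {V : Ω → β} {W : Ω → δ} (hU : Measurable U) (hV : Measurable V) (hW : Measurable W)
    (h1 : IndepFun U (fun ω => (V ω, W ω)) P) (h2 : IndepFun V W P) :
    IndepFun (fun ω => (U ω, V ω)) W P := by
  have hVW : Measurable fun ω => (V ω, W ω) := hV.prodMk hW
  have pU : IsProbabilityMeasure (P.map U) := Measure.isProbabilityMeasure_map hU.aemeasurable
  have pV : IsProbabilityMeasure (P.map V) := Measure.isProbabilityMeasure_map hV.aemeasurable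
  have pW : IsProbabilityMeasure (P.map W) := Measure.isProbabilityMeasure_map hW.aemeasurable
  have h3 : IndepFun U V P := h1.comp measurable_id measurable_fst
  rw [indepFun_iff_map_prod_eq_prod_map_map (by fun_prop) (by fun_prop)] at h1 h2 h3 ⊢
  rw [h3]
  have e := congrArg (Measure.map (MeasurableEquiv.prodAssoc (α := α) (β := β) (γ := δ)).symm) h1
  rw [Measure.map_map (by fun_prop) (by fun_prop), h2,
    ← Measure.prodAssoc_prod, Measure.map_map (by fun_prop) (by fun_prop)] at e
  rw [show ⇑(MeasurableEquiv.prodAssoc (α := α) (β := β) (γ := δ)).symm ∘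
    ⇑MeasurableEquiv.prodAssoc = id from MeasurableEquiv.symm_comp_self _, Measure.map_id] at e
  exact e

/-- The sequence `f` with its terms from index `n` on replaced by a default value. -/
def truncate {E : Type*} (d : E) (n : ℕ) (f : ℕ → E) (k : ℕ) : E := if k < n then f k else d

lemma measurable_truncate {E : Type*} [MeasurableSpace E] (d : E) (n : ℕ) :
    Measurable (truncate d n) := by
  refine measurable_pi_lambda _ fun k => ?_
  simp only [truncate]
  split_ifs
  · exact measurable_pi_apply k
  · exact measurable_const

lemma iIndepFun.indepFun_truncate {Ω E : Type*} [MeasurableSpace Ω] [MeasurableSpace E]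
    {P : Measure Ω} {f : ℕ → Ω → E} (h : iIndepFun f P) (hf : ∀ n, Measurable (f n)) (d : E)
    (n : ℕ) : IndepFun (fun ω => truncate d n fun k => f k ω) (f n) P := by
  have := h.indepFun_finset (Finset.range n) {n} (by simp) hf
  classical
  let ext : (Finset.range n → E) → ℕ → E := fun g k =>
    if hk : k ∈ Finset.range n then g ⟨k, hk⟩ else d
  have hext : Measurable ext := by
    refine measurable_pi_lambda _ fun k => ?_
    simp only [ext]
    split_ifs
    · exact measurable_pi_apply _
    · exact measurable_const
  have h2 := this.comp hext
    (measurable_pi_apply (⟨n, Finset.mem_singleton_self n⟩ : ({n} : Finset ℕ)))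
  have e : (fun ω => truncate d n fun k => f k ω) =
      ext ∘ fun ω (i : Finset.range n) => f i ω := by
    ext ω k
    simp [truncate, ext]
  rw [e]
  exact h2

lemma measurable_proc {Ω E : Type*} [MeasurableSpace E] (Y : ℕ → Ω → E) :
    Measurable[⨆ n, MeasurableSpace.comap (Y n) inferInstance] fun ω k => Y k ω := by
  refine @measurable_pi_lambda Ω ℕ (fun _ => E) (⨆ n, MeasurableSpace.comap (Y n) inferInstance) _ _
    fun k => ?_
  exact measurable_iff_comap_le.2 (le_iSup (fun n => MeasurableSpace.comap (Y n) inferInstance) k)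

/-- Variables that depend on disjoint sets of the four families are independent. -/
lemma indepFun_of_iIndep {Ω : Type*} {m : Fin 4 → MeasurableSpace Ω} {mΩ : MeasurableSpace Ω}
    {P : Measure Ω} (hm : iIndep m P) (hle : ∀ i, m i ≤ mΩ) (S T : Set (Fin 4)) (hST : Disjoint S T)
    {α β : Type*}
    [MeasurableSpace α] [MeasurableSpace β] {f : Ω → α} {g : Ω → β}
    (hf : Measurable[⨆ i ∈ S, m i] f) (hg : Measurable[⨆ i ∈ T, m i] g) : IndepFun f g P := by
  rw [IndepFun_iff_Indep]
  exact indep_of_indep_of_le_right (indep_of_indep_of_le_left (indep_iSup_of_disjoint hle hm hST)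
    hf.comap_le) hg.comap_le

section System

variable {Ω : Type*} [MeasurableSpace Ω] {P : Measure Ω}
  {μ₀ : Measure ℝ} {ρ : Measure (ℝ × ℝ)} {X L R : ℕ → Ω → ℝ} {I : ℕ → Ω → ℕ} {N : ℝ≥0 → Ω → ℕ}

lemma IsMcKeanSystem.measurable_LR (h : IsMcKeanSystem P μ₀ ρ X L R I N) (n : ℕ) :
    Measurable fun ω => (L n ω, R n ω) := (h.measurable_L n).prodMk (h.measurable_R n)

/-- The random shape of the tree: the indices of the split leaves, the pairs `(L, R)`, and the
number of collisions up to time `t`. -/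
def treeData (L R : ℕ → Ω → ℝ) (I : ℕ → Ω → ℕ) (N : ℝ≥0 → Ω → ℕ) (t : ℝ≥0) (ω : Ω) :
    ((ℕ → ℕ) × (ℕ → ℝ × ℝ)) × ℕ :=
  ((fun k => I k ω, fun k => (L k ω, R k ω)), N t ω)

lemma IsMcKeanSystem.measurable_treeData (h : IsMcKeanSystem P μ₀ ρ X L R I N) (t : ℝ≥0) :
    Measurable (treeData L R I N t) :=
  Measurable.prodMk (Measurable.prodMk (measurable_pi_lambda _ h.measurable_I)
    (measurable_pi_lambda _ h.measurable_LR)) (h.measurable_N t)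

lemma IsMcKeanSystem.families_le (h : IsMcKeanSystem P μ₀ ρ X L R I N) :
    ∀ i, (![⨆ n, MeasurableSpace.comap (I n) inferInstance,
      ⨆ n, MeasurableSpace.comap (fun ω => (L n ω, R n ω)) inferInstance,
      ⨆ n, MeasurableSpace.comap (X n) inferInstance,
      ⨆ t, MeasurableSpace.comap (N t) inferInstance] : Fin 4 → MeasurableSpace Ω) i ≤
      (inferInstance : MeasurableSpace Ω) := by
  intro i
  fin_cases i
  · exact iSup_le fun n => (h.measurable_I n).comap_le
  · exact iSup_le fun n => (h.measurable_LR n).comap_le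
  · exact iSup_le fun n => (h.measurable_X n).comap_le
  · exact iSup_le fun n => (h.measurable_N n).comap_le

lemma IsMcKeanSystem.indepFun_I_LR (h : IsMcKeanSystem P μ₀ ρ X L R I N) :
    IndepFun (fun ω k => I k ω) (fun ω k => (L k ω, R k ω)) P := by
  refine indepFun_of_iIndep h.iIndep_families h.families_le {0} {1} (by simp) ?_ ?_
  · exact (measurable_proc I).mono (le_iSup₂_of_le 0 rfl le_rfl) le_rfl
  · exact (measurable_proc fun n ω => (L n ω, R n ω)).mono (le_iSup₂_of_le 1 rfl le_rfl) le_rfl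

lemma IsMcKeanSystem.indepFun_shape_N (h : IsMcKeanSystem P μ₀ ρ X L R I N) (t : ℝ≥0) :
    IndepFun (fun ω => (treeData L R I N t ω).1) (N t) P := by
  refine indepFun_of_iIndep h.iIndep_families h.families_le {0, 1} {3} (by simp) ?_ ?_
  · refine Measurable.prodMk ?_ ?_
    · exact (measurable_proc I).mono (le_iSup₂_of_le 0 (by simp) le_rfl) le_rfl
    · exact (measurable_proc fun n ω => (L n ω, R n ω)).mono
        (le_iSup₂_of_le 1 (by simp) le_rfl) le_rfl
  · exact measurable_iff_comap_le.2 (le_iSup₂_of_le 3 rfl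
      (le_iSup (fun t => MeasurableSpace.comap (N t) inferInstance) t))

lemma IsMcKeanSystem.indepFun_treeData_X (h : IsMcKeanSystem P μ₀ ρ X L R I N) (t : ℝ≥0) :
    IndepFun (treeData L R I N t) (fun ω k => X k ω) P := by
  refine indepFun_of_iIndep h.iIndep_families h.families_le {0, 1, 3} {2} (by simp) ?_ ?_
  · refine Measurable.prodMk (Measurable.prodMk ?_ ?_) ?_
    · exact (measurable_proc I).mono (le_iSup₂_of_le 0 (by simp) le_rfl) le_rfl
    · exact (measurable_proc fun n ω => (L n ω, R n ω)).mono
        (le_iSup₂_of_le 1 (by simp) le_rfl) le_rfl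
    · exact measurable_iff_comap_le.2 (le_iSup₂_of_le 3 (by simp)
        (le_iSup (fun t => MeasurableSpace.comap (N t) inferInstance) t))
  · exact (measurable_proc X).mono (le_iSup₂_of_le 2 rfl le_rfl) le_rfl

/-- The pair `(L, R)` of a collision is independent of the earlier pairs and of all the indices. -/
lemma IsMcKeanSystem.indepFun_past_LR [IsProbabilityMeasure P]
    (h : IsMcKeanSystem P μ₀ ρ X L R I N) (n : ℕ) :
    IndepFun (fun ω => (fun k => I k ω, truncate (0, 0) n fun k => (L k ω, R k ω)))
      (fun ω => (L n ω, R n ω)) P := by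
  have hI : Measurable fun ω k => I k ω := measurable_pi_lambda _ h.measurable_I
  have hLR : Measurable fun ω k => (L k ω, R k ω) := measurable_pi_lambda _ h.measurable_LR
  refine IndepFun.assoc_left hI ((measurable_truncate _ n).comp hLR) (h.measurable_LR n) ?_
    (iIndepFun.indepFun_truncate h.iIndepFun_LR h.measurable_LR _ n)
  exact h.indepFun_I_LR.comp (φ := fun x => x) (ψ := fun y : ℕ → ℝ × ℝ =>
    (truncate (0, 0) n y, y n))
    measurable_id ((measurable_truncate _ n).prodMk (measurable_pi_apply n))

/-- The index of the leaf split at a collision is independent of the earlier collisions. -/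
lemma IsMcKeanSystem.indepFun_past_I [IsProbabilityMeasure P]
    (h : IsMcKeanSystem P μ₀ ρ X L R I N) (n : ℕ) :
    IndepFun (fun ω => (truncate (0, 0) n fun k => (L k ω, R k ω), truncate 0 n fun k => I k ω))
      (I n) P := by
  have hI : Measurable fun ω k => I k ω := measurable_pi_lambda _ h.measurable_I
  have hLR : Measurable fun ω k => (L k ω, R k ω) := measurable_pi_lambda _ h.measurable_LR
  refine IndepFun.assoc_left ((measurable_truncate _ n).comp hLR)
    ((measurable_truncate _ n).comp hI) (h.measurable_I n) ?_
    (iIndepFun.indepFun_truncate h.iIndepFun_I h.measurable_I _ n)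
  exact h.indepFun_I_LR.symm.comp (φ := truncate (0, 0) n) (ψ := fun y : ℕ → ℕ =>
    (truncate 0 n y, y n))
    (measurable_truncate _ n) ((measurable_truncate _ n).prodMk (measurable_pi_apply n))

lemma IsMcKeanSystem.ae_I_le [IsProbabilityMeasure P]
    (h : IsMcKeanSystem P μ₀ ρ X L R I N) (n : ℕ) :
    ∀ᵐ ω ∂P, I n ω ≤ n := by
  have e : P {ω | I n ω ≤ n} = 1 := by
    have : {ω | I n ω ≤ n} = ⋃ i ∈ Finset.range (n + 1), {ω | I n ω = i} := by
      ext ω; simp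
    rw [this, measure_biUnion_finset]
    · rw [Finset.sum_congr rfl fun i hi => h.law_I n i (Nat.lt_succ_iff.1 (Finset.mem_range.1 hi)),
        Finset.sum_const, Finset.card_range, nsmul_eq_mul]
      push_cast
      exact ENNReal.mul_inv_cancel (by simp) (by finiteness)
    · intro i _ j _ hij
      exact Set.disjoint_left.2 fun ω h1 h2 => hij (h1.symm.trans h2)
    · exact fun i _ => (h.measurable_I n) (measurableSet_singleton i)
  exact (prob_compl_eq_zero_iff ((h.measurable_I n) measurableSet_Iic)).2 e

end System

/-! ### Expectations over the weights of a McKean tree -/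

section Expectations

variable {Ω : Type*} [MeasurableSpace Ω] {P : Measure Ω} [IsProbabilityMeasure P]
  {μ₀ : Measure ℝ} {ρ : Measure (ℝ × ℝ)} {X L R : ℕ → Ω → ℝ}
  {I : ℕ → Ω → ℕ} {N : ℝ≥0 → Ω → ℕ}

/-- Averaging over the pair `w` attached to the leaf `i` undoes the splitting of this leaf, by the
fixed point equation. For `i ≥ n` no leaf is split. -/
lemma integral_prod_split [IsProbabilityMeasure ρ] {φ : ℝ → ℂ} {t : ℝ}
    (hfix : ∀ t, ∫ w, φ (w.1 * t) * φ (w.2 * t) ∂ρ = φ t) (b : ℕ → ℝ) (n i : ℕ) :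
    ∫ w, ∏ j ∈ Finset.range n, (if j = i then φ (w.1 * b j * t) * φ (w.2 * b j * t)
      else φ (b j * t)) ∂ρ = ∏ j ∈ Finset.range n, φ (b j * t) := by
  by_cases hi : i ∈ Finset.range n
  · have e : ∀ w : ℝ × ℝ, ∏ j ∈ Finset.range n,
        (if j = i then φ (w.1 * b j * t) * φ (w.2 * b j * t) else φ (b j * t)) =
        (φ (w.1 * (b i * t)) * φ (w.2 * (b i * t))) *
          ∏ j ∈ (Finset.range n).erase i, φ (b j * t) := fun w => by
      rw [← Finset.mul_prod_erase _ _ hi, if_pos rfl, mul_assoc w.1, mul_assoc w.2]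
      congr 1
      exact Finset.prod_congr rfl fun j hj => if_neg (Finset.ne_of_mem_erase hj)
    simp_rw [e]
    rw [integral_mul_const, hfix, Finset.mul_prod_erase _ (fun j => φ (b j * t)) hi]
  · have e : ∀ w : ℝ × ℝ, ∏ j ∈ Finset.range n,
        (if j = i then φ (w.1 * b j * t) * φ (w.2 * b j * t) else φ (b j * t)) =
        ∏ j ∈ Finset.range n, φ (b j * t) := fun w =>
      Finset.prod_congr rfl fun j hj => if_neg fun h : j = i => hi (h ▸ hj)
    simp_rw [e]
    simp

/-- For a characteristic function `φ` of a fixed point of the smoothing transformation, the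
expected product of the values of `φ` over the leaves does not change with the collisions. -/
lemma IsMcKeanSystem.integral_prod_treeWeight [IsProbabilityMeasure ρ]
    (h : IsMcKeanSystem P μ₀ ρ X L R I N) {φ : ℝ → ℂ}
    (hφ : Measurable φ) (hφ1 : ∀ t, ‖φ t‖ ≤ 1)
    (hfix : ∀ t, ∫ w, φ (w.1 * t) * φ (w.2 * t) ∂ρ = φ t) (n : ℕ) (t : ℝ) :
    ∫ ω, ∏ j ∈ Finset.range (n + 1),
      φ (treeWeight (fun k => I k ω) (fun k => (L k ω, R k ω)) n j * t) ∂P = φ t := by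
  induction n with
  | zero => simp [treeWeight_zero]
  | succ n ih =>
    let past : Ω → (ℕ → ℕ) × (ℕ → ℝ × ℝ) := fun ω =>
      (fun k => I k ω, truncate (0, 0) n fun k => (L k ω, R k ω))
    let F : ((ℕ → ℕ) × (ℕ → ℝ × ℝ)) × ℝ × ℝ → ℂ := fun q => ∏ j ∈ Finset.range (n + 1),
      if j = q.1.1 n then φ (q.2.1 * treeWeight q.1.1 q.1.2 n j * t) *
        φ (q.2.2 * treeWeight q.1.1 q.1.2 n j * t) else φ (treeWeight q.1.1 q.1.2 n j * t)
    have hpast : Measurable past := (measurable_pi_lambda _ h.measurable_I).prodMk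
      ((measurable_truncate _ n).comp (measurable_pi_lambda _ h.measurable_LR))
    have hLR := h.measurable_LR n
    have htw : ∀ j, Measurable fun q : ((ℕ → ℕ) × (ℕ → ℝ × ℝ)) × ℝ × ℝ =>
        treeWeight q.1.1 q.1.2 n j := fun j => (measurable_treeWeight n j).comp measurable_fst
    have hF : Measurable F := by
      refine Finset.measurable_fun_prod _ fun j _ => ?_
      have := htw j
      refine Measurable.ite (measurableSet_eq_fun measurable_const (by fun_prop)) ?_ ?_ <;> fun_prop
    have htr : ∀ ω j, treeWeight (fun k => I k ω) (fun k => (L k ω, R k ω)) n j =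
        treeWeight (past ω).1 (past ω).2 n j := fun ω j =>
      treeWeight_congr (fun _ _ => rfl) (fun k hk => by simp [past, truncate, hk]) j
    have hFint : Integrable F ((P.map past).prod ρ) := by
      have p1 : IsProbabilityMeasure (P.map past) :=
        Measure.isProbabilityMeasure_map hpast.aemeasurable
      refine (integrable_const (1 : ℝ)).mono' hF.aestronglyMeasurable (ae_of_all _ fun q => ?_)
      rw [norm_prod]
      refine Finset.prod_le_one (fun _ _ => norm_nonneg _) fun j _ => ?_
      split_ifs
      · rw [norm_mul]
        exact mul_le_one₀ (hφ1 _) (norm_nonneg _) (hφ1 _)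
      · exact hφ1 _
    have hjoint := (indepFun_iff_map_prod_eq_prod_map_map hpast.aemeasurable
      hLR.aemeasurable).1 (h.indepFun_past_LR n)
    rw [h.law_LR] at hjoint
    calc _ = ∫ ω, F (past ω, (L n ω, R n ω)) ∂P := by
          refine integral_congr_ae ?_
          filter_upwards [h.ae_I_le n] with ω hω
          rw [prod_treeWeight_succ (fun x => φ (x * t)) _ _ hω]
          refine Finset.prod_congr rfl fun j _ => ?_
          rw [htr]
      _ = ∫ q, F q ∂((P.map past).prod ρ) := by
          rw [← hjoint, integral_map (hpast.prodMk hLR).aemeasurable hF.aestronglyMeasurable]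
      _ = ∫ p, ∏ j ∈ Finset.range (n + 1), φ (treeWeight p.1 p.2 n j * t) ∂(P.map past) := by
          rw [integral_prod _ hFint]
          exact integral_congr_ae (ae_of_all _ fun p =>
            integral_prod_split hfix (treeWeight p.1 p.2 n) (n + 1) (p.1 n))
      _ = _ := by
          rw [integral_map hpast.aemeasurable]
          · simp_rw [← htr]
            exact ih
          · have := measurable_treeWeight n
            exact (Finset.measurable_fun_prod _ fun j _ =>
              hφ.comp ((this j).mul_const t)).aestronglyMeasurable

/-- The sum of the `γ`-th powers of the weights of the leaves. -/
noncomputable def leafMoment (γ : ℝ) (i : ℕ → ℕ) (lr : ℕ → ℝ × ℝ) (n : ℕ) : ℝ≥0∞ :=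
  ∑ j ∈ Finset.range (n + 1), ‖treeWeight i lr n j‖ₑ ^ γ

lemma measurable_leafMoment (γ : ℝ) (n : ℕ) :
    Measurable fun p : (ℕ → ℕ) × (ℕ → ℝ × ℝ) => leafMoment γ p.1 p.2 n := by
  have := measurable_treeWeight n
  refine Finset.measurable_fun_sum _ fun j _ => ?_
  exact ((this j).enorm).pow_const γ

/-- Averaging over the pair `w` multiplies the term of the split leaf `i` by `weightMoment γ ρ`. -/
lemma lintegral_sum_split [IsProbabilityMeasure ρ] {γ : ℝ} (hγ : 0 < γ) (b : ℕ → ℝ) (n i : ℕ) :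
    ∫⁻ w, ∑ j ∈ Finset.range n, (if j = i then ‖w.1 * b j‖ₑ ^ γ + ‖w.2 * b j‖ₑ ^ γ
      else ‖b j‖ₑ ^ γ) ∂ρ =
    ∑ j ∈ Finset.range n, ‖b j‖ₑ ^ γ * if j = i then weightMoment γ ρ else 1 := by
  rw [lintegral_finsetSum' _ fun j _ => by split_ifs <;> fun_prop]
  refine Finset.sum_congr rfl fun j _ => ?_
  split_ifs
  · simp_rw [enorm_mul, ENNReal.mul_rpow_of_nonneg _ _ hγ.le, ← add_mul]
    rw [lintegral_mul_const _ (by fun_prop), weightMoment, mul_comm]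
  · simp

lemma IsMcKeanSystem.lintegral_ite_I (h : IsMcKeanSystem P μ₀ ρ X L R I N) (κ : ℝ≥0∞) {n j : ℕ}
    (hj : j ≤ n) :
    ∫⁻ ω, (if j = I n ω then κ else 1) ∂P = κ * ((n : ℝ≥0∞) + 1)⁻¹ + (1 - ((n : ℝ≥0∞) + 1)⁻¹) := by
  have hm : MeasurableSet {ω | I n ω = j} := (h.measurable_I n) (measurableSet_singleton j)
  rw [← lintegral_add_compl _ hm]
  have e1 : ∫⁻ ω in {ω | I n ω = j}, (if j = I n ω then κ else 1) ∂P = κ * ((n : ℝ≥0∞) + 1)⁻¹ := by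
    rw [setLIntegral_congr_fun (g := fun _ => κ) hm fun ω hω => if_pos (Eq.symm hω),
      setLIntegral_const, h.law_I n j hj]
  have e2 : ∫⁻ ω in {ω | I n ω = j}ᶜ, (if j = I n ω then κ else 1) ∂P =
      1 - ((n : ℝ≥0∞) + 1)⁻¹ := by
    rw [setLIntegral_congr_fun (g := fun _ => 1) hm.compl fun ω hω => if_neg fun h => hω h.symm,
      setLIntegral_const, one_mul, prob_compl_eq_one_sub hm, h.law_I n j hj]
  rw [e1, e2]

/-- Recursion for the expected sum of the `γ`-th powers of the weights: a collision multiplies the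
term of a uniformly chosen leaf by `weightMoment γ ρ` on average. -/
lemma IsMcKeanSystem.lintegral_leafMoment_succ [IsProbabilityMeasure ρ]
    (h : IsMcKeanSystem P μ₀ ρ X L R I N) {γ : ℝ}
    (hγ : 0 < γ) (n : ℕ) :
    ∫⁻ ω, leafMoment γ (fun k => I k ω) (fun k => (L k ω, R k ω)) (n + 1) ∂P =
      (∫⁻ ω, leafMoment γ (fun k => I k ω) (fun k => (L k ω, R k ω)) n ∂P) *
        (weightMoment γ ρ * ((n : ℝ≥0∞) + 1)⁻¹ + (1 - ((n : ℝ≥0∞) + 1)⁻¹)) := by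
  let past : Ω → (ℕ → ℕ) × (ℕ → ℝ × ℝ) := fun ω =>
    (fun k => I k ω, truncate (0, 0) n fun k => (L k ω, R k ω))
  -- The pair `(L, R)` of collision `n` is integrated out first, for a fixed index `I n`, hence
  -- `past` contains all the indices; then the index itself, for fixed earlier collisions `past'`.
  let past' : Ω → (ℕ → ℝ × ℝ) × (ℕ → ℕ) := fun ω =>
    (truncate (0, 0) n fun k => (L k ω, R k ω), truncate 0 n fun k => I k ω)
  let F : ((ℕ → ℕ) × (ℕ → ℝ × ℝ)) × ℝ × ℝ → ℝ≥0∞ := fun q => ∑ j ∈ Finset.range (n + 1),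
    if j = q.1.1 n then ‖q.2.1 * treeWeight q.1.1 q.1.2 n j‖ₑ ^ γ +
      ‖q.2.2 * treeWeight q.1.1 q.1.2 n j‖ₑ ^ γ else ‖treeWeight q.1.1 q.1.2 n j‖ₑ ^ γ
  have hpast : Measurable past := (measurable_pi_lambda _ h.measurable_I).prodMk
    ((measurable_truncate _ n).comp (measurable_pi_lambda _ h.measurable_LR))
  have hpast' : Measurable past' :=
    ((measurable_truncate _ n).comp (measurable_pi_lambda _ h.measurable_LR)).prodMk
    ((measurable_truncate _ n).comp (measurable_pi_lambda _ h.measurable_I))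
  have hLR := h.measurable_LR n
  have hI := h.measurable_I n
  have htw := measurable_treeWeight n
  have hF : Measurable F := by
    refine Finset.measurable_fun_sum _ fun j _ => ?_
    have : Measurable fun q : ((ℕ → ℕ) × (ℕ → ℝ × ℝ)) × ℝ × ℝ => treeWeight q.1.1 q.1.2 n j :=
      (htw j).comp measurable_fst
    refine Measurable.ite (measurableSet_eq_fun measurable_const (by fun_prop)) ?_ ?_ <;> fun_prop
  have htr : ∀ ω j, treeWeight (fun k => I k ω) (fun k => (L k ω, R k ω)) n j =
      treeWeight (past ω).1 (past ω).2 n j := fun ω j =>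
    treeWeight_congr (fun _ _ => rfl) (fun k hk => by simp [past, truncate, hk]) j
  have htr' : ∀ ω j, treeWeight (fun k => I k ω) (fun k => (L k ω, R k ω)) n j =
      treeWeight (past' ω).2 (past' ω).1 n j := fun ω j =>
    treeWeight_congr (fun k hk => by simp [past', truncate, hk])
      (fun k hk => by simp [past', truncate, hk]) j
  have hjoint := (indepFun_iff_map_prod_eq_prod_map_map hpast.aemeasurable
    hLR.aemeasurable).1 (h.indepFun_past_LR n)
  rw [h.law_LR] at hjoint
  have hw : ∀ j, Measurable fun ω =>
      treeWeight (fun k => I k ω) (fun k => (L k ω, R k ω)) n j := fun j =>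
    (htw j).comp ((measurable_pi_lambda _ h.measurable_I).prodMk
      (measurable_pi_lambda _ h.measurable_LR))
  calc _ = ∫⁻ ω, F (past ω, (L n ω, R n ω)) ∂P := by
        refine lintegral_congr_ae ?_
        filter_upwards [h.ae_I_le n] with ω hω
        simp only [leafMoment]
        rw [sum_treeWeight_succ (fun x => ‖x‖ₑ ^ γ) _ _ hω]
        refine Finset.sum_congr rfl fun j _ => ?_
        rw [htr]
    _ = ∫⁻ p, (∑ j ∈ Finset.range (n + 1), ‖treeWeight p.1 p.2 n j‖ₑ ^ γ *
          if j = p.1 n then weightMoment γ ρ else 1) ∂(P.map past) := by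
        rw [← lintegral_map hF (hpast.prodMk hLR), hjoint, lintegral_prod _ hF.aemeasurable]
        exact lintegral_congr fun p =>
          lintegral_sum_split hγ (treeWeight p.1 p.2 n) (n + 1) (p.1 n)
    _ = ∫⁻ ω, (∑ j ∈ Finset.range (n + 1),
          ‖treeWeight (past' ω).2 (past' ω).1 n j‖ₑ ^ γ *
          if j = I n ω then weightMoment γ ρ else 1) ∂P := by
        rw [lintegral_map _ hpast]
        · simp_rw [← htr, ← htr']
          rfl
        · refine Finset.measurable_fun_sum _ fun j _ => ?_
          have := htw j
          refine Measurable.mul (by fun_prop) (Measurable.ite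
            (measurableSet_eq_fun measurable_const (by fun_prop)) ?_ ?_) <;> fun_prop
    _ = ∑ j ∈ Finset.range (n + 1), (∫⁻ ω, ‖treeWeight (past' ω).2 (past' ω).1 n j‖ₑ ^ γ ∂P) *
          (weightMoment γ ρ * ((n : ℝ≥0∞) + 1)⁻¹ + (1 - ((n : ℝ≥0∞) + 1)⁻¹)) := by
        have m1 : ∀ j, Measurable fun p : (ℕ → ℝ × ℝ) × (ℕ → ℕ) =>
            ‖treeWeight p.2 p.1 n j‖ₑ ^ γ := fun j =>
          (((htw j).comp measurable_swap).enorm).pow_const γ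
        have m2 : ∀ j, Measurable fun i : ℕ => if j = i then weightMoment γ ρ else 1 := fun j =>
          measurable_from_top
        refine (lintegral_finsetSum _ fun j _ =>
          ((m1 j).comp hpast').mul ((m2 j).comp hI)).trans ?_
        refine Finset.sum_congr rfl fun j hj => ?_
        have hind := (h.indepFun_past_I n).comp (m1 j) (m2 j)
        rw [← h.lintegral_ite_I _ (Nat.lt_succ_iff.1 (Finset.mem_range.1 hj))]
        exact lintegral_mul_eq_lintegral_mul_lintegral_of_indepFun ((m1 j).comp hpast')
          ((m2 j).comp hI) hind
    _ = _ := by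
        rw [← Finset.sum_mul]
        congr 1
        simp_rw [← htr', leafMoment]
        rw [lintegral_finsetSum' _ fun j _ => (((hw j).enorm).pow_const γ).aemeasurable]

end Expectations

/-! ### A binomial series -/

/-- The coefficients `κ (κ + 1) ⋯ (κ + n - 1) / n!` of the power series of `(1 - z) ^ (-κ)`. -/
noncomputable def risingCoeff (κ : ℝ) : ℕ → ℝ
  | 0 => 1
  | n + 1 => risingCoeff κ n * ((κ + n) / (n + 1))

lemma risingCoeff_nonneg {κ : ℝ} (hκ : 0 ≤ κ) (n : ℕ) : 0 ≤ risingCoeff κ n := by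
  induction n with
  | zero => simp [risingCoeff]
  | succ n ih => rw [risingCoeff]; positivity

/-- The partial sums are bounded by the function, as `(1 - z) ^ κ` times a partial sum is
antitone. -/
lemma sum_risingCoeff_le {κ : ℝ} (hκ : 0 ≤ κ) (n : ℕ) {z : ℝ} (hz : 0 ≤ z) (hz1 : z < 1) :
    (1 - z) ^ κ * ∑ k ∈ Finset.range n, risingCoeff κ k * z ^ k ≤ 1 := by
  rcases Nat.eq_zero_or_pos n with rfl | hn
  · simp
  let f : ℝ → ℝ := fun z => ∑ k ∈ Finset.range n, risingCoeff κ k * z ^ k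
  let f' : ℝ → ℝ := fun z => ∑ k ∈ Finset.range n, risingCoeff κ k * (k * z ^ (k - 1))
  have hf : ∀ z, HasDerivAt f (f' z) z := fun z =>
    HasDerivAt.fun_sum fun k _ => (hasDerivAt_pow k z).const_mul _
  have htel : ∀ m z, κ * ∑ k ∈ Finset.range m, risingCoeff κ k * z ^ k -
      (1 - z) * ∑ k ∈ Finset.range m, risingCoeff κ k * (k * z ^ (k - 1)) =
      m * risingCoeff κ m * z ^ (m - 1) := by
    intro m z
    induction m with
    | zero => simp
    | succ m ih =>
      rw [Finset.sum_range_succ, Finset.sum_range_succ, mul_add, mul_add, risingCoeff]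
      have hz : (m : ℝ) * z ^ m = m * (z * z ^ (m - 1)) := by
        rcases Nat.eq_zero_or_pos m with rfl | hm
        · simp
        · rw [← pow_succ', Nat.sub_add_cancel hm]
      have : ((m + 1 : ℕ) : ℝ) * (risingCoeff κ m * ((κ + m) / (m + 1))) =
          risingCoeff κ m * (κ + m) := by
        push_cast
        field_simp
      rw [this, Nat.add_sub_cancel]
      linear_combination ih - risingCoeff κ m * hz
  have hd : ∀ z < 1, HasDerivAt (fun z => (1 - z) ^ κ * f z)
      (-κ * (1 - z) ^ (κ - 1) * f z + (1 - z) ^ κ * f' z) z := fun z hz => by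
    have h1 : HasDerivAt (fun z : ℝ => (1 - z) ^ κ) (-κ * (1 - z) ^ (κ - 1)) z := by
      have := ((hasDerivAt_id z).const_sub 1).rpow_const (p := κ) (Or.inl (by simp; linarith))
      simpa using this
    exact h1.mul (hf z)
  have anti : AntitoneOn (fun z => (1 - z) ^ κ * f z) (Set.Ico 0 1) := by
    refine antitoneOn_of_deriv_nonpos (convex_Ico 0 1)
      (fun z hz => (hd z hz.2).continuousAt.continuousWithinAt)
      (fun z hz => ?_) fun z hz => ?_
    · rw [interior_Ico] at hz
      exact (hd z hz.2).differentiableAt.differentiableWithinAt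
    · rw [interior_Ico] at hz
      rw [(hd z hz.2).deriv]
      have hpos : 0 < 1 - z := by linarith [hz.2]
      have e : (1 - z) ^ κ = (1 - z) ^ (κ - 1) * (1 - z) := by
        rw [Real.rpow_sub_one hpos.ne', div_mul_cancel₀ _ hpos.ne']
      have t := htel n z
      have hnn : 0 ≤ n * risingCoeff κ n * z ^ (n - 1) :=
        mul_nonneg (mul_nonneg n.cast_nonneg (risingCoeff_nonneg hκ n)) (pow_nonneg hz.1.le _)
      have : -κ * (1 - z) ^ (κ - 1) * f z + (1 - z) ^ κ * f' z =
          -((1 - z) ^ (κ - 1) * (κ * f z - (1 - z) * f' z)) := by rw [e]; ring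
      rw [this, neg_nonpos]
      refine mul_nonneg (Real.rpow_nonneg hpos.le _) ?_
      exact hnn.trans_eq t.symm
  have := anti (Set.left_mem_Ico.2 zero_lt_one) ⟨hz, hz1⟩ hz
  refine this.trans ?_
  have h0 : f 0 = 1 := by
    obtain ⟨m, rfl⟩ := Nat.exists_eq_succ_of_ne_zero hn.ne'
    simp only [f, Nat.succ_eq_add_one, Finset.sum_range_succ']
    simp [risingCoeff]
  simp [h0]

/-- The generating function of the geometric law of the number of collisions, applied to a
sequence that satisfies the recursion of the expected moments of the weights. -/
lemma tsum_geometric_mul_le {κ : ℝ≥0∞} (hκ : κ < 1) (t : ℝ≥0) {m : ℕ → ℝ≥0∞} (h0 : m 0 = 1)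
    (hm : ∀ n, m (n + 1) = m n * (κ * ((n : ℝ≥0∞) + 1)⁻¹ + (1 - ((n : ℝ≥0∞) + 1)⁻¹))) :
    ∑' n, ENNReal.ofReal (Real.exp (-(t : ℝ)) * (1 - Real.exp (-(t : ℝ))) ^ n) * m n ≤
      ENNReal.ofReal (Real.exp (t * (κ.toReal - 1))) := by
  have hκtop : κ ≠ ∞ := hκ.ne_top
  set k := κ.toReal with hk
  have hk0 : 0 ≤ k := ENNReal.toReal_nonneg
  have hmr : ∀ n, m n = ENNReal.ofReal (risingCoeff k n) := by
    intro n
    induction n with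
    | zero => simp [h0, risingCoeff]
    | succ n ih =>
      rw [hm, ih, risingCoeff, ENNReal.ofReal_mul (risingCoeff_nonneg hk0 n)]
      congr 1
      have hn : (0 : ℝ) < n + 1 := by positivity
      have e1 : ((n : ℝ≥0∞) + 1)⁻¹ = ENNReal.ofReal ((n + 1 : ℝ)⁻¹) := by
        rw [ENNReal.ofReal_inv_of_pos hn, ENNReal.ofReal_add (by positivity) zero_le_one,
          ENNReal.ofReal_natCast, ENNReal.ofReal_one]
      have hle : (n + 1 : ℝ)⁻¹ ≤ 1 := inv_le_one_of_one_le₀ (by linarith [n.cast_nonneg (α := ℝ)])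
      rw [e1, ← ENNReal.ofReal_toReal hκtop, ← hk, ← ENNReal.ofReal_mul hk0, ← ENNReal.ofReal_one,
        ← ENNReal.ofReal_sub _ (by positivity), ← ENNReal.ofReal_add (by positivity) (by linarith)]
      congr 1
      field_simp
      ring
  set z := 1 - Real.exp (-(t : ℝ)) with hz
  have hexp : 0 < Real.exp (-(t : ℝ)) := Real.exp_pos _
  have hz0 : 0 ≤ z := by
    have : Real.exp (-(t : ℝ)) ≤ 1 := Real.exp_le_one_iff.2 (by simp)
    linarith
  have hz1 : z < 1 := by linarith
  refine ENNReal.tsum_le_of_sum_range_le fun n => ?_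
  have hterm : ∀ j, 0 ≤ Real.exp (-(t : ℝ)) * z ^ j * risingCoeff k j := fun j =>
    mul_nonneg (mul_nonneg hexp.le (pow_nonneg hz0 _)) (risingCoeff_nonneg hk0 _)
  simp_rw [hmr]
  rw [Finset.sum_congr rfl fun j _ =>
    (ENNReal.ofReal_mul (mul_nonneg hexp.le (pow_nonneg hz0 j))).symm,
    ← ENNReal.ofReal_sum_of_nonneg fun j _ => hterm j]
  refine ENNReal.ofReal_le_ofReal ?_
  have hs := sum_risingCoeff_le hk0 n hz0 hz1
  have e1 : (1 - z) ^ k = Real.exp (-(t * k)) := by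
    rw [hz, sub_sub_cancel, ← Real.exp_mul]
    ring_nf
  have e2 : ∑ j ∈ Finset.range n, Real.exp (-(t : ℝ)) * z ^ j * risingCoeff k j =
      Real.exp (-(t : ℝ)) * ∑ j ∈ Finset.range n, risingCoeff k j * z ^ j := by
    rw [Finset.mul_sum]
    exact Finset.sum_congr rfl fun j _ => by ring
  have e3 : Real.exp (t * (k - 1)) = Real.exp (-(t : ℝ)) * Real.exp (t * k) := by
    rw [← Real.exp_add]; ring_nf
  rw [e2, e3]
  refine mul_le_mul_of_nonneg_left ?_ hexp.le
  rw [e1] at hs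
  have e4 : Real.exp (t * k) * Real.exp (-(t * k)) = 1 := by rw [← Real.exp_add]; simp
  calc _ = Real.exp (t * k) * (Real.exp (-(t * k)) *
        ∑ j ∈ Finset.range n, risingCoeff k j * z ^ j) := by rw [← mul_assoc, e4, one_mul]
    _ ≤ Real.exp (t * k) * 1 := by gcongr
    _ = _ := mul_one _

/-! ### Weighted sums of independent variables -/

section WeightedSums

lemma measurable_weightedSum (w : ℕ → ℝ) (n : ℕ) :
    Measurable fun x : ℕ → ℝ => ∑ j ∈ Finset.range n, w j * x j := by fun_prop

variable (δ : Measure ℝ) [IsProbabilityMeasure δ] (w : ℕ → ℝ)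

lemma indepFun_weightedSum (n : ℕ) :
    IndepFun (fun x : ℕ → ℝ => ∑ j ∈ Finset.range n, w j * x j) (fun x => x n)
      (Measure.infinitePi fun _ : ℕ => δ) := by
  have h := iIndepFun.indepFun_truncate (P := Measure.infinitePi fun _ : ℕ => δ)
    (f := fun j x => x j) (iIndepFun_infinitePi (X := fun _ x => x) fun _ => measurable_id)
    (fun j => measurable_pi_apply j) 0 n
  have h2 := h.comp (measurable_weightedSum w n) measurable_id
  have e : (fun x : ℕ → ℝ => ∑ j ∈ Finset.range n, w j * x j) =
      (fun x => ∑ j ∈ Finset.range n, w j * x j) ∘ fun x => truncate 0 n fun k => x k := by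
    ext x
    refine Finset.sum_congr rfl fun j hj => ?_
    simp [truncate, Finset.mem_range.1 hj]
  rw [e]
  exact h2

lemma charFun_weightedSum (n : ℕ) (t : ℝ) :
    charFun ((Measure.infinitePi fun _ : ℕ => δ).map fun x => ∑ j ∈ Finset.range n, w j * x j) t =
      ∏ j ∈ Finset.range n, charFun δ (w j * t) := by
  induction n with
  | zero => simp
  | succ n ih =>
    have h := (indepFun_weightedSum δ w n).comp measurable_id (measurable_const_mul (w n))
    simp_rw [Finset.sum_range_succ]
    have e := congrFun (h.charFun_map_fun_add_eq_mul
      (measurable_weightedSum w n).aemeasurable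
      ((measurable_const_mul (w n)).comp (measurable_pi_apply n)).aemeasurable) t
    simp only [Function.comp_def, Pi.mul_apply] at e
    rw [e, ih, Finset.prod_range_succ]
    congr 1
    have e2 : (Measure.infinitePi fun _ : ℕ => δ).map (fun x => w n * x n) =
        δ.map (fun y => w n * y) := by
      conv_rhs => rw [← Measure.infinitePi_map_eval (fun _ : ℕ => δ) n,
        Measure.map_map (by fun_prop) (by fun_prop)]
      rfl
    rw [e2, charFun_map_mul]

variable {δ}

/-- Growth bounds add up over independent summands. -/
lemma GrowthBound.weightedSum {γ : ℝ} (hγ : 0 < γ) {C : ℝ≥0∞} (h : GrowthBound γ δ C) (n : ℕ) :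
    ∫⁻ x, ‖∑ j ∈ Finset.range n, w j * x j‖ₑ ^ γ ∂(Measure.infinitePi fun _ : ℕ => δ) ≤
      (∑ j ∈ Finset.range n, ‖w j‖ₑ ^ γ) * C := by
  induction n with
  | zero => simp [hγ]
  | succ n ih =>
    have hj := (indepFun_iff_map_prod_eq_prod_map_map
      (measurable_weightedSum w n).aemeasurable (measurable_pi_apply n).aemeasurable).1
      (indepFun_weightedSum δ w n)
    rw [Measure.infinitePi_map_eval] at hj
    simp_rw [Finset.sum_range_succ, add_mul]
    have p : IsProbabilityMeasure ((Measure.infinitePi fun _ : ℕ => δ).map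
        fun x => ∑ j ∈ Finset.range n, w j * x j) :=
      Measure.isProbabilityMeasure_map (measurable_weightedSum w n).aemeasurable
    have hF : Measurable fun p : ℝ × ℝ => ‖p.1 + w n * p.2‖ₑ ^ γ := by fun_prop
    calc _ = ∫⁻ p, ‖p.1 + w n * p.2‖ₑ ^ γ ∂((Measure.infinitePi fun _ : ℕ => δ).map
          fun x => (∑ j ∈ Finset.range n, w j * x j, x n)) := by
          rw [lintegral_map hF (by fun_prop)]
      _ ≤ ∫⁻ s, (‖s‖ₑ ^ γ + ‖w n‖ₑ ^ γ * C) ∂((Measure.infinitePi fun _ : ℕ => δ).map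
          fun x => ∑ j ∈ Finset.range n, w j * x j) := by
          rw [hj, lintegral_prod _ hF.aemeasurable]
          exact lintegral_mono fun s => h.scaled hγ (w n) s
      _ ≤ _ := by
          rw [lintegral_add_right _ measurable_const, lintegral_const, measure_univ, mul_one,
            lintegral_map (by fun_prop) (by fun_prop)]
          gcongr

end WeightedSums

/-! ### The weighted sum over the leaves of the random tree -/

/-- The sum of the values `x j` at the leaves of a tree, weighted by the weights of the leaves. -/
noncomputable def leafSum (p : (((ℕ → ℕ) × (ℕ → ℝ × ℝ)) × ℕ) × (ℕ → ℝ)) : ℝ :=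
  ∑ j ∈ Finset.range (p.1.2 + 1), treeWeight p.1.1.1 p.1.1.2 p.1.2 j * p.2 j

lemma measurable_leafSum : Measurable leafSum := by
  have h : Measurable fun q : (((ℕ → ℕ) × (ℕ → ℝ × ℝ)) × (ℕ → ℝ)) × ℕ =>
      leafSum ((q.1.1, q.2), q.1.2) := by
    refine measurable_from_prod_countable_left fun n => ?_
    simp only [leafSum]
    exact Finset.measurable_fun_sum _ fun j _ => ((measurable_treeWeight n j).comp
      measurable_fst).mul ((measurable_pi_apply j).comp measurable_snd)
  have hg : Measurable fun p : (((ℕ → ℕ) × (ℕ → ℝ × ℝ)) × ℕ) × (ℕ → ℝ) =>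
      ((p.1.1, p.2), p.1.2) := by fun_prop
  exact h.comp hg

section Tree

variable {Ω : Type*} [MeasurableSpace Ω] {P : Measure Ω}
  {μ₀ : Measure ℝ} {ρ : Measure (ℝ × ℝ)} {X L R : ℕ → Ω → ℝ}
  {I : ℕ → Ω → ℕ} {N : ℝ≥0 → Ω → ℕ}

lemma IsMcKeanSystem.measurable_V (h : IsMcKeanSystem P μ₀ ρ X L R I N) (t : ℝ≥0) :
    Measurable (V X L R I N t) :=
  measurable_leafSum.comp
    ((h.measurable_treeData t).prodMk (measurable_pi_lambda _ h.measurable_X))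

/-- The values at the leaves are independent of the tree, so they may be put on a product space. -/
lemma IsMcKeanSystem.map_V [IsProbabilityMeasure P] (h : IsMcKeanSystem P μ₀ ρ X L R I N)
    [IsProbabilityMeasure μ₀]
    (t : ℝ≥0) :
    P.map (V X L R I N t) =
      ((P.map (treeData L R I N t)).prod (Measure.infinitePi fun _ : ℕ => μ₀)).map leafSum := by
  have hX : Measurable fun ω k => X k ω := measurable_pi_lambda _ h.measurable_X
  have e := (indepFun_iff_map_prod_eq_prod_map_map (h.measurable_treeData t).aemeasurable
    hX.aemeasurable).1 (h.indepFun_treeData_X t)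
  rw [h.iIndepFun_X.map_fun_eq_infinitePi_map h.measurable_X] at e
  simp_rw [h.law_X] at e
  rw [← e, Measure.map_map measurable_leafSum ((h.measurable_treeData t).prodMk hX)]
  rfl

lemma IsMcKeanSystem.map_treeData [IsProbabilityMeasure P]
    (h : IsMcKeanSystem P μ₀ ρ X L R I N) (t : ℝ≥0) :
    P.map (treeData L R I N t) =
      (P.map fun ω => (fun k => I k ω, fun k => (L k ω, R k ω))).prod (P.map (N t)) :=
  (indepFun_iff_map_prod_eq_prod_map_map (measurable_fst.comp
    (h.measurable_treeData t)).aemeasurable (h.measurable_N t).aemeasurable).1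
    (h.indepFun_shape_N t)

/-- If the leaves carry independent variables whose law is a fixed point of the smoothing
transformation, then this is also the law of the weighted sum. -/
lemma IsMcKeanSystem.map_leafSum_fixedPoint [IsProbabilityMeasure P]
    (h : IsMcKeanSystem P μ₀ ρ X L R I N)
    [IsProbabilityMeasure ρ] {ν : Measure ℝ} [IsProbabilityMeasure ν] (hν : smooth ρ ν = ν)
    (t : ℝ≥0) :
    ((P.map (treeData L R I N t)).prod (Measure.infinitePi fun _ : ℕ => ν)).map leafSum = ν := by
  have hshape : Measurable fun ω => ((fun k => I k ω, fun k => (L k ω, R k ω)) :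
    (ℕ → ℕ) × (ℕ → ℝ × ℝ)) := measurable_fst.comp (h.measurable_treeData t)
  have pD : IsProbabilityMeasure (P.map (treeData L R I N t)) :=
    Measure.isProbabilityMeasure_map (h.measurable_treeData t).aemeasurable
  have pN : IsProbabilityMeasure (P.map (N t)) :=
    Measure.isProbabilityMeasure_map (h.measurable_N t).aemeasurable
  have pS : IsProbabilityMeasure (P.map fun ω => ((fun k => I k ω, fun k => (L k ω, R k ω)) :
    (ℕ → ℕ) × (ℕ → ℝ × ℝ))) := Measure.isProbabilityMeasure_map hshape.aemeasurable
  have pM : IsProbabilityMeasure (((P.map (treeData L R I N t)).prod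
      (Measure.infinitePi fun _ : ℕ => ν)).map leafSum) :=
    Measure.isProbabilityMeasure_map measurable_leafSum.aemeasurable
  refine Measure.ext_of_charFun (funext fun u => ?_)
  have hφ : Measurable (charFun ν) := measurable_charFun
  have m1 : Measurable fun D : ((ℕ → ℕ) × (ℕ → ℝ × ℝ)) × ℕ =>
      ∏ j ∈ Finset.range (D.2 + 1), charFun ν (treeWeight D.1.1 D.1.2 D.2 j * u) := by
    refine measurable_from_prod_countable_left fun n => ?_
    exact Finset.measurable_fun_prod (Finset.range (n + 1)) fun j _ =>
      hφ.comp ((measurable_treeWeight n j).mul_const u)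
  have i1 : Integrable (fun D : ((ℕ → ℕ) × (ℕ → ℝ × ℝ)) × ℕ =>
      ∏ j ∈ Finset.range (D.2 + 1), charFun ν (treeWeight D.1.1 D.1.2 D.2 j * u))
      (P.map (treeData L R I N t)) := by
    refine (integrable_const (1 : ℝ)).mono' m1.aestronglyMeasurable (ae_of_all _ fun D => ?_)
    rw [norm_prod]
    exact Finset.prod_le_one (fun _ _ => norm_nonneg _) fun j _ => norm_charFun_le_one _
  have i2 : Integrable (fun p => Complex.exp (u * leafSum p * Complex.I))
      ((P.map (treeData L R I N t)).prod (Measure.infinitePi fun _ : ℕ => ν)) := by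
    have := measurable_leafSum
    refine (integrable_const (1 : ℝ)).mono' (by fun_prop) (ae_of_all _ fun p => ?_)
    rw [← Complex.ofReal_mul, Complex.norm_exp_ofReal_mul_I]
  calc charFun (((P.map (treeData L R I N t)).prod
          (Measure.infinitePi fun _ : ℕ => ν)).map leafSum) u
      = ∫ D, ∏ j ∈ Finset.range (D.2 + 1), charFun ν (treeWeight D.1.1 D.1.2 D.2 j * u)
          ∂(P.map (treeData L R I N t)) := by
        rw [charFun_apply_real, integral_map measurable_leafSum.aemeasurable (by fun_prop),
          integral_prod _ i2]
        refine integral_congr_ae (ae_of_all _ fun D => ?_)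
        have e := charFun_weightedSum ν (treeWeight D.1.1 D.1.2 D.2) (D.2 + 1) u
        rw [charFun_apply_real, integral_map (measurable_weightedSum _ _).aemeasurable
          (by fun_prop)] at e
        exact e
    _ = ∫ n, charFun ν u ∂(P.map (N t)) := by
        rw [h.map_treeData] at i1 ⊢
        rw [integral_prod_symm _ i1]
        refine integral_congr_ae (ae_of_all _ fun n => ?_)
        have e := h.integral_prod_treeWeight hφ (fun s => norm_charFun_le_one s)
          (fun s => by rw [← charFun_smooth, hν]) n u
        simp only
        rw [integral_map hshape.aemeasurable]
        · exact e
        · exact (m1.comp (measurable_id.prodMk measurable_const)).aestronglyMeasurable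
    _ = charFun ν u := by simp

/-- The growth bound of a law carries over to the weighted sum of independent variables with
this law, with a factor that decays exponentially in time. -/
lemma IsMcKeanSystem.lintegral_leafSum_le [IsProbabilityMeasure P]
    (h : IsMcKeanSystem P μ₀ ρ X L R I N)
    [IsProbabilityMeasure ρ] {γ : ℝ} (hγ : 0 < γ) (hρ : weightMoment γ ρ < 1) {δ : Measure ℝ}
    [IsProbabilityMeasure δ] {C : ℝ≥0∞} (hδ : GrowthBound γ δ C) (t : ℝ≥0) :
    ∫⁻ p, ‖leafSum p‖ₑ ^ γ
        ∂((P.map (treeData L R I N t)).prod (Measure.infinitePi fun _ : ℕ => δ)) ≤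
      ENNReal.ofReal (Real.exp (t * ((weightMoment γ ρ).toReal - 1))) * C := by
  have hshape : Measurable fun ω => ((fun k => I k ω, fun k => (L k ω, R k ω)) :
    (ℕ → ℕ) × (ℕ → ℝ × ℝ)) := measurable_fst.comp (h.measurable_treeData t)
  have pN : IsProbabilityMeasure (P.map (N t)) :=
    Measure.isProbabilityMeasure_map (h.measurable_N t).aemeasurable
  have pS : IsProbabilityMeasure (P.map fun ω => ((fun k => I k ω, fun k => (L k ω, R k ω)) :
    (ℕ → ℕ) × (ℕ → ℝ × ℝ))) := Measure.isProbabilityMeasure_map hshape.aemeasurable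
  have m1 : Measurable fun D : ((ℕ → ℕ) × (ℕ → ℝ × ℝ)) × ℕ => leafMoment γ D.1.1 D.1.2 D.2 :=
    measurable_from_prod_countable_left fun n => measurable_leafMoment γ n
  calc _ ≤ ∫⁻ D, leafMoment γ D.1.1 D.1.2 D.2 * C ∂(P.map (treeData L R I N t)) := by
        rw [lintegral_prod _ (by have := measurable_leafSum; fun_prop)]
        exact lintegral_mono fun D => hδ.weightedSum (treeWeight D.1.1 D.1.2 D.2) hγ (D.2 + 1)
    _ = (∫⁻ D, leafMoment γ D.1.1 D.1.2 D.2 ∂(P.map (treeData L R I N t))) * C :=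
        lintegral_mul_const _ m1
    _ ≤ _ := by
        gcongr
        rw [h.map_treeData, lintegral_prod_symm _ m1.aemeasurable, lintegral_countable']
        refine le_of_eq_of_le (tsum_congr fun n => ?_) (tsum_geometric_mul_le hρ t
          (m := fun n => ∫⁻ ω, leafMoment γ (fun k => I k ω) (fun k => (L k ω, R k ω)) n ∂P) ?_
          fun n => h.lintegral_leafMoment_succ hγ n)
        · rw [Measure.map_apply (h.measurable_N t) (measurableSet_singleton n),
            lintegral_map (measurable_leafMoment γ n) hshape, ← h.law_N, mul_comm]
          rfl
        · simp [leafMoment, treeWeight_zero]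

/-- A coupling of the initial law with a fixed point of the smoothing transformation, placed
independently at the leaves of the tree, couples `V_t` with the fixed point. -/
theorem IsMcKeanSystem.exists_coupling [IsProbabilityMeasure P]
    (h : IsMcKeanSystem P μ₀ ρ X L R I N)
    [IsProbabilityMeasure μ₀] [IsProbabilityMeasure ρ] {γ : ℝ} (hγ : 0 < γ)
    (hρ : weightMoment γ ρ < 1) {ν : Measure ℝ} [IsProbabilityMeasure ν] (hν : smooth ρ ν = ν)
    {π : Measure (ℝ × ℝ)} (hπ : IsCoupling π μ₀ ν) {C : ℝ≥0∞} (hC : GrowthBound γ (diffLaw π) C)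
    (t : ℝ≥0) :
    ∃ π', IsCoupling π' (P.map (V X L R I N t)) ν ∧
      cost γ π' ≤ ENNReal.ofReal (Real.exp (t * ((weightMoment γ ρ).toReal - 1))) * C := by
  have pπ := hπ.isProbabilityMeasure
  have pD : IsProbabilityMeasure (P.map (treeData L R I N t)) :=
    Measure.isProbabilityMeasure_map (h.measurable_treeData t).aemeasurable
  set M := P.map (treeData L R I N t) with hM
  -- applying `f` to the pair at each leaf replaces the copies of `π` by copies of `π.map f`
  have key : ∀ f : ℝ × ℝ → ℝ, Measurable f → IsProbabilityMeasure (π.map f) →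
      (M.prod (Measure.infinitePi fun _ : ℕ => π)).map
        (fun p => leafSum (p.1, fun j => f (p.2 j))) =
      (M.prod (Measure.infinitePi fun _ : ℕ => π.map f)).map leafSum := fun f hf _ => by
    rw [← Measure.infinitePi_map_pi (fun _ : ℕ => π) fun _ => hf]
    have e := Measure.map_prod_map M (Measure.infinitePi fun _ : ℕ => π) measurable_id
      (g := fun (x : ℕ → ℝ × ℝ) j => f (x j)) (by fun_prop)
    rw [Measure.map_id] at e
    rw [e, Measure.map_map measurable_leafSum (by fun_prop)]
    rfl
  have hmeas : ∀ f : ℝ × ℝ → ℝ, Measurable f → Measurable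
      fun p : (((ℕ → ℕ) × (ℕ → ℝ × ℝ)) × ℕ) × (ℕ → ℝ × ℝ) =>
        leafSum (p.1, fun j => f (p.2 j)) := fun f hf => measurable_leafSum.comp (by fun_prop)
  refine ⟨(M.prod (Measure.infinitePi fun _ : ℕ => π)).map fun p =>
    (leafSum (p.1, fun j => (p.2 j).1), leafSum (p.1, fun j => (p.2 j).2)), ?_, ?_⟩
  · have p1 : IsProbabilityMeasure (π.map Prod.fst) := by rw [hπ.1]; infer_instance
    have p2 : IsProbabilityMeasure (π.map Prod.snd) := by rw [hπ.2]; infer_instance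
    have e := isCoupling_map (Q := M.prod (Measure.infinitePi fun _ : ℕ => π))
      (hmeas _ measurable_fst) (hmeas _ measurable_snd)
    rw [key _ measurable_fst p1, key _ measurable_snd p2] at e
    simp_rw [hπ.1, hπ.2] at e
    rwa [h.map_leafSum_fixedPoint hν, ← h.map_V] at e
  · rw [cost_map γ (hmeas _ measurable_fst) (hmeas _ measurable_snd)]
    refine le_of_eq_of_le ?_ (h.lintegral_leafSum_le hγ hρ hC t)
    have hd : Measurable fun z : ℝ × ℝ => z.1 - z.2 := by fun_prop
    have e := congrArg (fun m : Measure ℝ => ∫⁻ x, ‖x‖ₑ ^ γ ∂m) (key _ hd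
      (inferInstanceAs (IsProbabilityMeasure (diffLaw π))))
    rw [lintegral_map (by fun_prop) (hmeas _ hd), lintegral_map (by fun_prop)
      measurable_leafSum] at e
    refine Eq.trans (lintegral_congr fun p => ?_) e
    simp only [leafSum, ← Finset.sum_sub_distrib, mul_sub]

end Tree

/-! ### Wasserstein distances and weak convergence -/

lemma wasserstein_eq_iInf_cost {γ : ℝ} (hγ : 0 ≤ γ) (μ ν : Measure ℝ) :
    wasserstein γ μ ν =
      ⨅ (π : Measure (ℝ × ℝ)) (_ : IsCoupling π μ ν), cost γ π ^ (1 / max γ 1) := by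
  simp only [wasserstein, cost, ofReal_abs_rpow hγ, IsCoupling]

lemma IsCoupling.wasserstein_le {γ : ℝ} (hγ : 0 ≤ γ) {π : Measure (ℝ × ℝ)} {μ ν : Measure ℝ}
    (h : IsCoupling π μ ν) : wasserstein γ μ ν ≤ cost γ π ^ (1 / max γ 1) := by
  rw [wasserstein_eq_iInf_cost hγ]
  exact iInf₂_le π h

lemma FiniteDist.wasserstein_lt_top {γ : ℝ} (hγ : 0 ≤ γ) {μ ν : Measure ℝ}
    (h : FiniteDist γ μ ν) : wasserstein γ μ ν < ∞ := by
  obtain ⟨π, hπ, hc⟩ := h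
  exact (hπ.wasserstein_le hγ).trans_lt (ENNReal.rpow_lt_top_of_nonneg (by positivity) hc.ne)

/-- A bounded Lipschitz function is Hölder continuous of every order `q ≤ 1`. -/
lemma enorm_sub_le_of_lipschitz {f : ℝ → ℝ} {C : ℝ} (hC : ∀ x y, dist (f x) (f y) ≤ C) {K : ℝ≥0}
    (hK : LipschitzWith K f) {q : ℝ} (hq : 0 ≤ q) (hq1 : q ≤ 1) (x y : ℝ) :
    ‖f x - f y‖ₑ ≤ max (ENNReal.ofReal C) K * ‖x - y‖ₑ ^ q := by
  rcases le_total ‖x - y‖ₑ 1 with h | h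
  · calc ‖f x - f y‖ₑ ≤ K * ‖x - y‖ₑ := by
          simpa only [edist_eq_enorm_sub] using hK x y
      _ = K * ‖x - y‖ₑ ^ (1 : ℝ) := by rw [ENNReal.rpow_one]
      _ ≤ _ := mul_le_mul' (le_max_right _ _) (ENNReal.rpow_le_rpow_of_exponent_ge h hq1)
  · calc ‖f x - f y‖ₑ ≤ ENNReal.ofReal C := by
          rw [← ofReal_norm, ← dist_eq_norm]
          exact ENNReal.ofReal_le_ofReal (hC x y)
      _ = ENNReal.ofReal C * 1 := (mul_one _).symm
      _ ≤ _ := mul_le_mul' (le_max_left _ _) (by simpa using ENNReal.rpow_le_rpow h hq)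

/-- Convergence of the transport cost to zero implies weak convergence. -/
lemma tendsto_of_tendsto_cost {γ : ℝ} (hγ : 0 < γ) {ι : Type*} {l : Filter ι}
    [l.IsCountablyGenerated] {μ : ι → ProbabilityMeasure ℝ} {ν : ProbabilityMeasure ℝ}
    {π : ι → Measure (ℝ × ℝ)} (hπ : ∀ i, IsCoupling (π i) (μ i) ν)
    (h : Tendsto (fun i => cost γ (π i)) l (𝓝 0)) : Tendsto μ l (𝓝 ν) := by
  rw [tendsto_iff_forall_lipschitz_integral_tendsto]
  rintro f ⟨C, hC⟩ ⟨K, hK⟩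
  have hf : Measurable f := hK.continuous.measurable
  have hint : ∀ m : Measure ℝ, IsProbabilityMeasure m → Integrable f m := fun m _ => by
    refine Integrable.of_bound hf.aestronglyMeasurable (‖f 0‖ + C) (ae_of_all _ fun x => ?_)
    have h1 := hC x 0
    rw [dist_eq_norm] at h1
    linarith [norm_le_norm_add_norm_sub' (f x) (f 0)]
  set M : ℝ≥0∞ := max (ENNReal.ofReal C) K with hM
  have hMtop : M ≠ ∞ := by simp [hM]
  have bound : ∀ i, edist (∫ x, f x ∂(μ i : Measure ℝ)) (∫ x, f x ∂(ν : Measure ℝ)) ≤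
      M * cost γ (π i) ^ (1 / max γ 1) := by
    intro i
    have hp := (hπ i).isProbabilityMeasure
    have i1 := hint (μ i) inferInstance
    have i2 := hint ν inferInstance
    rw [← (hπ i).1, integrable_map_measure (by fun_prop) (by fun_prop)] at i1
    rw [← (hπ i).2, integrable_map_measure (by fun_prop) (by fun_prop)] at i2
    rw [← (hπ i).1, ← (hπ i).2, integral_map (by fun_prop) (by fun_prop),
      integral_map (by fun_prop) (by fun_prop), edist_eq_enorm_sub]
    have e := integral_sub i1 i2
    simp only [Function.comp_def] at e
    rw [← e]
    calc _ ≤ ∫⁻ z, ‖f z.1 - f z.2‖ₑ ∂(π i) := enorm_integral_le_lintegral_enorm _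
      _ ≤ ∫⁻ z, M * ‖z.1 - z.2‖ₑ ^ min γ 1 ∂(π i) := lintegral_mono fun z =>
          enorm_sub_le_of_lipschitz hC hK (le_min hγ.le zero_le_one) (min_le_right _ _) _ _
      _ = M * ∫⁻ z, ‖z.1 - z.2‖ₑ ^ min γ 1 ∂(π i) := lintegral_const_mul _ (by fun_prop)
      _ ≤ _ := by
          gcongr
          exact lintegral_rpow_min_le (f := fun z : ℝ × ℝ => z.1 - z.2) (by fun_prop)
  rw [tendsto_iff_edist_tendsto_0]
  have hp : 0 < 1 / max γ 1 := by positivity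
  have t1 : Tendsto (fun i => M * cost γ (π i) ^ (1 / max γ 1)) l (𝓝 0) := by
    have := ENNReal.Tendsto.const_mul ((ENNReal.continuous_rpow_const (y := 1 / max γ 1)).tendsto
      0 |>.comp h) (Or.inr hMtop)
    simpa [ENNReal.zero_rpow_of_pos hp, Function.comp_def] using this
  exact tendsto_of_tendsto_of_tendsto_of_le_of_le tendsto_const_nhds t1 (fun _ => zero_le) bound

/-! ### Exponential convergence -/

section Convergence

variable {Ω : Type*} [MeasurableSpace Ω] {P : Measure Ω} [IsProbabilityMeasure P]
  {μ₀ : Measure ℝ} [IsProbabilityMeasure μ₀] {ρ : Measure (ℝ × ℝ)} [IsProbabilityMeasure ρ]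
  {X L R : ℕ → Ω → ℝ} {I : ℕ → Ω → ℕ} {N : ℝ≥0 → Ω → ℕ}

lemma IsMcKeanSystem.exists_coupling_cost_le (h : IsMcKeanSystem P μ₀ ρ X L R I N) {γ : ℝ}
    (hγ : 0 < γ) (hγ2 : γ ≤ 2) (hρ : weightMoment γ ρ < 1) {ν : Measure ℝ}
    [IsProbabilityMeasure ν] (hν : smooth ρ ν = ν)
    (hmean : 1 < γ → Integrable (fun x => x) μ₀ ∧ Integrable (fun x => x) ν ∧
      ∫ x, x ∂μ₀ = ∫ x, x ∂ν) {π : Measure (ℝ × ℝ)} (hπ : IsCoupling π μ₀ ν) (t : ℝ≥0) :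
    ∃ π', IsCoupling π' (P.map (V X L R I N t)) ν ∧
      cost γ π' ≤ ENNReal.ofReal (Real.exp (t * ((weightMoment γ ρ).toReal - 1))) *
        ((if γ ≤ 1 then 1 else 2) * cost γ π) := by
  have hp := hπ.isProbabilityMeasure
  rw [← lintegral_diffLaw]
  refine h.exists_coupling hγ hρ hν hπ (growthBound_of_moment hγ hγ2 _ fun h1 => ?_) t
  obtain ⟨m1, m2, m3⟩ := hmean h1
  rw [integral_diffLaw hπ m1 m2, m3, sub_self]

/-- The infimum over the couplings of the initial law with the fixed point, each of which gives a
coupling at time `t`. The exponent `1 / max γ 1` turns the factors `2` and `e ^ (t (κ - 1))` of the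
costs into the constants of the estimate. -/
theorem IsMcKeanSystem.wasserstein_V_le (h : IsMcKeanSystem P μ₀ ρ X L R I N) {γ : ℝ}
    (hγ : 0 < γ) (hγ2 : γ ≤ 2) (hρ : weightMoment γ ρ < 1) {ν : Measure ℝ}
    [IsProbabilityMeasure ν] (hν : smooth ρ ν = ν)
    (hmean : 1 < γ → Integrable (fun x => x) μ₀ ∧ Integrable (fun x => x) ν ∧
      ∫ x, x ∂μ₀ = ∫ x, x ∂ν) (t : ℝ≥0) :
    wasserstein γ (P.map (V X L R I N t)) ν ≤
      ENNReal.ofReal (if γ ≤ 1 then 1 else (2 : ℝ) ^ (1 / γ)) * wasserstein γ μ₀ ν *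
        ENNReal.ofReal (Real.exp (-((if γ ≤ 1 then 1 else 1 / γ) * t *
          (1 - (weightMoment γ ρ).toReal)))) := by
  set A : ℝ≥0∞ := ENNReal.ofReal (if γ ≤ 1 then 1 else (2 : ℝ) ^ (1 / γ)) with hA
  set E : ℝ≥0∞ := ENNReal.ofReal (Real.exp (-((if γ ≤ 1 then 1 else 1 / γ) * t *
    (1 - (weightMoment γ ρ).toReal)))) with hE
  have hp0 : 0 ≤ 1 / max γ 1 := by positivity
  have hA' : A = (if γ ≤ 1 then 1 else 2) ^ (1 / max γ 1) := by
    rw [hA]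
    split_ifs with h1
    · simp
    · rw [max_eq_left (not_le.1 h1).le, ← ENNReal.ofReal_rpow_of_pos two_pos]
      simp
  have hE' : E = ENNReal.ofReal (Real.exp (t * ((weightMoment γ ρ).toReal - 1))) ^
      (1 / max γ 1) := by
    rw [hE, ENNReal.ofReal_rpow_of_pos (Real.exp_pos _), ← Real.exp_mul]
    split_ifs with h1
    · rw [max_eq_right h1]
      congr 2
      ring
    · rw [max_eq_left (not_le.1 h1).le]
      congr 2
      ring
  have hA0 : A ≠ 0 := by
    rw [hA]
    split_ifs
    · simp
    · simpa using Real.rpow_pos_of_pos two_pos _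
  have hE0 : E ≠ 0 := by simpa [hE] using Real.exp_pos _
  have key : ∀ π, IsCoupling π μ₀ ν → wasserstein γ (P.map (V X L R I N t)) ν ≤
      A * E * cost γ π ^ (1 / max γ 1) := fun π hπ => by
    obtain ⟨π', hπ', hc⟩ := h.exists_coupling_cost_le hγ hγ2 hρ hν hmean hπ t
    refine (hπ'.wasserstein_le hγ.le).trans ((ENNReal.rpow_le_rpow hc hp0).trans_eq ?_)
    rw [ENNReal.mul_rpow_of_nonneg _ _ hp0, ENNReal.mul_rpow_of_nonneg _ _ hp0, ← hA', ← hE',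
      ← mul_assoc, mul_comm E]
  rw [mul_right_comm, ← ENNReal.div_le_iff' (mul_ne_zero hA0 hE0)
    (ENNReal.mul_ne_top ENNReal.ofReal_ne_top ENNReal.ofReal_ne_top),
    wasserstein_eq_iInf_cost hγ.le μ₀]
  exact le_iInf₂ fun π hπ => ENNReal.div_le_of_le_mul' (key π hπ)

theorem IsMcKeanSystem.tendstoInDistribution_V (h : IsMcKeanSystem P μ₀ ρ X L R I N) {γ : ℝ}
    (hγ : 0 < γ) (hγ2 : γ ≤ 2) (hρ : weightMoment γ ρ < 1) (ν : ProbabilityMeasure ℝ)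
    (hν : smooth ρ ν = ν)
    (hmean : 1 < γ → Integrable (fun x => x) μ₀ ∧ Integrable (fun x => x) (ν : Measure ℝ) ∧
      ∫ x, x ∂μ₀ = ∫ x, x ∂(ν : Measure ℝ)) (hfin : FiniteDist γ μ₀ ν) :
    TendstoInDistribution (V X L R I N) atTop (id : ℝ → ℝ) (fun _ => P) (ν : Measure ℝ) := by
  obtain ⟨π, hπ, hc⟩ := hfin
  choose π' hπ' hc' using h.exists_coupling_cost_le hγ hγ2 hρ hν hmean hπ
  refine ⟨fun t => (h.measurable_V t).aemeasurable, aemeasurable_id, ?_⟩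
  refine tendsto_of_tendsto_cost hγ (π := π') (fun t => ?_) ?_
  · simpa only [ProbabilityMeasure.coe_mk, Measure.map_id] using hπ' t
  · have hk : (weightMoment γ ρ).toReal - 1 < 0 := by
      have := (ENNReal.toReal_lt_toReal hρ.ne_top ENNReal.one_ne_top).2 hρ
      simp only [ENNReal.toReal_one] at this
      linarith
    have t1 : Tendsto (fun t : ℝ≥0 => Real.exp (t * ((weightMoment γ ρ).toReal - 1))) atTop
        (𝓝 0) :=
      Real.tendsto_exp_atBot.comp
        (NNReal.tendsto_coe_atTop.2 tendsto_id |>.atTop_mul_const_of_neg hk)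
    have t2 := ENNReal.Tendsto.mul_const (b := (if γ ≤ 1 then 1 else 2) * cost γ π)
      (ENNReal.tendsto_ofReal t1) (Or.inr (ENNReal.mul_ne_top (by split_ifs <;> simp) hc.ne))
    rw [ENNReal.ofReal_zero, zero_mul] at t2
    exact tendsto_of_tendsto_of_tendsto_of_le_of_le tendsto_const_nhds t2 (fun _ => zero_le) hc'

end Convergence

/-! ### Translation of the hypotheses -/

section Hypotheses

variable {Ω₀ : Type*} [MeasurableSpace Ω₀] {P₀ : Measure Ω₀} {L₀ R₀ : Ω₀ → ℝ}

lemma weightMoment_map (hL₀ : Measurable L₀) (hR₀ : Measurable R₀) (hL : ∀ᵐ ω ∂P₀, 0 ≤ L₀ ω)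
    (hR : ∀ᵐ ω ∂P₀, 0 ≤ R₀ ω) {s : ℝ} (hs : 0 ≤ s) :
    weightMoment s (P₀.map fun ω => (L₀ ω, R₀ ω)) =
      ∫⁻ ω, ENNReal.ofReal (L₀ ω ^ s + R₀ ω ^ s) ∂P₀ := by
  rw [weightMoment, lintegral_map (by fun_prop) (by fun_prop)]
  refine lintegral_congr_ae ?_
  filter_upwards [hL, hR] with ω h1 h2
  rw [ENNReal.ofReal_add (Real.rpow_nonneg h1 s) (Real.rpow_nonneg h2 s), ← ofReal_abs_rpow hs,
    ← ofReal_abs_rpow hs, abs_of_nonneg h1, abs_of_nonneg h2]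

/-- The convention `0 ^ 0 = 0` of `powZ` plays no role for positive exponents. -/
lemma S_eq_weightMoment_sub_one (hL₀ : Measurable L₀) (hR₀ : Measurable R₀)
    (hL : ∀ᵐ ω ∂P₀, 0 ≤ L₀ ω) (hR : ∀ᵐ ω ∂P₀, 0 ≤ R₀ ω) {s : ℝ} (hs : 0 < s) :
    S P₀ L₀ R₀ s = (weightMoment s (P₀.map fun ω => (L₀ ω, R₀ ω)) : EReal) - 1 := by
  have e : ∀ x, powZ x s = x ^ s := fun x => by
    rw [powZ]
    split_ifs with h
    · rw [h, Real.zero_rpow hs.ne']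
    · rfl
  rw [S, weightMoment_map hL₀ hR₀ hL hR hs.le]
  simp only [e]

lemma lt_one_of_coe_sub_one_neg {κ : ℝ≥0∞} (h : (κ : EReal) - 1 < 0) :
    κ < 1 ∧ |((κ : EReal) - 1).toReal| = 1 - κ.toReal := by
  have hκ : κ ≠ ∞ := by
    rintro rfl
    rw [EReal.coe_ennreal_top, show (1 : EReal) = ((1 : ℝ) : EReal) from rfl,
      EReal.top_sub_coe] at h
    exact absurd h (by simp)
  lift κ to ℝ≥0 using hκ
  have e : ((κ : ℝ≥0∞) : EReal) - 1 = (((κ : ℝ) - 1 : ℝ) : EReal) := by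
    rw [EReal.coe_sub, EReal.coe_one]
    rfl
  rw [e] at h ⊢
  have h1 : (κ : ℝ) - 1 < 0 := by exact_mod_cast h
  refine ⟨?_, ?_⟩
  · exact_mod_cast (by linarith : (κ : ℝ) < 1)
  · rw [EReal.toReal_coe, abs_of_neg h1, ENNReal.coe_toReal]
    ring

end Hypotheses

lemma integral_weights_eq_one {ρ : Measure (ℝ × ℝ)} (hρ0 : ∀ᵐ w ∂ρ, 0 ≤ w.1 ∧ 0 ≤ w.2)
    (hρ1 : weightMoment 1 ρ = 1) : ∫ w, (w.1 + w.2) ∂ρ = 1 := by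
  rw [integral_eq_lintegral_of_nonneg_ae
    (by filter_upwards [hρ0] with w hw; exact add_nonneg hw.1 hw.2) (by fun_prop)]
  have e : ∫⁻ w, ENNReal.ofReal (w.1 + w.2) ∂ρ = weightMoment 1 ρ := by
    refine lintegral_congr_ae ?_
    filter_upwards [hρ0] with w hw
    rw [ENNReal.ofReal_add hw.1 hw.2, ENNReal.rpow_one, ENNReal.rpow_one,
      Real.enorm_of_nonneg hw.1, Real.enorm_of_nonneg hw.2]
  rw [e, hρ1, ENNReal.toReal_one]

lemma quantileExponent_mul_lt_one {α γ ε c : ℝ} (hα : 0 < α) (hε : 0 < ε) (hε1 : ε < 1)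
    (hγε : γ < α / (1 - ε)) (h : c = 0 → γ < α + ε) : quantileExponent α ε c * γ < 1 := by
  rw [quantileExponent]
  split_ifs with hc
  · rw [one_div_mul_eq_div, div_lt_one (by linarith)]
    exact h hc
  · rw [lt_div_iff₀ (by linarith)] at hγε
    rw [div_mul_eq_mul_div, div_lt_one hα, mul_comm]
    exact hγε

end KacModel

theorem lemma3p7
    -- the random vector `(L, R)` and the initial condition `X₀`
    {Ω₀ : Type*} [MeasurableSpace Ω₀] (P₀ : Measure Ω₀) [IsProbabilityMeasure P₀]
    (X₀ L₀ R₀ : Ω₀ → ℝ)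
    (hX₀ : Measurable X₀) (hL₀ : Measurable L₀) (hR₀ : Measurable R₀)
    (hL₀_nonneg : ∀ᵐ ω ∂P₀, 0 ≤ L₀ ω) (hR₀_nonneg : ∀ᵐ ω ∂P₀, 0 ≤ R₀ ω)
    -- the probability space that carries the process `V_t`
    {Ω : Type*} [MeasurableSpace Ω] (P : Measure Ω) [IsProbabilityMeasure P]
    (X L R : ℕ → Ω → ℝ) (I : ℕ → Ω → ℕ) (N : ℝ≥0 → Ω → ℕ)
    (hsys : KacModel.IsMcKeanSystem P (P₀.map X₀) (P₀.map (fun ω => (L₀ ω, R₀ ω))) X L R I N)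
    -- the exponents
    (α γ : ℝ) (hα : 0 < α) (hα2 : α ≤ 2)
    (hLR : ∫⁻ ω, ENNReal.ofReal (L₀ ω ^ α + R₀ ω ^ α) ∂P₀ = 1)
    (hγ : (1 ≤ α ∧ α < γ ∧ γ ≤ 2) ∨ (α < γ ∧ γ ≤ 1))
    (hS : KacModel.S P₀ L₀ R₀ γ < 0)
    -- moments of the initial condition
    (hcenter : 1 < α → ∫ ω, X₀ ω ∂P₀ = 0)
    (hmoment : α = 1 → Integrable (fun ω => |X₀ ω| ^ γ) P₀)
    -- refined tail bounds on the distribution function of the initial condition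
    (hγα : γ < 2 * α)
    (cp cm K ε : ℝ) (hK : 0 < K) (hε : 0 < ε) (hε1 : ε < 1)
    (htail_pos : ∀ x : ℝ, 0 < x →
      |1 - cp * x ^ (-α) - cdf (P₀.map X₀) x| < K * x ^ (-(α + ε)))
    (htail_neg : ∀ x : ℝ, x < 0 →
      |cdf (P₀.map X₀) x - cm * (-x) ^ (-α)| < K * (-x) ^ (-(α + ε)))
    (hnondeg : 1 < α → (0 < cp ∧ 0 < cm) ∨ γ < α + ε)
    (hγε : γ < α / (1 - ε)) :
    -- `ν` is the law of the limit in distribution `V_∞` of `V_t`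
    ∃ ν : ProbabilityMeasure ℝ,
      TendstoInDistribution (KacModel.V X L R I N) atTop (id : ℝ → ℝ) (fun _ => P)
        (ν : Measure ℝ) ∧
      KacModel.wasserstein γ (P₀.map X₀) ν < ∞ ∧
      ∀ t : ℝ≥0,
        KacModel.wasserstein γ (P.map (KacModel.V X L R I N t)) ν ≤
          ENNReal.ofReal (if γ ≤ 1 then 1 else (2 : ℝ) ^ (1 / γ)) *
            KacModel.wasserstein γ (P₀.map X₀) ν *
            ENNReal.ofReal (Real.exp (-((if γ ≤ 1 then 1 else 1 / γ) * t *
              |(KacModel.S P₀ L₀ R₀ γ).toReal|))) ∧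
        ENNReal.ofReal (if γ ≤ 1 then 1 else (2 : ℝ) ^ (1 / γ)) *
            KacModel.wasserstein γ (P₀.map X₀) ν *
            ENNReal.ofReal (Real.exp (-((if γ ≤ 1 then 1 else 1 / γ) * t *
              |(KacModel.S P₀ L₀ R₀ γ).toReal|))) < ∞ := by
  have hγ0 : 0 < γ := by rcases hγ with h | h <;> linarith [h.1]
  have hγ2 : γ ≤ 2 := by rcases hγ with h | h <;> linarith [h.2]
  have hαγ : α < γ := by rcases hγ with h | h; exacts [h.2.1, h.1]
  have hpμ : IsProbabilityMeasure (P₀.map X₀) := Measure.isProbabilityMeasure_map hX₀.aemeasurable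
  have hpair : Measurable fun ω => (L₀ ω, R₀ ω) := hL₀.prodMk hR₀
  have hpρ : IsProbabilityMeasure (P₀.map fun ω => (L₀ ω, R₀ ω)) :=
    Measure.isProbabilityMeasure_map hpair.aemeasurable
  rw [← KacModel.weightMoment_map hL₀ hR₀ hL₀_nonneg hR₀_nonneg hα.le] at hLR
  have hSκ := KacModel.S_eq_weightMoment_sub_one hL₀ hR₀ hL₀_nonneg hR₀_nonneg hγ0
  rw [hSκ] at hS ⊢
  obtain ⟨hρ, habs⟩ := KacModel.lt_one_of_coe_sub_one_neg hS
  rw [habs]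
  have hρ0 : ∀ᵐ w ∂(P₀.map fun ω => (L₀ ω, R₀ ω)), 0 ≤ w.1 ∧ 0 ≤ w.2 := by
    rw [ae_map_iff hpair.aemeasurable (by measurability)]
    exact hL₀_nonneg.and hR₀_nonneg
  -- the one-step distance is finite, and the smoothing transformation preserves the mean
  have hstep : KacModel.FiniteDist γ (P₀.map X₀)
        (KacModel.smooth (P₀.map fun ω => (L₀ ω, R₀ ω)) (P₀.map X₀)) ∧
      (1 < γ → Integrable (fun x => x) (P₀.map X₀) ∧
        (∫ w, (w.1 + w.2) ∂(P₀.map fun ω => (L₀ ω, R₀ ω))) * ∫ x, x ∂(P₀.map X₀) =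
          ∫ x, x ∂(P₀.map X₀)) := by
    rcases eq_or_ne α 1 with rfl | hα1
    · have hm : ∫⁻ x, ‖x‖ₑ ^ γ ∂(P₀.map X₀) < ∞ := by
        rw [lintegral_map (by fun_prop) hX₀]
        simp_rw [← KacModel.ofReal_abs_rpow hγ0.le]
        have := (hmoment rfl).lintegral_lt_top
        exact this
      refine ⟨KacModel.finiteDist_smooth_of_moment hγ0 (hρ.trans ENNReal.one_lt_top) hm,
        fun h1 => ⟨KacModel.integrable_of_lintegral_rpow_lt_top h1.le measurable_id hm, ?_⟩⟩
      rw [KacModel.integral_weights_eq_one hρ0 hLR, one_mul]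
    · have hβ : ∀ c, (1 < α → 0 < c ∨ γ < α + ε) →
          KacModel.quantileExponent α ε c * γ < 1 := fun c hc => by
        refine KacModel.quantileExponent_mul_lt_one hα hε hε1 hγε fun hc0 => ?_
        rcases lt_or_gt_of_ne hα1 with h1 | h1
        · -- here `γ ≤ 1`, so that `γ < α + γ * ε ≤ α + ε`
          have hγ1 : γ ≤ 1 := by rcases hγ with h | h; exacts [absurd h.1 (not_le.2 h1), h.2]
          rw [lt_div_iff₀ (by linarith)] at hγε
          nlinarith
        · exact (hc h1).resolve_left (by rw [hc0]; exact lt_irrefl 0)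
      obtain ⟨h1, h2⟩ := KacModel.finiteDist_smooth_of_tails hα hαγ hγα hK hε
        (hβ cp fun h => (hnondeg h).imp_left And.left)
        (hβ cm fun h => (hnondeg h).imp_left And.right) htail_pos htail_neg hρ0 hLR
        (hρ.trans ENNReal.one_lt_top)
      refine ⟨h1, fun hγ1 => ?_⟩
      have hα1' : 1 < α := by
        rcases hγ with h | h
        exacts [lt_of_le_of_ne h.1 hα1.symm, absurd h.2 (not_le.2 hγ1)]
      refine ⟨h2 hα1', ?_⟩
      rw [integral_map hX₀.aemeasurable (by fun_prop), hcenter hα1', mul_zero]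
  obtain ⟨ν, hpν, hν, hfin, hmean⟩ :=
    KacModel.exists_smooth_fixedPoint hγ0 hγ2 hρ hstep.1 hstep.2
  have hmean' := fun h1 : 1 < γ => And.intro (hstep.2 h1).1 (hmean h1)
  have hW := hfin.wasserstein_lt_top hγ0.le
  exact ⟨⟨ν, hpν⟩, hsys.tendstoInDistribution_V hγ0 hγ2 hρ ⟨ν, hpν⟩ hν hmean' hfin, hW,
    fun t => ⟨hsys.wasserstein_V_le hγ0 hγ2 hρ hν hmean' t,
      ENNReal.mul_lt_top (ENNReal.mul_lt_top ENNReal.ofReal_lt_top hW) ENNReal.ofReal_lt_top⟩⟩
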